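/- Let $n\ge 2$, $\mathfrak g=\mathfrak{sl}_n(\mathbb C)=\mathfrak n^+\oplus\mathfrak h\oplus\mathfrak n^-$ with $\mathfrak h$ the diagonal and $\mathfrak n^{\pm}$ the strictly upper/lower triangular matrices, simple roots $\alpha_1,\dots,\alpha_{n-1}$, positive roots $R^+=\{\alpha_{i,j}=\alpha_i+\cdots+\alpha_j : 1\le i\le j\le n-1\}$, $\mathfrak{sl}_2$-triples $e_\alpha,h_\alpha,f_\alpha$ ($\alpha\in R^+$) of matrix units, and $P^+$ the set of dominant integral weights. For $\tau\in P^+$ let $V(\tau)$ be the simple finite-dimensional $\mathfrak g$-module of highest weight $\tau$. Let $\lambda_1,\lambda_2\in P^+$, $\lambda=\lambda_1+\lambda_2$, and $a_\alpha=\min\{\lambda_1(h_\alpha),\lambda_2(h_\alpha)\}$ for $\alpha\in R^+$. Let $F=F_{\lambda_1,\lambda_2}$ be the largest quotient which is integrable over $\mathfrak g=\mathfrak g\otimes 1$ (i.e. on which all $e_\alpha,f_\alpha$ act locally nilpotently) of the cyclic $\mathfrak g\otimes\mathbb C[t]$-module with generator $\mathbb 1$ and relations $$(\mathfrak n^+\otimes\mathbb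 C[t])\mathbb 1=0,\quad (h\otimes p)\mathbb 1=p(0)\lambda(h)\mathbb 1\ (h\in\mathfrak h,\ p\in\mathbb C[t]),\quad (\mathfrak n^-\otimes t^2\mathbb C[t])\mathbb 1=0,\quad (f_\alpha\otimes t)^{a_\alpha+1}\mathbb 1=0\ (\alpha\in R^+).$$ For $s\ge0$ let $F^s=U(\mathfrak g\otimes\mathbb C[t])^s\,\mathbb 1$, where $U(\mathfrak g\otimes\mathbb C[t])^s$ is the component of $t$-degree $s$; it is a $\mathfrak g$-submodule. For $\mathbf m=(m_\alpha)\in\mathbb Z_{\ge0}^{R^+}$ put $\deg\mathbf m=\sum_\alpha m_\alpha$, $\mathrm{wt}(\mathbf m)=\sum_\alpha m_\alpha\alpha$, $\mathrm{ht}(\mathbf m)=\sum_{i\le j} m_{\alpha_{i,j}}(j-i+1)$, and $\mathbf f^{\mathbf m}\mathbb 1=\prod_\alpha(f_\alpha\otimes t)^{m_\alpha}\mathbb 1\in F$ (the order of the factors is irrelevant). Order $R^+$ by $\alpha_{i,j}\le\alpha_{k,l}$ iff $i<k$, or $i=k$ and $j\le l$, and order $\mathbb Z_{\ge0}^{R^+}$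 lexicographically: $\mathbf m<\mathbf n$ iff $m_\alpha<n_\alpha$ for the least root $\alpha$ with $m_\alpha\ne n_\alpha$. A Dyck path is a nonempty sequence $(\beta_1,\dots,\beta_r)$ of positive roots such that $\beta_q=\alpha_{k,l}$ implies $\beta_{q+1}\in\{\alpha_{k+1,l},\alpha_{k,l+1}\}$; if $\beta_1=\alpha_{k_1,l_1}$ and $\beta_r=\alpha_{k_r,l_r}$, its base root is $\beta(\mathbf p)=\alpha_{k_1,l_r}$. Let $S(\lambda_1,\lambda_2)$ be the set of $\mathbf s\in\mathbb Z_{\ge0}^{R^+}$ with $\sum_{\alpha\in\mathbf p}s_\alpha\le a_{\beta(\mathbf p)}$ for every Dyck path $\mathbf p$. For $\mathbf n\in\mathbb Z_{\ge0}^{R^+}$ with $\deg\mathbf n=s$ and $\mathrm{ht}(\mathbf n)=\ell$ let $\mathcal F^{<\ell}(F^s)$ be the $\mathfrak g$-submodule of $F$ generated by all $\mathbf f^{\mathbf m}\mathbb 1$ with $\deg\mathbf m=s$ and $\mathrm{ht}(\mathbf m)<\ell$, and let $\mathcal F_{\le\mathbf n}$ be the $\mathfrak g$-submodule generated by $\mathcal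 F^{<\ell}(F^s)$ and all $\mathbf f^{\mathbf m}\mathbb 1$ with $\deg\mathbf m=s$, $\mathrm{ht}(\mathbf m)=\ell$, $\mathbf m\le\mathbf n$. Let $S_{hw}(\lambda_1,\lambda_2)$ be the set of $\mathbf n\in S(\lambda_1,\lambda_2)$ for which $$\mathfrak G_{\mathbf n}=\mathcal F_{\le\mathbf n}\Big/\Big(\mathcal F^{<\ell}(F^s)+\sum_{\mathbf m<\mathbf n,\ \deg\mathbf m=s,\ \mathrm{ht}(\mathbf m)=\ell}\mathcal F_{\le\mathbf m}\Big)$$ is nonzero. Then for all $\lambda_1,\lambda_2,\tau\in P^+$ the following Hom spaces are finite-dimensional, and $$\dim\operatorname{Hom}_{\mathfrak{sl}_n}(F_{\lambda_1,\lambda_2},V(\tau))=\#\{\mathbf s\in S_{hw}(\lambda_1,\lambda_2) : \mathrm{wt}(\mathbf s)=\lambda_1+\lambda_2-\tau\},$$ and for every $s\ge0$ $$\dim\operatorname{Hom}_{\mathfrak{sl}_n}(F^s_{\lambda_1,\lambda_2},V(\tau))=\#\{\mathbf s\in S_{hw}(\lambda_1,\lambda_2) : \mathrm{wt}(\mathbf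 s)=\lambda_1+\lambda_2-\tau,\ \deg(\mathbf s)=s\}.$$ In particular $$\dim\operatorname{Hom}_{\mathfrak{sl}_n}(F_{\lambda_1,\lambda_2},V(\tau))\le\#\{\mathbf s\in S(\lambda_1,\lambda_2) : \mathrm{wt}(\mathbf s)=\lambda_1+\lambda_2-\tau\}.$$ -/

import Mathlib

open scoped TensorProduct

noncomputable section

namespace SlCurrent

/-! ## The Lie algebra `sl_n`, its positive roots and weights -/

/-- `sl_n(ℂ)`, the traceless complex `n × n` matrices. -/
abbrev Sl (n : ℕ) := LieAlgebra.SpecialLinear.sl (Fin n) ℂ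

/-- The positive roots of `sl_n`. The pair `(i, j)`, `i < j` in `Fin n`, stands for
`ε_i - ε_j`, that is for the sum of the simple roots `ε_k - ε_{k+1}`, `i ≤ k < j`. With simple roots
`α_1, …, α_{n-1}` numbered from one, `α_{k,l} = α_k + ⋯ + α_l` is the pair `(k - 1, l)`.
The roots are ordered lexicographically: `α_{i,j} ≤ α_{k,l}` iff `i < k`, or `i = k` and `j ≤ l`. -/
abbrev PosRoot (n : ℕ) := {p : Fin n ×ₗ Fin n // (ofLex p).1 < (ofLex p).2}

variable {n : ℕ}

/-- The index `i` of the root `ε_i - ε_j`. -/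
def PosRoot.src (α : PosRoot n) : Fin n := (ofLex α.1).1

/-- The index `j` of the root `ε_i - ε_j`. -/
def PosRoot.tgt (α : PosRoot n) : Fin n := (ofLex α.1).2

theorem PosRoot.src_lt_tgt (α : PosRoot n) : α.src < α.tgt := α.2

/-- The height of a positive root: the number of simple roots of which it is the sum. -/
def PosRoot.height (α : PosRoot n) : ℕ := (α.tgt : ℕ) - (α.src : ℕ)

/-- The root vector `e_α = E_{ij}` of `α = ε_i - ε_j`. -/
def eVec (α : PosRoot n) : Sl n :=
  LieAlgebra.SpecialLinear.single α.src α.tgt α.src_lt_tgt.ne 1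

/-- The root vector `f_α = E_{ji}` of weight `-α`, `α = ε_i - ε_j`. -/
def fVec (α : PosRoot n) : Sl n :=
  LieAlgebra.SpecialLinear.single α.tgt α.src α.src_lt_tgt.ne' 1

/-- The Cartan subalgebra `𝔥` of traceless diagonal matrices (as a vector space). -/
def cartan (n : ℕ) : Submodule ℂ (Sl n) where
  carrier := {A | ∀ i j, i ≠ j → A.1 i j = 0}
  zero_mem' := fun _ _ _ => rfl
  add_mem' := by
    intro A B hA hB i j hij
    simp [hA i j hij, hB i j hij]
  smul_mem' := by
    intro c A hA i j hij
    simp [hA i j hij]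

/-- The functional `ε_i` on `𝔥`: the `i`-th diagonal entry. -/
def eps (i : Fin n) : Module.Dual ℂ (cartan n) where
  toFun h := h.1.1 i i
  map_add' _ _ := rfl
  map_smul' _ _ := rfl

/-- A positive root as a functional on `𝔥`. -/
def PosRoot.toDual (α : PosRoot n) : Module.Dual ℂ (cartan n) := eps α.src - eps α.tgt

/-- The coroot `h_α = E_{ii} - E_{jj}` of `α = ε_i - ε_j`. -/
def coroot (α : PosRoot n) : cartan n :=
  ⟨LieAlgebra.SpecialLinear.singleSubSingle α.src α.tgt 1, by
    intro i j hij
    have h1 : ∀ k : Fin n, ¬ (k = i ∧ k = j) := fun k hk => hij (hk.1.symm.trans hk.2)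
    simp [h1]⟩

/-- Dominant integral weights `∑ m_k ω_k`, given by their coefficients `m_k ∈ ℕ` on the `n - 1`
fundamental weights. -/
abbrev DomWeight (n : ℕ) := Fin (n - 1) → ℕ

/-- The fundamental weight `ω_k = ∑_{i ≤ k} ε_i` (indices start at zero) as a functional on `𝔥`. -/
def fundWeight (k : Fin (n - 1)) : Module.Dual ℂ (cartan n) :=
  ∑ i : Fin n, if (i : ℕ) ≤ (k : ℕ) then eps i else 0

/-- A dominant integral weight as a functional on `𝔥`. -/
def DomWeight.toDual (wt : DomWeight n) : Module.Dual ℂ (cartan n) :=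
  ∑ k, wt k • fundWeight k

/-- The natural number `λ(h_α)`; for `α = ε_i - ε_j` it is `∑_{i ≤ k < j} m_k`. -/
def DomWeight.pairing (wt : DomWeight n) (α : PosRoot n) : ℕ :=
  ∑ k : Fin (n - 1), if (α.src : ℕ) ≤ (k : ℕ) ∧ (k : ℕ) < (α.tgt : ℕ) then wt k else 0

theorem eps_coroot (i : Fin n) (α : PosRoot n) :
    eps i (coroot α) = (if i = α.src then 1 else 0) - (if i = α.tgt then 1 else 0) := by
  change (LieAlgebra.SpecialLinear.singleSubSingle α.src α.tgt (1 : ℂ)).val i i = _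
  simp [Matrix.single_apply, eq_comm]

theorem fundWeight_coroot (k : Fin (n - 1)) (α : PosRoot n) :
    fundWeight k (coroot α) =
      if (α.src : ℕ) ≤ (k : ℕ) ∧ (k : ℕ) < (α.tgt : ℕ) then 1 else 0 := by
  have h : (α.src : ℕ) < (α.tgt : ℕ) := α.src_lt_tgt
  have h1 : fundWeight k (coroot α) = ∑ i : Fin n, if (i : ℕ) ≤ (k : ℕ) then
      ((if i = α.src then (1 : ℂ) else 0) - (if i = α.tgt then 1 else 0)) else 0 := by
    rw [fundWeight, LinearMap.sum_apply]
    refine Finset.sum_congr rfl fun i _ => ?_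
    split_ifs <;> simp_all [eps_coroot]
  have h2 : ∀ i : Fin n, (if (i : ℕ) ≤ (k : ℕ) then
      ((if i = α.src then (1 : ℂ) else 0) - (if i = α.tgt then 1 else 0)) else 0) =
      (if i = α.src then (if (α.src : ℕ) ≤ (k : ℕ) then 1 else 0) else 0) -
      (if i = α.tgt then (if (α.tgt : ℕ) ≤ (k : ℕ) then 1 else 0) else 0) := by
    intro i
    have h5 := α.src_lt_tgt.ne
    by_cases h3 : i = α.src
    · simp [h3, h5]
    · by_cases h4 : i = α.tgt
      · simp only [h4, h5.symm, if_true, if_false, zero_sub]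
        split_ifs <;> simp
      · simp [h3, h4]
  simp only [h1, h2, Finset.sum_sub_distrib, Finset.sum_ite_eq', Finset.mem_univ, if_true]
  split_ifs <;> first | omega | simp

/-- The explicit formula for `λ(h_α)` agrees with the evaluation of the functional. -/
theorem DomWeight.toDual_coroot (wt : DomWeight n) (α : PosRoot n) :
    wt.toDual (coroot α) = (wt.pairing α : ℂ) := by
  simp [DomWeight.toDual, DomWeight.pairing, fundWeight_coroot]

/-- `V` is a module of highest weight `wt`, when `V` is simple: it contains a nonzero vector
killed by `𝔫⁺` on which `𝔥` acts through `wt`. -/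
def HasHighestWeight (V : Type*) [AddCommGroup V] [Module ℂ V] [LieRingModule (Sl n) V]
    (wt : DomWeight n) : Prop :=
  ∃ v : V, v ≠ 0 ∧ (∀ α : PosRoot n, ⁅eVec α, v⁆ = 0) ∧
    ∀ h : cartan n, ⁅(h : Sl n), v⁆ = wt.toDual h • v

/-! ## The current algebra and the module `F` -/

/-- The current algebra `sl_n ⊗ ℂ[t]`, with `[p ⊗ x, q ⊗ y] = p q ⊗ [x, y]`. -/
abbrev Current (n : ℕ) := Polynomial ℂ ⊗[ℂ] Sl n

/-- The enveloping algebra `U(sl_n ⊗ ℂ[t])`. -/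
abbrev UCurrent (n : ℕ) := UniversalEnvelopingAlgebra ℂ (Current n)

/-- The element `x ⊗ p` of `U(sl_n ⊗ ℂ[t])`. -/
def cur (x : Sl n) (p : Polynomial ℂ) : UCurrent n :=
  UniversalEnvelopingAlgebra.ι ℂ (p ⊗ₜ[ℂ] x)

/-- The left ideal `J` for which `U(sl_n ⊗ ℂ[t]) / J` is the module induced from `M`.
The first two families say that `𝔟 ⊗ ℂ[t]` acts on the generator through evaluation at `t = 0`
and the weight `λ₁ + λ₂` (this gives the module induced from the one-dimensional
`𝔟 ⊗ ℂ[t]`-module); the last two families are the relations that cut out `M`. -/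
def relIdeal (wt₁ wt₂ : DomWeight n) : Submodule (UCurrent n) (UCurrent n) :=
  Submodule.span (UCurrent n)
    ({u | ∃ (α : PosRoot n) (p : Polynomial ℂ), u = cur (eVec α) p} ∪
     {u | ∃ (h : cartan n) (p : Polynomial ℂ),
        u = cur (h : Sl n) p -
          algebraMap ℂ (UCurrent n) (p.eval 0 * (wt₁ + wt₂ : DomWeight n).toDual h)} ∪
     {u | ∃ (α : PosRoot n) (p : Polynomial ℂ), u = cur (fVec α) (Polynomial.X ^ 2 * p)} ∪
     {u | ∃ α : PosRoot n,
        u = cur (fVec α) Polynomial.X ^ (min (wt₁.pairing α) (wt₂.pairing α) + 1)})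

/-- A module over `sl_n ⊗ ℂ[t]` is integrable (as an `sl_n`-module) if all root vectors of
`sl_n = sl_n ⊗ 1` act locally nilpotently. -/
def IsIntegrable (n : ℕ) (V : Type*) [AddCommGroup V] [Module (UCurrent n) V] : Prop :=
  ∀ (α : PosRoot n) (v : V),
    (∃ k : ℕ, cur (eVec α) 1 ^ k • v = 0) ∧ (∃ k : ℕ, cur (fVec α) 1 ^ k • v = 0)

/-- The kernel of the maximal integrable quotient: the intersection of all submodules with an
integrable quotient. -/
def integrableKernel (n : ℕ) (V : Type*) [AddCommGroup V] [Module (UCurrent n) V] :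
    Submodule (UCurrent n) V :=
  sInf {N | IsIntegrable n (V ⧸ N)}

/-- The `sl_n ⊗ ℂ[t]`-module `F_{λ₁,λ₂}`: the maximal integrable quotient of the module induced
from `M_{λ₁,λ₂}`. -/
def FModule (wt₁ wt₂ : DomWeight n) : Type :=
  (UCurrent n ⧸ relIdeal wt₁ wt₂) ⧸ integrableKernel n (UCurrent n ⧸ relIdeal wt₁ wt₂)

namespace FModule

variable (wt₁ wt₂ : DomWeight n)

instance : AddCommGroup (FModule wt₁ wt₂) :=
  inferInstanceAs (AddCommGroup
    ((UCurrent n ⧸ relIdeal wt₁ wt₂) ⧸ integrableKernel n (UCurrent n ⧸ relIdeal wt₁ wt₂)))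

instance : Module (UCurrent n) (FModule wt₁ wt₂) :=
  inferInstanceAs (Module (UCurrent n)
    ((UCurrent n ⧸ relIdeal wt₁ wt₂) ⧸ integrableKernel n (UCurrent n ⧸ relIdeal wt₁ wt₂)))

instance : Module ℂ (FModule wt₁ wt₂) :=
  inferInstanceAs (Module ℂ
    ((UCurrent n ⧸ relIdeal wt₁ wt₂) ⧸ integrableKernel n (UCurrent n ⧸ relIdeal wt₁ wt₂)))

instance : IsScalarTower ℂ (UCurrent n) (FModule wt₁ wt₂) :=
  inferInstanceAs (IsScalarTower ℂ (UCurrent n)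
    ((UCurrent n ⧸ relIdeal wt₁ wt₂) ⧸ integrableKernel n (UCurrent n ⧸ relIdeal wt₁ wt₂)))

/-- The canonical generator `𝟙` of `F_{λ₁,λ₂}`. -/
def one : FModule wt₁ wt₂ :=
  Submodule.Quotient.mk (Submodule.Quotient.mk (1 : UCurrent n))

end FModule

theorem cur_add_left (x y : Sl n) (p : Polynomial ℂ) : cur (x + y) p = cur x p + cur y p := by
  simp only [cur, TensorProduct.tmul_add, map_add]

theorem cur_smul_left (c : ℂ) (x : Sl n) (p : Polynomial ℂ) : cur (c • x) p = c • cur x p := by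
  simp only [cur, TensorProduct.tmul_smul, map_smul]

theorem cur_lie_one (x y : Sl n) : cur ⁅x, y⁆ 1 = cur x 1 * cur y 1 - cur y 1 * cur x 1 := by
  have h : ((1 : Polynomial ℂ) ⊗ₜ[ℂ] ⁅x, y⁆ : Current n) = ⁅(1 : Polynomial ℂ) ⊗ₜ[ℂ] x,
      (1 : Polynomial ℂ) ⊗ₜ[ℂ] y⁆ := by
    rw [LieAlgebra.ExtendScalars.bracket_tmul, mul_one]
  let _ : LieRing (UCurrent n) := LieRing.ofAssociativeRing
  rw [cur, h]
  exact (LieHom.map_lie (UniversalEnvelopingAlgebra.ι ℂ) _ _).trans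
    (LieRing.of_associative_ring_bracket _ _)

/-- `sl_n` acts on `F_{λ₁,λ₂}` through `x ↦ x ⊗ 1`. -/
instance (wt₁ wt₂ : DomWeight n) : LieRingModule (Sl n) (FModule wt₁ wt₂) where
  bracket x v := cur x 1 • v
  add_lie x y v := by
    change cur (x + y) 1 • v = cur x 1 • v + cur y 1 • v
    rw [cur_add_left, add_smul]
  lie_add x v w := smul_add _ v w
  leibniz_lie x y v := by
    change cur x 1 • cur y 1 • v = cur ⁅x, y⁆ 1 • v + cur y 1 • cur x 1 • v
    rw [cur_lie_one, sub_smul, mul_smul, mul_smul, sub_add_cancel]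

theorem FModule.lie_def {wt₁ wt₂ : DomWeight n} (x : Sl n) (v : FModule wt₁ wt₂) :
    ⁅x, v⁆ = cur x 1 • v := rfl

instance (wt₁ wt₂ : DomWeight n) : LieModule ℂ (Sl n) (FModule wt₁ wt₂) where
  smul_lie c x v := by
    rw [FModule.lie_def, FModule.lie_def, cur_smul_left, smul_assoc]
  lie_smul c x v := by
    rw [FModule.lie_def, FModule.lie_def, ← algebraMap_smul (UCurrent n) c v,
      ← algebraMap_smul (UCurrent n) c (cur x 1 • v), ← mul_smul, ← mul_smul,
      Algebra.commutes]

/-! ## The grading by powers of `t` -/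

/-- The degree `s` component of `U(sl_n ⊗ ℂ[t])`, spanned by the products
`(x₁ ⊗ t^{r₁}) ⋯ (x_k ⊗ t^{r_k})` with `r₁ + ⋯ + r_k = s`. -/
def uGraded (n : ℕ) (s : ℕ) : Submodule ℂ (UCurrent n) :=
  Submodule.span ℂ {u | ∃ l : List (Sl n × ℕ), (l.map Prod.snd).sum = s ∧
    u = (l.map fun y => cur y.1 (Polynomial.X ^ y.2)).prod}

/-- The graded component `F^s_{λ₁,λ₂} = U(sl_n ⊗ ℂ[t])^s . 𝟙`, an `sl_n`-submodule. -/
def FModule.graded (wt₁ wt₂ : DomWeight n) (s : ℕ) : LieSubmodule ℂ (Sl n) (FModule wt₁ wt₂) where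
  toSubmodule := (uGraded n s).map
    ((LinearMap.toSpanSingleton (UCurrent n) (FModule wt₁ wt₂) (one wt₁ wt₂)).restrictScalars ℂ)
  lie_mem := by
    rintro x _ ⟨u, hu, rfl⟩
    refine ⟨cur x 1 * u, ?_, ?_⟩
    · change u ∈ uGraded n s at hu
      change cur x 1 * u ∈ uGraded n s
      induction hu using Submodule.span_induction with
      | mem u hu =>
        obtain ⟨l, hl, rfl⟩ := hu
        exact Submodule.subset_span ⟨(x, 0) :: l, by simpa using hl, by simp⟩
      | zero => rw [mul_zero]; exact Submodule.zero_mem _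
      | add u v _ _ hu hv => rw [mul_add]; exact Submodule.add_mem _ hu hv
      | smul c u _ hu => rw [mul_smul_comm]; exact Submodule.smul_mem _ c hu
    · simp [FModule.lie_def, mul_smul]

/-! ## Dyck paths and the polytope -/

/-- One step of a Dyck path: from `α_{k,l}` to `α_{k+1,l}` or `α_{k,l+1}`. -/
def DyckStep (α β : PosRoot n) : Prop :=
  ((β.src : ℕ) = α.src + 1 ∧ β.tgt = α.tgt) ∨ (β.src = α.src ∧ (β.tgt : ℕ) = α.tgt + 1)

/-- Dyck paths: nonempty sequences of positive roots `β₁, …, β_s` moving by Dyck steps. -/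
structure DyckPath (n : ℕ) where
  roots : List (PosRoot n)
  ne_nil : roots ≠ []
  isChain : roots.IsChain DyckStep

theorem src_head_le_src_getLast : ∀ (l : List (PosRoot n)) (hl : l ≠ []),
    l.IsChain DyckStep → (l.head hl).src ≤ (l.getLast hl).src
  | [_], _, _ => le_rfl
  | α :: β :: l, _, h => by
    rw [List.isChain_cons_cons] at h
    have h2 := src_head_le_src_getLast (β :: l) (by simp) h.2
    have h1 : α.src ≤ β.src := by
      rcases h.1 with h1 | h1
      · exact Fin.le_def.2 (by omega)
      · exact h1.1.ge
    simpa using h1.trans h2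

/-- The base root `α_{k₁,l_s}` of a Dyck path from `α_{k₁,l₁}` to `α_{k_s,l_s}`. -/
def DyckPath.baseRoot (p : DyckPath n) : PosRoot n :=
  ⟨toLex ((p.roots.head p.ne_nil).src, (p.roots.getLast p.ne_nil).tgt),
    (src_head_le_src_getLast p.roots p.ne_nil p.isChain).trans_lt (PosRoot.src_lt_tgt _)⟩

/-- The polytope cut out by the Dyck path inequalities `∑_{α ∈ p} x_α ≤ a_{β(p)}`. -/
def dyckPolytope (a : PosRoot n → ℕ) : Set (PosRoot n → ℝ) :=
  {x | ∀ p : DyckPath n, (p.roots.map x).sum ≤ a p.baseRoot}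

/-- The points of the Dyck path polytope with nonnegative integer coordinates. -/
def dyckPoints (a : PosRoot n → ℕ) : Set (PosRoot n → ℕ) :=
  {s | (fun α => (s α : ℝ)) ∈ dyckPolytope a}

/-- `S(λ₁, λ₂)`: the points for `a_α = min {λ₁(h_α), λ₂(h_α)}`. -/
def pointSet (wt₁ wt₂ : DomWeight n) : Set (PosRoot n → ℕ) :=
  dyckPoints fun α => min (wt₁.pairing α) (wt₂.pairing α)

/-- The degree `∑ s_α` of a point. -/
def deg (s : PosRoot n → ℕ) : ℕ := ∑ α, s α

/-- The weight `∑ s_α α` of a point. -/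
def weight (s : PosRoot n → ℕ) : Module.Dual ℂ (cartan n) := ∑ α, s α • α.toDual

/-- The height of the weight of a point. -/
def ht (s : PosRoot n → ℕ) : ℕ := ∑ α, s α * α.height

/-! ## The filtration and the highest weight points -/

/-- The vector `∏_α (f_α ⊗ t)^{m_α} . 𝟙` of `F_{λ₁,λ₂}`. The factors are written in increasing
order of the roots; the order does not matter since `𝔫⁻ ⊗ t² ℂ[t]` acts by zero. -/
def monomialVec (wt₁ wt₂ : DomWeight n) (m : PosRoot n → ℕ) : FModule wt₁ wt₂ :=
  (((Finset.univ : Finset (PosRoot n)).sort (· ≤ ·)).map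
    fun α => cur (fVec α) Polynomial.X ^ m α).prod • FModule.one wt₁ wt₂

/-- The `sl_n`-submodule `U(sl_n) U(𝔫⁻ ⊗ t)^{s, <l} . 𝟙`, generated by the monomials of degree `s`
and height less than `l`. -/
def filtLT (wt₁ wt₂ : DomWeight n) (s l : ℕ) : LieSubmodule ℂ (Sl n) (FModule wt₁ wt₂) :=
  LieSubmodule.lieSpan ℂ (Sl n) {v | ∃ m, deg m = s ∧ ht m < l ∧ v = monomialVec wt₁ wt₂ m}

/-- The `sl_n`-submodule generated by the monomials `m` with the degree of `b` which have smaller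
height than `b`, or the same height as `b` and `m ≤ b` in the lexicographic order on exponents. -/
def filtLE (wt₁ wt₂ : DomWeight n) (b : PosRoot n → ℕ) :
    LieSubmodule ℂ (Sl n) (FModule wt₁ wt₂) :=
  filtLT wt₁ wt₂ (deg b) (ht b) ⊔
    LieSubmodule.lieSpan ℂ (Sl n)
      {v | ∃ m, deg m = deg b ∧ ht m = ht b ∧ toLex m ≤ toLex b ∧ v = monomialVec wt₁ wt₂ m}

/-- The sum of the term of strictly smaller height and of all terms of the refined filtration for
exponents of the same degree and height that precede `b`. -/
def filtPrev (wt₁ wt₂ : DomWeight n) (b : PosRoot n → ℕ) :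
    LieSubmodule ℂ (Sl n) (FModule wt₁ wt₂) :=
  filtLT wt₁ wt₂ (deg b) (ht b) ⊔
    ⨆ m ∈ {m : PosRoot n → ℕ | deg m = deg b ∧ ht m = ht b ∧ toLex m < toLex b},
      filtLE wt₁ wt₂ m

/-- The graded component of the refined filtration of `F_{λ₁,λ₂}` at the exponent `b`. -/
abbrev GrComponent (wt₁ wt₂ : DomWeight n) (b : PosRoot n → ℕ) : Type :=
  filtLE wt₁ wt₂ b ⧸ (filtPrev wt₁ wt₂ b).comap (filtLE wt₁ wt₂ b).incl

/-- `S_hw(λ₁, λ₂)`: the points of `S(λ₁, λ₂)` with nonzero graded component. -/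
def hwPoints (wt₁ wt₂ : DomWeight n) : Set (PosRoot n → ℕ) :=
  {b | b ∈ pointSet wt₁ wt₂ ∧ Nontrivial (GrComponent wt₁ wt₂ b)}

end SlCurrent

end

/-! On `F` the `f_α` act locally nilpotently, and `F` is the sum of its weight spaces, all of whose
weights lie below `λ₁ + λ₂`. Such a module is semisimple, so multiplicities can be read off from any
filtration whose subquotients are zero or simple. List the exponents by degree, then height, then
lexicographically. Applying `e_β` to a monomial vector keeps the degree and lowers the height
(`eVec_lie_monomialVec_mem`), so each monomial vector is singular modulo the submodule generated by
its predecessors. The subquotient at `b` is therefore zero or simple of highest weight `λ₁ + λ₂ -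
wt(b)`, and the multiplicity of `V(τ)` is the number of nonzero steps of weight `τ`
(`finrank_hom_eq`).

Semisimplicity comes from the Casimir operator. Its scalar separates a dominant weight from all
dominant weights strictly above it (`casimirScalar_ne`), so a polynomial in the Casimir operator
turns a vector that is singular modulo a submodule into a genuinely singular one
(`exists_singular_lift`), and singular weight vectors generate simple submodules (`isAtom_lieSpan`).
The homomorphisms to `V(τ)` which detect single steps are constructed through their graphs in `M ×
V` (`exists_hom`).

Exponents outside `S(λ₁, λ₂)` give zero steps by a straightening law (`monomialVec_mem_span_lt`).
From `(f_β ⊗ t)^N 𝟙 = 0` with `N > a_β`, repeated application of raising operators yields, up to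
nonzero scalars, the vanishing of the sum of all divided monomials with prescribed row and column
sums (`marginSum_eq_zero`). An exponent supported on a Dyck path is the lexicographically largest
one with its row and column sums, so its monomial is expressed through smaller ones; multiplying by
the remaining factors treats a general exponent. Hence `S_hw` is exactly the set of nonzero steps
and is finite.

For a fixed degree only the exponents of that degree are used. For all of `F` the lower degrees are
added to each filtration step, which changes nothing because distinct degrees are independent: they
are eigenspaces of `t ↦ 2t` (`iSupIndep_graded`). -/

noncomputable section

namespace SlCurrent

variable {n : ℕ}

/-! ## Matrix units in `sl_n` -/

/-- The traceless part `E_{ij} - δ_{ij} / n` of a matrix unit. -/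
def matUnit (i j : Fin n) : Sl n :=
  ⟨Matrix.single i j 1 - (if i = j then (n : ℂ)⁻¹ else 0) • (1 : Matrix (Fin n) (Fin n) ℂ), by
    have hn : (n : ℂ) ≠ 0 := Nat.cast_ne_zero.2 (Fin.pos i).ne'
    change Matrix.trace (_ : Matrix (Fin n) (Fin n) ℂ) = 0
    rw [Matrix.trace_sub, Matrix.trace_smul, Matrix.trace_one, Fintype.card_fin]
    rcases eq_or_ne i j with rfl | h
    · simp [hn]
    · simp [h]⟩

theorem val_matUnit (i j : Fin n) : (matUnit i j).1 =
    Matrix.single i j 1 - (if i = j then (n : ℂ)⁻¹ else 0) • 1 := rfl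

theorem eVec_eq (α : PosRoot n) : eVec α = matUnit α.src α.tgt := by
  apply Subtype.ext
  simp [val_matUnit, α.src_lt_tgt.ne, eVec]

theorem fVec_eq (α : PosRoot n) : fVec α = matUnit α.tgt α.src := by
  apply Subtype.ext
  simp [val_matUnit, α.src_lt_tgt.ne', fVec]

/-- Scalar corrections disappear in a commutator. On the right they occur only when `j = k` and `i =
l` both hold, and then they cancel between the two terms. -/
theorem matUnit_lie (i j k l : Fin n) : ⁅matUnit i j, matUnit k l⁆ =
    (if j = k then matUnit i l else 0) - (if i = l then matUnit k j else 0) := by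
  apply Subtype.ext
  rw [LieAlgebra.SpecialLinear.sl_bracket]
  have h0 : ∀ (A B : Matrix (Fin n) (Fin n) ℂ) (c d : ℂ),
      (A - c • 1) * (B - d • 1) - (B - d • 1) * (A - c • 1) = A * B - B * A := by
    intro A B c d
    simp only [sub_mul, mul_sub, smul_mul_assoc, mul_smul_comm, one_mul, mul_one, smul_sub, smul_smul,
      mul_comm d c]
    abel
  have h1 : ∀ i j k l : Fin n, Matrix.single i j (1 : ℂ) * Matrix.single k l 1 =
      if j = k then Matrix.single i l 1 else 0 := by
    intro i j k l
    split_ifs with h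
    · subst h; simp
    · simp [h]
  rw [val_matUnit, val_matUnit, h0, h1, h1]
  by_cases hjk : j = k <;> by_cases hil : i = l
  · subst hjk hil
    simp [val_matUnit]
  · simp [hil, Ne.symm hil, hjk, val_matUnit]
  · simp [hil, Ne.symm hjk, hjk, val_matUnit]
  · simp [hjk, hil, Ne.symm hil]

/-- The corrections add up to a multiple of the trace of `A`, which is zero. The traceless parts
thus span without a choice of basis for the diagonal part. -/
theorem sum_smul_matUnit (A : Sl n) : ∑ i, ∑ j, A.1 i j • matUnit i j = A := by
  have htr : Matrix.trace A.1 = 0 := A.2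
  apply Subtype.ext
  have h : ((∑ i, ∑ j, A.1 i j • matUnit i j : Sl n) : Matrix (Fin n) (Fin n) ℂ) =
      ∑ i, ∑ j, A.1 i j • (matUnit i j).1 := by
    simp
  rw [h]
  have h2 : ∑ i, ∑ j, (A.1 i j * if i = j then (n : ℂ)⁻¹ else 0) = 0 := by
    simp only [mul_ite, mul_zero, Finset.sum_ite_eq, Finset.mem_univ, if_true, ← Finset.sum_mul]
    rw [show ∑ i, A.1 i i = 0 from htr, zero_mul]
  simp only [val_matUnit, smul_sub, Finset.sum_sub_distrib, smul_smul, ← Finset.sum_smul, h2,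
    zero_smul, sub_zero, Matrix.smul_single, smul_eq_mul, mul_one]
  exact (Matrix.matrix_eq_sum_single A.1).symm

/-- The traceless part of a diagonal matrix unit, as an element of `𝔥`. -/
def diagUnit (i : Fin n) : cartan n :=
  ⟨matUnit i i, by
    intro k l hkl
    have : ¬ (i = k ∧ i = l) := fun h => hkl (h.1.symm.trans h.2)
    simp [val_matUnit, hkl, this]⟩

theorem eps_diagUnit (k i : Fin n) :
    eps k (diagUnit i) = (if k = i then 1 else 0) - (n : ℂ)⁻¹ := by
  change (matUnit i i).1 k k = _
  simp [val_matUnit, Matrix.single_apply, eq_comm]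

theorem sum_smul_diagUnit (h : cartan n) : ∑ i, eps i h • diagUnit i = h := by
  apply Subtype.ext
  conv_rhs => rw [← sum_smul_matUnit (h : Sl n)]
  rw [Submodule.coe_sum]
  refine Finset.sum_congr rfl fun i _ => ?_
  rw [Finset.sum_eq_single i]
  · rfl
  · intro j _ hj
    rw [h.2 i j hj.symm, zero_smul]
  · simp

theorem toDual_apply (α : PosRoot n) (h : cartan n) : α.toDual h = eps α.src h - eps α.tgt h := rfl

theorem toDual_diagUnit (α : PosRoot n) (i : Fin n) : α.toDual (diagUnit i) =
    (if i = α.src then 1 else 0) - (if i = α.tgt then 1 else 0) := by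
  simp [toDual_apply, eps_diagUnit, eq_comm]

theorem coroot_eq (α : PosRoot n) : coroot α = diagUnit α.src - diagUnit α.tgt := by
  apply Subtype.ext
  apply Subtype.ext
  change Matrix.single α.src α.src 1 - Matrix.single α.tgt α.tgt 1 =
    (matUnit α.src α.src).1 - (matUnit α.tgt α.tgt).1
  simp [val_matUnit]

theorem diagUnit_lie (i k l : Fin n) : ⁅(diagUnit i : Sl n), matUnit k l⁆ =
    ((if k = i then (1 : ℂ) else 0) - (if l = i then 1 else 0)) • matUnit k l := by
  change ⁅matUnit i i, _⁆ = _
  rw [matUnit_lie]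
  by_cases h1 : k = i <;> by_cases h2 : l = i <;> simp [h1, h2, Ne.symm]

theorem cartan_lie (h : cartan n) (k l : Fin n) :
    ⁅(h : Sl n), matUnit k l⁆ = (eps k h - eps l h) • matUnit k l := by
  conv_lhs => rw [← sum_smul_diagUnit h]
  rw [Submodule.coe_sum, sum_lie]
  simp only [Submodule.coe_smul, smul_lie, diagUnit_lie, smul_smul, ← Finset.sum_smul, mul_sub,
    mul_ite, mul_one, mul_zero, Finset.sum_sub_distrib, Finset.sum_ite_eq, Finset.mem_univ, if_true]

theorem cartan_lie_eVec (h : cartan n) (α : PosRoot n) :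
    ⁅(h : Sl n), eVec α⁆ = α.toDual h • eVec α := by
  rw [eVec_eq, cartan_lie]; rfl

theorem cartan_lie_fVec (h : cartan n) (α : PosRoot n) :
    ⁅(h : Sl n), fVec α⁆ = (-α.toDual h) • fVec α := by
  rw [fVec_eq, cartan_lie, toDual_apply, neg_sub]

theorem eVec_lie_fVec (α : PosRoot n) : ⁅eVec α, fVec α⁆ = (coroot α : Sl n) := by
  rw [eVec_eq, fVec_eq, matUnit_lie, coroot_eq]
  simp [diagUnit]

theorem toDual_coroot_self (α : PosRoot n) : α.toDual (coroot α) = 2 := by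
  have h := α.src_lt_tgt.ne
  simp only [coroot_eq, map_sub, toDual_diagUnit, h, h.symm, if_true, if_false]
  norm_num

theorem isSl2Triple (α : PosRoot n) :
    IsSl2Triple (coroot α : Sl n) (eVec α) (fVec α) where
  h_ne_zero := by
    intro h
    have h2 : coroot α = 0 := Subtype.ext h
    have := toDual_coroot_self α
    rw [h2, map_zero] at this
    norm_num at this
  lie_e_f := eVec_lie_fVec α
  lie_h_e_nsmul := by
    rw [cartan_lie_eVec, toDual_coroot_self, ofNat_smul_eq_nsmul]
  lie_h_f_nsmul := by
    rw [cartan_lie_fVec, toDual_coroot_self, neg_smul, ofNat_smul_eq_nsmul]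

/-- The triangular decomposition as an induction principle. -/
theorem sl_induction {p : Sl n → Prop} (he : ∀ α, p (eVec α)) (hf : ∀ α, p (fVec α))
    (hh : ∀ h : cartan n, p h) (add : ∀ x y, p x → p y → p (x + y))
    (smul : ∀ (c : ℂ) x, p x → p (c • x)) (x : Sl n) : p x := by
  have h0 : p 0 := by simpa using hh 0
  rw [← sum_smul_matUnit x]
  refine Finset.sum_induction _ p add h0 fun i _ => Finset.sum_induction _ p add h0 fun j _ => ?_
  apply smul
  rcases lt_trichotomy i j with h | rfl | h
  · have := he ⟨toLex (i, j), h⟩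
    rwa [eVec_eq] at this
  · exact hh (diagUnit i)
  · have := hf ⟨toLex (j, i), h⟩
    rwa [fVec_eq] at this

/-! ## Weights -/

theorem weight_zero : weight (0 : PosRoot n → ℕ) = 0 := by simp [weight]

theorem weight_add (m m' : PosRoot n → ℕ) : weight (m + m') = weight m + weight m' := by
  simp [weight, add_smul, Finset.sum_add_distrib]

theorem weight_single (α : PosRoot n) : weight (Pi.single α 1) = α.toDual := by
  rw [weight, Finset.sum_eq_single α]
  · simp
  · intro β _ h; simp [h]
  · simp

theorem ht_zero : ht (0 : PosRoot n → ℕ) = 0 := by simp [ht]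

theorem ht_add (m m' : PosRoot n → ℕ) : ht (m + m') = ht m + ht m' := by
  simp [ht, add_mul, Finset.sum_add_distrib]

theorem ht_single (α : PosRoot n) : ht (Pi.single α 1) = α.height := by
  rw [ht, Finset.sum_eq_single α]
  · simp
  · intro β _ h; simp [h]
  · simp

theorem deg_zero : deg (0 : PosRoot n → ℕ) = 0 := by simp [deg]

theorem deg_add (m m' : PosRoot n → ℕ) : deg (m + m') = deg m + deg m' := by
  simp [deg, Finset.sum_add_distrib]

theorem deg_single (α : PosRoot n) : deg (Pi.single α 1) = 1 := by
  simp [deg]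

theorem height_pos (α : PosRoot n) : 0 < α.height :=
  Nat.sub_pos_of_lt α.src_lt_tgt

theorem cast_height (α : PosRoot n) : (α.height : ℂ) = (α.tgt : ℕ) - (α.src : ℕ) := by
  rw [PosRoot.height, Nat.cast_sub (Fin.le_def.1 α.src_lt_tgt.le)]

theorem eq_zero_of_ht_eq_zero {m : PosRoot n → ℕ} (h : ht m = 0) : m = 0 := by
  funext α
  have := (Finset.sum_eq_zero_iff.1 h) α (Finset.mem_univ α)
  exact (Nat.mul_eq_zero.1 this).resolve_right (height_pos α).ne'

/-- The linear functional on weights which takes the value `height α` at every positive root. -/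
def heightFunctional (μ : Module.Dual ℂ (cartan n)) : ℂ :=
  -∑ i : Fin n, ((i : ℕ) : ℂ) * μ (diagUnit i)

theorem heightFunctional_weight (m : PosRoot n → ℕ) : heightFunctional (weight m) = ht m := by
  have h1 : ∀ α : PosRoot n, -∑ i : Fin n, ((i : ℕ) : ℂ) * α.toDual (diagUnit i) = α.height := by
    intro α
    simp only [toDual_diagUnit, mul_sub, mul_ite, mul_one, mul_zero, Finset.sum_sub_distrib,
      Finset.sum_ite_eq', Finset.mem_univ, if_true, cast_height]
    ring
  rw [ht, Nat.cast_sum]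
  simp only [Nat.cast_mul, ← h1, heightFunctional, weight, LinearMap.sum_apply,
    LinearMap.smul_apply, nsmul_eq_mul, Finset.mul_sum, mul_neg]
  rw [Finset.sum_comm, ← Finset.sum_neg_distrib]
  refine Finset.sum_congr rfl fun α _ => ?_
  rw [← Finset.sum_neg_distrib, ← Finset.sum_neg_distrib]
  refine Finset.sum_congr rfl fun i _ => ?_
  ring

/-- The height depends linearly on the weight. An exponent is not determined by its weight, and this
makes the height a legitimate induction parameter for weights. -/
theorem ht_eq_of_weight_eq {m m' : PosRoot n → ℕ} (h : weight m = weight m') : ht m = ht m' := by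
  have := heightFunctional_weight m
  rw [h, heightFunctional_weight] at this
  exact_mod_cast this.symm

theorem eq_zero_of_weight_eq_zero {m : PosRoot n → ℕ} (h : weight m = 0) : m = 0 :=
  eq_zero_of_ht_eq_zero (by rw [ht_eq_of_weight_eq (h.trans weight_zero.symm), ht_zero])

/-- A weight is dominant integral if it takes values in `ℕ` at all coroots. -/
def IsDominant (μ : Module.Dual ℂ (cartan n)) : Prop := ∀ α, ∃ k : ℕ, μ (coroot α) = k

/-- The scalar by which the Casimir element acts on a highest weight vector of weight `μ`. -/
def casimirScalar (μ : Module.Dual ℂ (cartan n)) : ℂ :=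
  ∑ i, μ (diagUnit i) ^ 2 + ∑ α : PosRoot n, μ (coroot α)

theorem sum_posRoot {A : Type*} [AddCommMonoid A] (g : Fin n → Fin n → A) :
    ∑ α : PosRoot n, g α.src α.tgt = ∑ i, ∑ j, if i < j then g i j else 0 := by
  rw [← Finset.sum_product', Finset.univ_product_univ, ← Finset.sum_filter]
  refine Finset.sum_bij' (fun α _ => (α.src, α.tgt))
    (fun p hp => ⟨toLex p, (Finset.mem_filter.1 hp).2⟩) ?_ ?_ ?_ ?_ ?_
  · intro α _
    exact Finset.mem_filter.2 ⟨Finset.mem_univ _, α.src_lt_tgt⟩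
  · intro p _; exact Finset.mem_univ _
  · intro α _; rfl
  · intro p _; rfl
  · intro α _; rfl

/-- The index `i` is the source of `n - 1 - i` positive roots and the target of `i` of them. -/
theorem sum_coroot (μ : Module.Dual ℂ (cartan n)) : ∑ α : PosRoot n, μ (coroot α) =
    ∑ i : Fin n, ((n : ℂ) - 1 - 2 * (i : ℕ)) * μ (diagUnit i) := by
  simp only [coroot_eq, map_sub]
  rw [sum_posRoot fun i j => μ (diagUnit i) - μ (diagUnit j)]
  have h1 : ∀ i j : Fin n, (if i < j then μ (diagUnit i) - μ (diagUnit j) else 0) =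
      (if i < j then μ (diagUnit i) else 0) - (if i < j then μ (diagUnit j) else 0) := by
    intro i j; split_ifs <;> simp
  simp only [h1, Finset.sum_sub_distrib]
  rw [Finset.sum_comm (f := fun i j => if i < j then μ (diagUnit j) else 0),
    ← Finset.sum_sub_distrib]
  refine Finset.sum_congr rfl fun i _ => ?_
  rw [← Finset.sum_filter, ← Finset.sum_filter, Finset.sum_const, Finset.sum_const]
  have h2 : (Finset.univ.filter fun j => i < j) = Finset.Ioi i := by ext; simp
  have h3 : (Finset.univ.filter fun j => j < i) = Finset.Iio i := by ext; simp
  rw [h2, h3, Fin.card_Ioi, Fin.card_Iio, nsmul_eq_mul, nsmul_eq_mul, Nat.sub_sub,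
    Nat.cast_sub (by omega)]
  push_cast
  ring

/-- The difference of the scalars is `(μ - ν, μ + ν + 2ρ)`, that is `∑ m_α (μ(h_α) + ν(h_α) + 2 ht
α)`. By dominance no summand is negative, and a summand with `m_α ≠ 0` is positive because heights
are. -/
theorem casimirScalar_ne {μ ν : Module.Dual ℂ (cartan n)} (hμ : IsDominant μ) (hν : IsDominant ν)
    {m : PosRoot n → ℕ} (hm : m ≠ 0) (h : μ = ν + weight m) :
    casimirScalar μ ≠ casimirScalar ν := by
  have key : casimirScalar μ - casimirScalar ν =
      ∑ α, (m α : ℂ) * (μ (coroot α) + ν (coroot α) + 2 * α.height) := by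
    have e1 : ∀ i, μ (diagUnit i) - ν (diagUnit i) =
        ∑ α : PosRoot n, (m α : ℂ) *
          ((if i = α.src then 1 else 0) - (if i = α.tgt then 1 else 0)) := by
      intro i
      rw [h]
      simp [weight, toDual_diagUnit]
    have e2 : casimirScalar μ - casimirScalar ν = ∑ i, (μ (diagUnit i) - ν (diagUnit i)) *
        (μ (diagUnit i) + ν (diagUnit i) + (n - 1 - 2 * (i : ℕ))) := by
      rw [casimirScalar, casimirScalar, sum_coroot, sum_coroot, ← Finset.sum_add_distrib,
        ← Finset.sum_add_distrib, ← Finset.sum_sub_distrib]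
      refine Finset.sum_congr rfl fun i _ => ?_
      ring
    rw [e2]
    simp only [e1, Finset.sum_mul]
    rw [Finset.sum_comm]
    refine Finset.sum_congr rfl fun α _ => ?_
    simp only [mul_assoc, ← Finset.mul_sum, sub_mul, ite_mul, one_mul, zero_mul,
      Finset.sum_sub_distrib, Finset.sum_ite_eq', Finset.mem_univ, if_true]
    rw [coroot_eq, cast_height, map_sub, map_sub]
    ring
  choose a ha using hμ
  choose b hb using hν
  intro heq
  rw [heq, sub_self] at key
  simp only [ha, hb] at key
  have key2 : ∑ α, m α * (a α + b α + 2 * α.height) = 0 := by exact_mod_cast key.symm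
  apply hm
  funext α
  have h3 := Finset.sum_eq_zero_iff.1 key2 α (Finset.mem_univ α)
  have := height_pos α
  exact (Nat.mul_eq_zero.1 h3).resolve_right (by omega)

end SlCurrent

end

noncomputable section

namespace SlCurrent

variable {n : ℕ}

/-! ## Weight spaces of `sl_n`-modules -/

section WeightSpaces

variable {M : Type*} [AddCommGroup M] [Module ℂ M] [LieRingModule (Sl n) M]
  [LieModule ℂ (Sl n) M] {μ : Module.Dual ℂ (cartan n)}

variable (M) in
/-- The weight space of weight `μ`. -/
def wtSpace (μ : Module.Dual ℂ (cartan n)) : Submodule ℂ M where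
  carrier := {x | ∀ h : cartan n, ⁅(h : Sl n), x⁆ = μ h • x}
  zero_mem' := by simp
  add_mem' := by
    intro x y hx hy h
    rw [lie_add, hx, hy, smul_add]
  smul_mem' := by
    intro c x hx h
    rw [lie_smul, hx, smul_comm]

theorem lie_mem_wtSpace {x : M} (hx : x ∈ wtSpace M μ) {y : Sl n} {κ : Module.Dual ℂ (cartan n)}
    (hy : ∀ h : cartan n, ⁅(h : Sl n), y⁆ = κ h • y) : ⁅y, x⁆ ∈ wtSpace M (μ + κ) := by
  intro h
  rw [leibniz_lie, hy, hx, smul_lie, lie_smul, ← add_smul, LinearMap.add_apply, add_comm (μ h)]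

theorem lie_eVec_mem_wtSpace {x : M} (hx : x ∈ wtSpace M μ) (α : PosRoot n) :
    ⁅eVec α, x⁆ ∈ wtSpace M (μ + α.toDual) :=
  lie_mem_wtSpace hx fun h => cartan_lie_eVec h α

theorem lie_fVec_mem_wtSpace {x : M} (hx : x ∈ wtSpace M μ) (α : PosRoot n) :
    ⁅fVec α, x⁆ ∈ wtSpace M (μ - α.toDual) := by
  rw [sub_eq_add_neg]
  exact lie_mem_wtSpace hx fun h => cartan_lie_fVec h α

/-- A subspace stable under `𝔥` contains the weight components of its elements. -/
theorem component_mem (N : Submodule ℂ M) (hN : ∀ (h : cartan n), ∀ x ∈ N, ⁅(h : Sl n), x⁆ ∈ N)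
    (s : Finset (Module.Dual ℂ (cartan n))) (x : Module.Dual ℂ (cartan n) → M)
    (hx : ∀ κ, x κ ∈ wtSpace M κ) (hs : ∑ κ ∈ s, x κ ∈ N) : ∀ κ ∈ s, x κ ∈ N := by
  classical
  induction s using Finset.induction_on generalizing x with
  | empty => simp
  | insert κ₀ s h₀ ih =>
    rw [Finset.sum_insert h₀] at hs
    have h1 : ∀ κ ∈ s, x κ ∈ N := by
      intro κ hκ
      -- An `h` that separates `κ` from `κ₀`: the operator `h - κ₀(h)` kills the `κ₀`-component and
      -- rescales the others, the one at `κ` by a nonzero factor.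
      obtain ⟨h, hh⟩ : ∃ h, κ h - κ₀ h ≠ 0 := by
        by_contra! hcon
        have : κ = κ₀ := LinearMap.ext fun h => sub_eq_zero.1 (hcon h)
        exact h₀ (this ▸ hκ)
      have h2 := ih (fun κ => (κ h - κ₀ h) • x κ) (fun κ => Submodule.smul_mem _ _ (hx κ)) (by
        have h3 := N.sub_mem (hN h _ hs) (N.smul_mem (κ₀ h) hs)
        rw [lie_add, lie_sum, hx κ₀, smul_add, add_sub_add_left_eq_sub, Finset.smul_sum,
          ← Finset.sum_sub_distrib] at h3
        simpa only [(hx _ _), ← sub_smul] using h3) κ hκ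
      simpa [hh] using N.smul_mem (κ h - κ₀ h)⁻¹ h2
    intro κ hκ
    rcases Finset.mem_insert.1 hκ with rfl | hκ
    · simpa using N.sub_mem hs (N.sum_mem h1)
    · exact h1 κ hκ

variable (M) in
/-- The sum of the weight spaces with weights in `S`. -/
def wtSum (S : Set (Module.Dual ℂ (cartan n))) : Submodule ℂ M :=
  Submodule.span ℂ {x | ∃ κ ∈ S, x ∈ wtSpace M κ}

theorem wtSpace_le_wtSum {S : Set (Module.Dual ℂ (cartan n))} (h : μ ∈ S) :
    wtSpace M μ ≤ wtSum M S :=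
  fun _ hx => Submodule.subset_span ⟨μ, h, hx⟩

theorem wtSum_mono {S T : Set (Module.Dual ℂ (cartan n))} (h : S ⊆ T) : wtSum M S ≤ wtSum M T :=
  Submodule.span_mono fun _ ⟨κ, hκ, hx⟩ => ⟨κ, h hκ, hx⟩

theorem exists_sum_of_mem_wtSum {S : Set (Module.Dual ℂ (cartan n))} {x : M}
    (hx : x ∈ wtSum M S) : ∃ (s : Finset (Module.Dual ℂ (cartan n)))
      (y : Module.Dual ℂ (cartan n) → M), ↑s ⊆ S ∧ (∀ κ, y κ ∈ wtSpace M κ) ∧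
        x = ∑ κ ∈ s, y κ := by
  classical
  induction hx using Submodule.span_induction with
  | mem x hx =>
    obtain ⟨κ, hκ, hx⟩ := hx
    refine ⟨{κ}, Pi.single κ x, by simpa using hκ, fun κ' => ?_, by simp⟩
    by_cases h : κ' = κ
    · subst h; simpa using hx
    · simp [h]
  | zero => exact ⟨∅, 0, by simp, fun κ => Submodule.zero_mem _, by simp⟩
  | add x x' _ _ hx hx' =>
    obtain ⟨s, y, hs, hy, rfl⟩ := hx
    obtain ⟨s', y', hs', hy', rfl⟩ := hx'
    refine ⟨s ∪ s', fun κ => (if κ ∈ s then y κ else 0) + if κ ∈ s' then y' κ else 0, ?_, ?_, ?_⟩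
    · rw [Finset.coe_union]; exact Set.union_subset hs hs'
    · intro κ
      refine Submodule.add_mem _ ?_ ?_ <;> split_ifs
      exacts [hy κ, Submodule.zero_mem _, hy' κ, Submodule.zero_mem _]
    · rw [Finset.sum_add_distrib, Finset.sum_ite_mem, Finset.sum_ite_mem,
        Finset.inter_eq_right.2 Finset.subset_union_left,
        Finset.inter_eq_right.2 Finset.subset_union_right]
  | smul c x _ hx =>
    obtain ⟨s, y, hs, hy, rfl⟩ := hx
    exact ⟨s, fun κ => c • y κ, hs, fun κ => Submodule.smul_mem _ _ (hy κ), Finset.smul_sum⟩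

/-- Independence of weight spaces: `component_mem` for the zero subspace, applied to the relation
`-x + ∑ y κ = 0`. -/
theorem mem_of_mem_wtSum {S : Set (Module.Dual ℂ (cartan n))} {x : M} (hx : x ∈ wtSum M S)
    (hμ : x ∈ wtSpace M μ) (h0 : x ≠ 0) : μ ∈ S := by
  classical
  obtain ⟨s, y, hs, hy, hxy⟩ := exists_sum_of_mem_wtSum hx
  by_contra hμS
  have hμs : μ ∉ s := fun h => hμS (hs h)
  have := component_mem (⊥ : Submodule ℂ M) (by simp) (insert μ s)
    (fun κ => if κ = μ then -x else y κ) (by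
      intro κ
      split_ifs with h
      · rw [h]; exact Submodule.neg_mem _ hμ
      · exact hy κ) (by
      have h2 : ∑ κ ∈ s, (if κ = μ then -x else y κ) = ∑ κ ∈ s, y κ :=
        Finset.sum_congr rfl fun κ hκ => if_neg (ne_of_mem_of_not_mem hκ hμs)
      rw [Finset.sum_insert hμs, h2, ← hxy]
      simp) μ (Finset.mem_insert_self _ _)
  simp [h0] at this

theorem exists_weight_vector {S : Set (Module.Dual ℂ (cartan n))} (N : Submodule ℂ M)
    (hN : ∀ (h : cartan n), ∀ x ∈ N, ⁅(h : Sl n), x⁆ ∈ N) (hS : N ≤ wtSum M S) (h0 : N ≠ ⊥) :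
    ∃ κ : Module.Dual ℂ (cartan n), ∃ x ∈ N, x ∈ wtSpace M κ ∧ x ≠ 0 := by
  obtain ⟨x, hx, hx0⟩ := (Submodule.ne_bot_iff N).1 h0
  obtain ⟨s, y, hs, hy, rfl⟩ := exists_sum_of_mem_wtSum (hS hx)
  obtain ⟨κ, hκ, hκ0⟩ := Finset.exists_ne_zero_of_sum_ne_zero hx0
  exact ⟨κ, y κ, component_mem N hN s y hy hx κ hκ, hy κ, hκ0⟩

/-- The weights of the form `μ - weight m`. -/
def below (μ : Module.Dual ℂ (cartan n)) : Set (Module.Dual ℂ (cartan n)) :=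
  {κ | ∃ m : PosRoot n → ℕ, μ = κ + weight m}

/-- The weights of the form `μ - weight m`, `m ≠ 0`. -/
def strictlyBelow (μ : Module.Dual ℂ (cartan n)) : Set (Module.Dual ℂ (cartan n)) :=
  {κ | ∃ m : PosRoot n → ℕ, m ≠ 0 ∧ μ = κ + weight m}

theorem self_mem_below (μ : Module.Dual ℂ (cartan n)) : μ ∈ below μ :=
  ⟨0, by rw [weight_zero, add_zero]⟩

theorem strictlyBelow_subset_below (μ : Module.Dual ℂ (cartan n)) : strictlyBelow μ ⊆ below μ :=
  fun _ ⟨m, _, h⟩ => ⟨m, h⟩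

theorem not_mem_strictlyBelow (μ : Module.Dual ℂ (cartan n)) : μ ∉ strictlyBelow μ := by
  rintro ⟨m, hm, h⟩
  exact hm (eq_zero_of_weight_eq_zero (left_eq_add.1 h))

theorem below_trans {μ ν κ : Module.Dual ℂ (cartan n)} (h : ν ∈ below μ) (h' : κ ∈ below ν) :
    κ ∈ below μ := by
  obtain ⟨m, rfl⟩ := h
  obtain ⟨m', rfl⟩ := h'
  exact ⟨m' + m, by rw [weight_add, add_assoc]⟩

theorem below_antisymm {μ ν : Module.Dual ℂ (cartan n)} (h : ν ∈ below μ) (h' : μ ∈ below ν) :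
    μ = ν := by
  obtain ⟨m, hm⟩ := h
  obtain ⟨m', hm'⟩ := h'
  have h3 : weight (m + m') = 0 := by
    rw [weight_add]
    rw [hm, add_assoc] at hm'
    exact left_eq_add.1 hm'
  have h4 : m = 0 := by
    have := eq_zero_of_weight_eq_zero h3
    funext α
    have := congrFun this α
    simp only [Pi.add_apply, Pi.zero_apply, Nat.add_eq_zero_iff] at this
    exact this.1
  rw [hm, h4, weight_zero, add_zero]

theorem lie_fVec_mem_wtSum {S T : Set (Module.Dual ℂ (cartan n))} {α : PosRoot n}
    (h : ∀ κ ∈ S, κ - α.toDual ∈ T) {x : M} (hx : x ∈ wtSum M S) : ⁅fVec α, x⁆ ∈ wtSum M T := by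
  have : wtSum M S ≤ (wtSum M T).comap (LieModule.toEnd ℂ (Sl n) M (fVec α)) := by
    refine Submodule.span_le.2 ?_
    rintro y ⟨κ, hκ, hy⟩
    exact wtSpace_le_wtSum (h κ hκ) (lie_fVec_mem_wtSpace hy α)
  exact this hx

theorem sub_mem_strictlyBelow {κ : Module.Dual ℂ (cartan n)} (h : κ ∈ below μ) (α : PosRoot n) :
    κ - α.toDual ∈ strictlyBelow μ := by
  obtain ⟨m, rfl⟩ := h
  refine ⟨m + Pi.single α 1, ?_, ?_⟩
  · intro h0
    simpa using congrFun h0 α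
  · rw [weight_add, weight_single]; abel

theorem lie_fVec_mem_wtSum_below {x : M} (hx : x ∈ wtSum M (below μ)) (α : PosRoot n) :
    ⁅fVec α, x⁆ ∈ wtSum M (strictlyBelow μ) :=
  lie_fVec_mem_wtSum (fun _ hκ => sub_mem_strictlyBelow hκ α) hx

/-! ## Highest weight vectors -/

/-- The triangular decomposition: the submodule generated by a `𝔟`-stable subspace `T` is
contained in each `𝔫⁻`-stable subspace which contains `T`. -/
theorem lieSpan_le_of_stable {T W : Submodule ℂ M} (he : ∀ α : PosRoot n, ∀ x ∈ T, ⁅eVec α, x⁆ ∈ T)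
    (hh : ∀ h : cartan n, ∀ x ∈ T, ⁅(h : Sl n), x⁆ ∈ T) (hTW : T ≤ W)
    (hf : ∀ α : PosRoot n, ∀ x ∈ W, ⁅fVec α, x⁆ ∈ W) :
    (LieSubmodule.lieSpan ℂ (Sl n) (T : Set M) : Submodule ℂ M) ≤ W := by
  let P : Submodule ℂ M := sInf {W | T ≤ W ∧ ∀ α : PosRoot n, ∀ x ∈ W, ⁅fVec α, x⁆ ∈ W}
  have hTP : T ≤ P := le_sInf fun W hW => hW.1
  have hfP : ∀ α : PosRoot n, ∀ x ∈ P, ⁅fVec α, x⁆ ∈ P := by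
    intro α x hx
    rw [Submodule.mem_sInf] at hx ⊢
    exact fun W hW => hW.2 α x (hx W hW)
  -- `P` is the least `𝔫⁻`-stable subspace over `T`, and `Q` is the part of `P` which all of `sl_n`
  -- maps into `P`. Since `y f x = [y, f] x + f y x`, `Q` is again `𝔫⁻`-stable and contains `T`; so
  -- `Q = P`, and `P` is a submodule.
  let Q : Submodule ℂ M :=
    { carrier := {x | x ∈ P ∧ ∀ y : Sl n, ⁅y, x⁆ ∈ P}
      zero_mem' := ⟨P.zero_mem, by simp⟩
      add_mem' := fun hx hy => ⟨P.add_mem hx.1 hy.1, fun z => by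
        rw [lie_add]; exact P.add_mem (hx.2 z) (hy.2 z)⟩
      smul_mem' := fun c x hx => ⟨P.smul_mem c hx.1, fun z => by
        rw [lie_smul]; exact P.smul_mem c (hx.2 z)⟩ }
  have hPQ : P ≤ Q := by
    refine sInf_le ⟨fun x hx => ⟨hTP hx, fun y => ?_⟩, fun α x hx => ⟨hfP α x hx.1, fun y => ?_⟩⟩
    · induction y using sl_induction with
      | he α => exact hTP (he α x hx)
      | hf α => exact hfP α x (hTP hx)
      | hh h => exact hTP (hh h x hx)
      | add y z hy hz => rw [add_lie]; exact P.add_mem hy hz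
      | smul c y hy => rw [smul_lie]; exact P.smul_mem c hy
    · rw [leibniz_lie]
      exact P.add_mem (hx.2 _) (hfP α _ (hx.2 y))
  let P' : LieSubmodule ℂ (Sl n) M := { P with lie_mem := fun {y x} hx => (hPQ hx).2 y }
  have h1 : LieSubmodule.lieSpan ℂ (Sl n) (T : Set M) ≤ P' := LieSubmodule.lieSpan_le.2 hTP
  exact fun x hx => (sInf_le (show W ∈ _ from ⟨hTW, hf⟩) : P ≤ W) (h1 hx)

variable (n) in
/-- Vectors killed by `𝔫⁺`. -/
def IsSingular (x : M) : Prop := ∀ α : PosRoot n, ⁅eVec α, x⁆ = 0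

/-- The line through `v` is `𝔟`-stable, so only `f`'s need to be applied to it, and each of them
moves strictly downwards. -/
theorem lieSpan_singleton_le {v : M} (hv : IsSingular n v) (hμ : v ∈ wtSpace M μ) :
    (LieSubmodule.lieSpan ℂ (Sl n) {v} : Submodule ℂ M) ≤
      Submodule.span ℂ {v} ⊔ wtSum M (strictlyBelow μ) := by
  have h1 : Submodule.span ℂ {v} ⊔ wtSum M (strictlyBelow μ) ≤ wtSum M (below μ) :=
    sup_le ((Submodule.span_singleton_le_iff_mem _ _).2 (wtSpace_le_wtSum (self_mem_below μ) hμ))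
      (wtSum_mono (strictlyBelow_subset_below μ))
  have h2 := lieSpan_le_of_stable (T := Submodule.span ℂ {v})
    (W := Submodule.span ℂ {v} ⊔ wtSum M (strictlyBelow μ)) (fun α x hx => by
      obtain ⟨c, rfl⟩ := Submodule.mem_span_singleton.1 hx
      rw [lie_smul, hv α, smul_zero]
      exact Submodule.zero_mem _) (fun h x hx => by
      obtain ⟨c, rfl⟩ := Submodule.mem_span_singleton.1 hx
      rw [lie_smul, hμ]
      exact Submodule.smul_mem _ _ (Submodule.smul_mem _ _ (Submodule.mem_span_singleton_self v)))
    le_sup_left (fun α x hx => le_sup_right (a := Submodule.span ℂ {v})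
      (lie_fVec_mem_wtSum_below (h1 hx) α))
  refine le_trans ?_ h2
  exact LieSubmodule.lieSpan_mono (by simp)

theorem lieSpan_singleton_le_wtSum {v : M} (hv : IsSingular n v) (hμ : v ∈ wtSpace M μ) :
    (LieSubmodule.lieSpan ℂ (Sl n) {v} : Submodule ℂ M) ≤ wtSum M (below μ) :=
  (lieSpan_singleton_le hv hμ).trans
    (sup_le ((Submodule.span_singleton_le_iff_mem _ _).2 (wtSpace_le_wtSum (self_mem_below μ) hμ))
      (wtSum_mono (strictlyBelow_subset_below μ)))

theorem exists_smul_of_mem_lieSpan {v x : M} (hv : IsSingular n v) (hμ : v ∈ wtSpace M μ)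
    (hx : x ∈ LieSubmodule.lieSpan ℂ (Sl n) {v}) (hxμ : x ∈ wtSpace M μ) : ∃ c : ℂ, x = c • v := by
  obtain ⟨y, hy, z, hz, rfl⟩ := Submodule.mem_sup.1 (lieSpan_singleton_le hv hμ hx)
  obtain ⟨c, rfl⟩ := Submodule.mem_span_singleton.1 hy
  refine ⟨c, ?_⟩
  by_contra hne
  have hz0 : z ≠ 0 := fun h => hne (by rw [h, add_zero])
  have hzμ : z ∈ wtSpace M μ := by
    simpa using Submodule.sub_mem _ hxμ (Submodule.smul_mem _ c hμ)
  exact not_mem_strictlyBelow μ (mem_of_mem_wtSum hz hzμ hz0)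

/-! ## Bounded modules -/

variable (M) in
/-- `M` is the sum of its weight spaces, and all weights are of the form `κ - weight m`. -/
def IsBounded (κ : Module.Dual ℂ (cartan n)) : Prop := wtSum M (below κ) = ⊤

theorem IsBounded.mem_below {κ : Module.Dual ℂ (cartan n)} (h : IsBounded M κ) {x : M}
    (hx : x ∈ wtSpace M μ) (h0 : x ≠ 0) : μ ∈ below κ :=
  mem_of_mem_wtSum (by rw [h]; trivial) hx h0

/-- Induction along the action of `𝔫⁺`. -/
theorem IsBounded.induction {κ : Module.Dual ℂ (cartan n)} (h : IsBounded M κ)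
    {p : Module.Dual ℂ (cartan n) → M → Prop} (zero : ∀ μ, p μ 0)
    (step : ∀ μ, ∀ x ∈ wtSpace M μ, (∀ α : PosRoot n, p (μ + α.toDual) ⁅eVec α, x⁆) → p μ x)
    {x : M} (hx : x ∈ wtSpace M μ) : p μ x := by
  -- Strong induction on the height of `κ - μ`: passing from `μ` to `μ + α` lowers it by the height
  -- of `α`.
  have main : ∀ (k : ℕ) (μ : Module.Dual ℂ (cartan n)) (m : PosRoot n → ℕ) (x : M),
      κ = μ + weight m → ht m = k → x ∈ wtSpace M μ → p μ x := by
    intro k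
    induction k using Nat.strong_induction_on with
    | _ k ih =>
      intro μ m x hm hk hx
      refine step μ x hx fun α => ?_
      have hα := lie_eVec_mem_wtSpace hx α
      rcases eq_or_ne ⁅eVec α, x⁆ 0 with h0 | h0
      · rw [h0]; exact zero _
      · obtain ⟨m', hm'⟩ := h.mem_below hα h0
        refine ih (ht m') ?_ _ m' _ hm' rfl hα
        have h2 : weight m = weight (Pi.single α 1 + m') := by
          rw [weight_add, weight_single]
          rw [hm, add_assoc] at hm'
          exact add_left_cancel hm'
        have h3 := ht_eq_of_weight_eq h2
        rw [ht_add, ht_single] at h3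
        have := height_pos α
        omega
  rcases eq_or_ne x 0 with rfl | h0
  · exact zero μ
  · obtain ⟨m, hm⟩ := h.mem_below hx h0
    exact main _ μ m x hm rfl hx

/-- Starting from a nonzero weight vector, apply raising operators as long as the result is nonzero;
boundedness makes this stop. -/
theorem IsBounded.exists_singular {κ : Module.Dual ℂ (cartan n)} (h : IsBounded M κ)
    {N : LieSubmodule ℂ (Sl n) M} (hN : N ≠ ⊥) :
    ∃ ν : Module.Dual ℂ (cartan n), ∃ x ∈ N, x ∈ wtSpace M ν ∧ IsSingular n x ∧ x ≠ 0 := by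
  obtain ⟨ν, x, hxN, hx, hx0⟩ := exists_weight_vector (S := below κ) (N : Submodule ℂ M)
    (fun h x hx => N.lie_mem hx) (by rw [h]; exact le_top) (by simpa using hN)
  refine h.induction (p := fun ν x => x ∈ N → x ≠ 0 →
    ∃ ν : Module.Dual ℂ (cartan n), ∃ x ∈ N, x ∈ wtSpace M ν ∧ IsSingular n x ∧ x ≠ 0) ?_ ?_ hx hxN hx0
  · intro _ _ h0; exact absurd rfl h0
  · intro ν x hx ih hxN hx0
    by_cases hs : IsSingular n x
    · exact ⟨ν, x, hxN, hx, hs, hx0⟩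
    · obtain ⟨α, hα⟩ := not_forall.1 hs
      exact ih α (N.lie_mem hxN) hα

/-! ## The Casimir operator -/

theorem sum_sum_eq {A : Type*} [AddCommMonoid A] (g : Fin n → Fin n → A) :
    ∑ i, ∑ j, g i j = ∑ i, g i i + ∑ α : PosRoot n, (g α.src α.tgt + g α.tgt α.src) := by
  rw [Finset.sum_add_distrib, sum_posRoot g, sum_posRoot fun i j => g j i,
    Finset.sum_comm (f := fun i j => if i < j then g j i else 0), ← Finset.sum_add_distrib,
    ← Finset.sum_add_distrib]
  refine Finset.sum_congr rfl fun i _ => ?_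
  have h : ∀ j, g i j = (if i = j then g i i else 0) +
      ((if i < j then g i j else 0) + if j < i then g i j else 0) := by
    intro j
    rcases lt_trichotomy i j with h | rfl | h
    · simp [h, h.ne, h.not_gt]
    · simp
    · simp [h, h.ne', h.not_gt]
  rw [Finset.sum_congr rfl fun j _ => h j, Finset.sum_add_distrib, Finset.sum_add_distrib]
  simp

variable (n M) in
/-- The Casimir operator. -/
def casimir : Module.End ℂ M :=
  ∑ i : Fin n, ∑ j : Fin n, LieModule.toEnd ℂ (Sl n) M (matUnit i j) *
    LieModule.toEnd ℂ (Sl n) M (matUnit j i)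

/-- By the derivation rule the commutator with a matrix unit splits into four sums, which cancel in
pairs once the summation indices are renamed. -/
theorem casimir_comm (y : Sl n) : Commute (casimir n M) (LieModule.toEnd ℂ (Sl n) M y) := by
  have key : ∀ k l : Fin n, Commute (LieModule.toEnd ℂ (Sl n) M (matUnit k l)) (casimir n M) := by
    intro k l
    let X : Fin n → Fin n → Module.End ℂ M := fun i j => LieModule.toEnd ℂ (Sl n) M (matUnit i j)
    have hX : ∀ i j k l, X i j * X k l - X k l * X i j =
        (if j = k then X i l else 0) - if i = l then X k j else 0 := by
      intro i j k l
      ext x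
      simp only [X, LinearMap.sub_apply, Module.End.mul_apply, LieModule.toEnd_apply_apply]
      rw [← lie_lie, matUnit_lie]
      split_ifs <;> simp
    have h1 : ∀ i j, X k l * (X i j * X j i) - X i j * X j i * X k l =
        (if l = i then X k j * X j i else 0) - (if k = j then X i l * X j i else 0) +
        ((if l = j then X i j * X k i else 0) - if k = i then X i j * X j l else 0) := by
      intro i j
      have : X k l * (X i j * X j i) - X i j * X j i * X k l =
          (X k l * X i j - X i j * X k l) * X j i + X i j * (X k l * X j i - X j i * X k l) := by
        noncomm_ring
      rw [this, hX, hX, sub_mul, mul_sub]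
      simp only [ite_mul, mul_ite, zero_mul, mul_zero]
    refine sub_eq_zero.1 ?_
    change X k l * (∑ i, ∑ j, X i j * X j i) - (∑ i, ∑ j, X i j * X j i) * X k l = 0
    simp only [Finset.mul_sum, Finset.sum_mul, ← Finset.sum_sub_distrib, h1]
    simp only [Finset.sum_add_distrib, Finset.sum_sub_distrib]
    rw [Finset.sum_comm (f := fun i j => if l = i then X k j * X j i else 0),
      Finset.sum_comm (f := fun i j => if k = i then X i j * X j l else 0)]
    simp
  rw [← sum_smul_matUnit y, map_sum]
  refine Commute.sum_right _ _ _ fun i _ => ?_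
  rw [map_sum]
  refine Commute.sum_right _ _ _ fun j _ => ?_
  rw [map_smul]
  exact (key i j).symm.smul_right _

/-- Rewriting `e_α f_α = f_α e_α + h_α` moves all raising operators to the right; the coroots left
over are the linear part of `casimirScalar`. -/
theorem casimir_apply {x : M} (hx : x ∈ wtSpace M μ) : casimir n M x =
    casimirScalar μ • x + 2 • ∑ α : PosRoot n, ⁅fVec α, ⁅eVec α, x⁆⁆ := by
  simp only [casimir, LinearMap.sum_apply, Module.End.mul_apply, LieModule.toEnd_apply_apply]
  rw [sum_sum_eq fun i j => ⁅matUnit i j, ⁅matUnit j i, x⁆⁆, casimirScalar, add_smul,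
    Finset.sum_smul, Finset.sum_smul, add_assoc, Finset.smul_sum, ← Finset.sum_add_distrib]
  congr 1
  · refine Finset.sum_congr rfl fun i _ => ?_
    change ⁅(diagUnit i : Sl n), ⁅(diagUnit i : Sl n), x⁆⁆ = _
    rw [hx, lie_smul, hx, smul_smul, sq]
  · refine Finset.sum_congr rfl fun α _ => ?_
    rw [← eVec_eq, ← fVec_eq, leibniz_lie (eVec α), eVec_lie_fVec, hx, two_smul, add_assoc]

theorem casimir_apply_singular {x : M} (hx : x ∈ wtSpace M μ) (hs : IsSingular n x) :
    casimir n M x = casimirScalar μ • x := by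
  rw [casimir_apply hx]
  simp [hs _]

theorem aeval_casimir_lie (P : Polynomial ℂ) (y : Sl n) (x : M) :
    Polynomial.aeval (casimir n M) P ⁅y, x⁆ = ⁅y, Polynomial.aeval (casimir n M) P x⁆ := by
  have h : Commute (Polynomial.aeval (casimir n M) P) (LieModule.toEnd ℂ (Sl n) M y) := by
    induction P using Polynomial.induction_on' with
    | add p q hp hq => rw [map_add]; exact hp.add_left hq
    | monomial k c =>
      rw [Polynomial.aeval_monomial]
      exact (Algebra.commute_algebraMap_left c _).mul_left ((casimir_comm y).pow_left k)
  exact LinearMap.congr_fun h.eq x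

end WeightSpaces

end SlCurrent

end

noncomputable section

namespace SlCurrent

variable {n : ℕ}

/-! ## Semisimplicity of integrable modules -/

section Semisimple

variable {M : Type*} [AddCommGroup M] [Module ℂ M] [LieRingModule (Sl n) M]
  [LieModule ℂ (Sl n) M] {μ κ : Module.Dual ℂ (cartan n)}
variable {P : Type*} [AddCommGroup P] [Module ℂ P] [LieRingModule (Sl n) P]
  [LieModule ℂ (Sl n) P]

variable (n M) in
/-- All `f_α` act locally nilpotently. -/
def LocNilpotent : Prop :=
  ∀ (α : PosRoot n) (x : M), ∃ k : ℕ, (LieModule.toEnd ℂ (Sl n) M (fVec α) ^ k) x = 0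

theorem map_toEnd_pow (φ : M →ₗ⁅ℂ, Sl n⁆ P) (y : Sl n) (k : ℕ) (x : M) :
    φ ((LieModule.toEnd ℂ (Sl n) M y ^ k) x) = (LieModule.toEnd ℂ (Sl n) P y ^ k) (φ x) := by
  induction k with
  | zero => simp
  | succ k ih => simp [pow_succ', ih]

theorem map_casimir (φ : M →ₗ⁅ℂ, Sl n⁆ P) (x : M) : φ (casimir n M x) = casimir n P (φ x) := by
  simp [casimir, map_sum]

theorem map_aeval_casimir (φ : M →ₗ⁅ℂ, Sl n⁆ P) (p : Polynomial ℂ) (x : M) :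
    φ (Polynomial.aeval (casimir n M) p x) = Polynomial.aeval (casimir n P) p (φ x) := by
  have h : ∀ k : ℕ, φ ((casimir n M ^ k) x) = (casimir n P ^ k) (φ x) := by
    intro k
    induction k with
    | zero => simp
    | succ k ih => rw [pow_succ', pow_succ', Module.End.mul_apply, map_casimir, ih]; rfl
  induction p using Polynomial.induction_on' with
  | add p q hp hq => simp [hp, hq]
  | monomial k c => simp [Polynomial.aeval_monomial, h, Module.algebraMap_end_apply]

theorem map_mem_wtSpace (φ : M →ₗ⁅ℂ, Sl n⁆ P) {x : M} (hx : x ∈ wtSpace M μ) :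
    φ x ∈ wtSpace P μ := by
  intro h
  rw [← LieModuleHom.map_lie, hx, map_smul]

omit [LieModule ℂ (Sl n) M] [LieModule ℂ (Sl n) P] in
theorem IsSingular.map (φ : M →ₗ⁅ℂ, Sl n⁆ P) {x : M} (hx : IsSingular n x) :
    IsSingular n (φ x) := by
  intro α
  rw [← LieModuleHom.map_lie, hx, map_zero]

theorem LocNilpotent.of_surjective (h : LocNilpotent n M) (φ : M →ₗ⁅ℂ, Sl n⁆ P)
    (hφ : Function.Surjective φ) : LocNilpotent n P := by
  intro α y
  obtain ⟨x, rfl⟩ := hφ y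
  obtain ⟨k, hk⟩ := h α x
  exact ⟨k, by rw [← map_toEnd_pow, hk, map_zero]⟩

/-- For the last nonzero power `f^k x` one has `0 = e f^(k+1) x = (k+1)(μ(h_α) - k) f^k x`, so
`μ(h_α) = k`. -/
theorem LocNilpotent.isDominant (h : LocNilpotent n M) {x : M} (hx : x ∈ wtSpace M μ)
    (hs : IsSingular n x) (h0 : x ≠ 0) : IsDominant μ := by
  intro α
  have P : (isSl2Triple α).HasPrimitiveVectorWith x (μ (coroot α)) := ⟨h0, hx _, hs α⟩
  obtain ⟨k, hk₁, hk₂⟩ := Nat.exists_not_and_succ_of_not_zero_of_exists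
    (p := fun k => (LieModule.toEnd ℂ (Sl n) M (fVec α) ^ k) x = 0) (by simpa using h0) (h α x)
  refine ⟨k, ?_⟩
  have := P.lie_e_pow_succ_toEnd_f k
  rw [hk₂, lie_zero, eq_comm, smul_eq_zero_iff_left hk₁, mul_eq_zero, sub_eq_zero] at this
  exact this.resolve_left (Nat.cast_add_one_ne_zero k)

theorem aeval_casimir_mem_wtSpace (p : Polynomial ℂ) {x : M} (hx : x ∈ wtSpace M μ) :
    Polynomial.aeval (casimir n M) p x ∈ wtSpace M μ := by
  intro h
  rw [← aeval_casimir_lie, hx, map_smul]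

theorem aeval_casimir_prod_eq_zero {s : Finset (PosRoot n)} {p : PosRoot n → Polynomial ℂ}
    {α : PosRoot n} (hα : α ∈ s) {x : M} (hx : Polynomial.aeval (casimir n M) (p α) x = 0) :
    Polynomial.aeval (casimir n M) (∏ β ∈ s, p β) x = 0 := by
  classical
  rw [← Finset.prod_erase_mul s p hα, map_mul, Module.End.mul_apply, hx, map_zero]

/-- Each weight vector is killed by a polynomial in the Casimir operator, the roots of which come
from higher dominant weights. -/
theorem exists_aeval_casimir_eq_zero (hM : IsBounded M κ) (hf : LocNilpotent n M) {x : M}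
    (hx : x ∈ wtSpace M μ) : ∃ p : Polynomial ℂ, Polynomial.aeval (casimir n M) p x = 0 ∧
      ∀ z, p.IsRoot z → ∃ ν, IsDominant ν ∧ μ ∈ below ν ∧ z = casimirScalar ν := by
  refine hM.induction (p := fun μ x => ∃ p : Polynomial ℂ,
    Polynomial.aeval (casimir n M) p x = 0 ∧
      ∀ z, p.IsRoot z → ∃ ν, IsDominant ν ∧ μ ∈ below ν ∧ z = casimirScalar ν) ?_ ?_ hx
  · intro μ
    exact ⟨1, by simp, fun z hz => by simp [Polynomial.IsRoot] at hz⟩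
  · intro μ x hx ih
    choose p hp hroot using ih
    -- `q` annihilates every `e_α x`. As the Casimir operator commutes with `e_α`, the vector `q(C)
    -- x` is singular: it is either zero, or `μ` is dominant and one further linear factor kills it.
    set q := ∏ α, p α with hq
    have hqroot : ∀ z, q.IsRoot z → ∃ ν, IsDominant ν ∧ μ ∈ below ν ∧ z = casimirScalar ν := by
      intro z hz
      rw [hq, Polynomial.IsRoot, Polynomial.eval_prod, Finset.prod_eq_zero_iff] at hz
      obtain ⟨α, -, hα⟩ := hz
      obtain ⟨ν, h1, h2, h3⟩ := hroot α z hα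
      exact ⟨ν, h1, below_trans h2 ⟨Pi.single α 1, by rw [weight_single]⟩, h3⟩
    set y := Polynomial.aeval (casimir n M) q x with hy
    have hyμ : y ∈ wtSpace M μ := aeval_casimir_mem_wtSpace q hx
    have hys : IsSingular n y := by
      intro α
      rw [hy, ← aeval_casimir_lie]
      exact aeval_casimir_prod_eq_zero (Finset.mem_univ α) (hp α)
    rcases eq_or_ne y 0 with h0 | h0
    · exact ⟨q, h0, hqroot⟩
    · refine ⟨(Polynomial.X - Polynomial.C (casimirScalar μ)) * q, ?_, ?_⟩
      · rw [map_mul, Module.End.mul_apply, ← hy]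
        simp [casimir_apply_singular hyμ hys, Module.algebraMap_end_apply]
      · intro z hz
        rcases Polynomial.root_mul.1 hz with hz | hz
        · exact ⟨μ, hf.isDominant hyμ hys h0, self_mem_below μ, Polynomial.root_X_sub_C.1 hz ▸ rfl⟩
        · exact hqroot z hz

theorem aeval_casimir_singular (p : Polynomial ℂ) {x : M} (hx : x ∈ wtSpace M μ)
    (hs : IsSingular n x) : Polynomial.aeval (casimir n M) p x =
      p.eval (casimirScalar μ) • x := by
  have h : ∀ k : ℕ, (casimir n M ^ k) x = casimirScalar μ ^ k • x := by
    intro k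
    induction k with
    | zero => simp
    | succ k ih =>
      rw [pow_succ', Module.End.mul_apply, ih, map_smul, casimir_apply_singular hx hs, smul_smul,
        pow_succ]
  induction p using Polynomial.induction_on' with
  | add p q hp hq => simp [hp, hq, add_smul]
  | monomial k c => simp [Polynomial.aeval_monomial, h, Module.algebraMap_end_apply, smul_smul, mul_comm]

theorem mk_eq_zero_iff {N : LieSubmodule ℂ (Sl n) M} {x : M} :
    LieSubmodule.Quotient.mk' N x = 0 ↔ x ∈ N := by
  rw [← LieModuleHom.mem_ker, LieSubmodule.Quotient.mk'_ker]

/-- Vectors which are singular modulo a submodule can be corrected to singular vectors. -/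
theorem exists_singular_lift (hM : IsBounded M κ) (hf : LocNilpotent n M)
    (N : LieSubmodule ℂ (Sl n) M) {v : M} (hv : v ∈ wtSpace M μ)
    (hN : ∀ α : PosRoot n, ⁅eVec α, v⁆ ∈ N) :
    ∃ w ∈ wtSpace M μ, IsSingular n w ∧ v - w ∈ N ∧ (v ∈ N → w = 0) := by
  -- In this case the choice `w = 0` secures the last clause, so that zero steps of a filtration
  -- contribute no vector at all.
  by_cases hvN : v ∈ N
  · exact ⟨0, Submodule.zero_mem _, fun _ => lie_zero _, by rwa [sub_zero], fun _ => rfl⟩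
  let π := LieSubmodule.Quotient.mk' N
  have hπs : IsSingular n (π v) := by
    intro α
    rw [← LieModuleHom.map_lie]
    exact mk_eq_zero_iff.2 (hN α)
  have hπv : π v ∈ wtSpace _ μ := map_mem_wtSpace π hv
  have hμ : IsDominant μ := (hf.of_surjective π (LieSubmodule.Quotient.surjective_mk' N)).isDominant
    hπv hπs fun h => hvN (mk_eq_zero_iff.1 h)
  choose p hp hroot using fun α => exists_aeval_casimir_eq_zero hM hf (lie_eVec_mem_wtSpace hv α)
  set q := ∏ α, p α with hq
  -- The roots of `q` are Casimir scalars of dominant weights above some `μ + α`, hence strictly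
  -- above `μ`; the scalar of the dominant weight `μ` is not among them.
  have hc : q.eval (casimirScalar μ) ≠ 0 := by
    rw [hq, Polynomial.eval_prod, Finset.prod_ne_zero_iff]
    intro α _ h0
    obtain ⟨ν, hν, ⟨m, hm⟩, h⟩ := hroot α _ h0
    refine casimirScalar_ne hν hμ (m := Pi.single α 1 + m) ?_ ?_ h.symm
    · intro h1
      simpa using congrFun h1 α
    · rw [hm, weight_add, weight_single, add_assoc]
  -- Modulo `N` the vector `v` is singular, so there `q(C)` multiplies it by `q.eval (casimirScalar
  -- μ)`. Dividing by this scalar gives a vector congruent to `v`, and `q` kills all `e_α v`.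
  refine ⟨(q.eval (casimirScalar μ))⁻¹ • Polynomial.aeval (casimir n M) q v,
    Submodule.smul_mem _ _ (aeval_casimir_mem_wtSpace q hv), fun α => ?_, ?_, fun h => absurd h hvN⟩
  · rw [lie_smul, ← aeval_casimir_lie, aeval_casimir_prod_eq_zero (Finset.mem_univ α) (hp α),
      smul_zero]
  · refine mk_eq_zero_iff.1 ?_
    change π _ = 0
    rw [map_sub, map_smul, map_aeval_casimir, aeval_casimir_singular q hπv hπs, smul_smul,
      inv_mul_cancel₀ hc, one_smul, sub_self]

/-- A nonzero submodule contains a singular vector `y` of some weight `ν` below `μ`. The Casimir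
operator is the scalar of `μ` on everything generated by `v`, so the scalars of `ν` and `μ` agree.
This forces `ν = μ`, and then `y` is a multiple of `v`. -/
theorem isAtom_lieSpan (hM : IsBounded M κ) (hf : LocNilpotent n M) {v : M}
    (hv : v ∈ wtSpace M μ) (hs : IsSingular n v) (h0 : v ≠ 0) :
    IsAtom (LieSubmodule.lieSpan ℂ (Sl n) {v}) := by
  have hvS : v ∈ LieSubmodule.lieSpan ℂ (Sl n) {v} := LieSubmodule.subset_lieSpan rfl
  refine ⟨fun h => h0 ?_, fun N hN => ?_⟩
  · rw [h] at hvS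
    exact (LieSubmodule.mem_bot v).1 hvS
  by_contra hne
  obtain ⟨ν, y, hyN, hyν, hys, hy0⟩ := hM.exists_singular hne
  have hyS := hN.le hyN
  obtain ⟨m, hm⟩ := mem_of_mem_wtSum (lieSpan_singleton_le_wtSum hs hv hyS) hyν hy0
  let E : LieSubmodule ℂ (Sl n) M :=
    { LinearMap.ker (casimir n M - algebraMap ℂ _ (casimirScalar μ)) with
      lie_mem := by
        intro z x hx
        change x ∈ LinearMap.ker _ at hx
        change _ ∈ LinearMap.ker _
        rw [LinearMap.mem_ker, LinearMap.sub_apply, Module.algebraMap_end_apply] at hx ⊢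
        have h1 := LinearMap.congr_fun (casimir_comm (M := M) z).eq x
        simp only [Module.End.mul_apply, LieModule.toEnd_apply_apply] at h1
        rw [h1, ← lie_smul, ← lie_sub, hx, lie_zero] }
  have hE : ∀ x, x ∈ E ↔ casimir n M x = casimirScalar μ • x := by
    intro x
    change x ∈ LinearMap.ker _ ↔ _
    rw [LinearMap.mem_ker, LinearMap.sub_apply, Module.algebraMap_end_apply, sub_eq_zero]
  have hle : LieSubmodule.lieSpan ℂ (Sl n) {v} ≤ E := by
    rw [LieSubmodule.lieSpan_le, Set.singleton_subset_iff]
    exact (hE v).2 (casimir_apply_singular hv hs)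
  have hyE := (hE y).1 (hle hyS)
  rw [casimir_apply_singular hyν hys] at hyE
  have hc : casimirScalar ν = casimirScalar μ := smul_left_injective ℂ hy0 hyE
  have hm0 : m = 0 := by
    by_contra hm0
    exact casimirScalar_ne (hf.isDominant hv hs h0) (hf.isDominant hyν hys hy0) hm0 hm hc.symm
  rw [hm0, weight_zero, add_zero] at hm
  subst hm
  obtain ⟨c, rfl⟩ := exists_smul_of_mem_lieSpan hs hv hyS hyν
  have hc0 : c ≠ 0 := fun h => hy0 (by rw [h, zero_smul])
  have hvN : v ∈ N := by
    simpa [smul_smul, hc0] using N.smul_mem c⁻¹ hyN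
  exact hN.not_ge (LieSubmodule.lieSpan_le.2 (Set.singleton_subset_iff.2 hvN))

/-- The socle contains every weight vector, by induction along `𝔫⁺`: if it contains all `e_α x`,
then `x` differs by an element of the socle from a singular vector, which is zero or generates an
atom. -/
theorem complementedLattice (hM : IsBounded M κ) (hf : LocNilpotent n M) :
    ComplementedLattice (LieSubmodule ℂ (Sl n) M) := by
  refine complementedLattice_of_sSup_atoms_eq_top (eq_top_iff.2 ?_)
  set A := sSup {N : LieSubmodule ℂ (Sl n) M | IsAtom N} with hA
  have h1 : ∀ μ : Module.Dual ℂ (cartan n), ∀ x ∈ wtSpace M μ, x ∈ A := by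
    intro μ x hx
    refine hM.induction (p := fun _ x => x ∈ A) (fun _ => A.zero_mem) ?_ hx
    intro μ x hx ih
    obtain ⟨w, hw, hws, hwA, -⟩ := exists_singular_lift hM hf A hx ih
    have hwA' : w ∈ A := by
      rcases eq_or_ne w 0 with rfl | h0
      · exact A.zero_mem
      · have h3 : LieSubmodule.lieSpan ℂ (Sl n) {w} ≤ A := le_sSup (isAtom_lieSpan hM hf hw hws h0)
        exact h3 (LieSubmodule.subset_lieSpan rfl)
    simpa using A.add_mem hwA hwA'
  have h2 : wtSum M (below κ) ≤ (A : Submodule ℂ M) :=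
    Submodule.span_le.2 fun x ⟨μ, _, hx⟩ => h1 μ x hx
  rw [hM] at h2
  exact fun x _ => h2 Submodule.mem_top

/-! ## Simple modules -/

/-- The vectors `f^k x` are eigenvectors of `h_α` for distinct eigenvalues; were all of them
nonzero, they would be linearly independent. -/
theorem locNilpotent_of_finiteDimensional [FiniteDimensional ℂ M] (hM : IsBounded M κ) :
    LocNilpotent n M := by
  intro α
  let f := LieModule.toEnd ℂ (Sl n) M (fVec α)
  let K : Submodule ℂ M :=
    { carrier := {x | ∃ k : ℕ, (f ^ k) x = 0}
      zero_mem' := ⟨0, by simp⟩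
      add_mem' := by
        rintro x y ⟨k, hk⟩ ⟨l, hl⟩
        refine ⟨k + l, ?_⟩
        rw [map_add, pow_add, Module.End.mul_apply, Module.End.mul_apply, hl, map_zero,
          ← Module.End.mul_apply, (Commute.pow_pow_self f k l).eq, Module.End.mul_apply, hk,
          map_zero, add_zero]
      smul_mem' := by
        rintro c x ⟨k, hk⟩
        exact ⟨k, by rw [map_smul, hk, smul_zero]⟩ }
  suffices h : wtSum M (below κ) ≤ K by
    rw [hM] at h
    exact fun x => h Submodule.mem_top
  refine Submodule.span_le.2 ?_
  rintro x ⟨μ, -, hx⟩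
  change ∃ k : ℕ, (f ^ k) x = 0
  have hfk : ∀ k : ℕ, ⁅(coroot α : Sl n), (f ^ k) x⁆ = (μ (coroot α) - 2 * k) • (f ^ k) x := by
    intro k
    induction k with
    | zero => simpa using hx (coroot α)
    | succ k ih =>
      rw [pow_succ', Module.End.mul_apply]
      change ⁅_, ⁅fVec α, (f ^ k) x⁆⁆ = _ • ⁅fVec α, (f ^ k) x⁆
      rw [leibniz_lie, ih, cartan_lie_fVec, toDual_coroot_self, smul_lie, lie_smul, ← add_smul]
      push_cast
      ring_nf
  by_contra! hne
  have hli := Module.End.eigenvectors_linearIndependent' (LieModule.toEnd ℂ (Sl n) M (coroot α : Sl n))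
    (fun k : ℕ => μ (coroot α) - 2 * k) (fun k l h => by simpa using h) (fun k => (f ^ k) x)
    fun k => ⟨Module.End.mem_eigenspace_iff.2 (hfk k), hne k⟩
  have := hli.finite
  exact not_finite ℕ

end Semisimple

end SlCurrent

end

noncomputable section

namespace SlCurrent

variable {n : ℕ}

/-! ### Products of modules, as ambient modules for graphs of homomorphisms -/

section Prod

variable {M : Type*} [AddCommGroup M] [Module ℂ M] [LieRingModule (Sl n) M]
  [LieModule ℂ (Sl n) M]
variable {V : Type*} [AddCommGroup V] [Module ℂ V] [LieRingModule (Sl n) V]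
  [LieModule ℂ (Sl n) V]

instance : LieRingModule (Sl n) (M × V) where
  bracket y x := (⁅y, x.1⁆, ⁅y, x.2⁆)
  add_lie y z x := Prod.ext (add_lie y z x.1) (add_lie y z x.2)
  lie_add y x x' := Prod.ext (lie_add y x.1 x'.1) (lie_add y x.2 x'.2)
  leibniz_lie y z x := Prod.ext (leibniz_lie y z x.1) (leibniz_lie y z x.2)

instance : LieModule ℂ (Sl n) (M × V) where
  smul_lie c y x := Prod.ext (smul_lie c y x.1) (smul_lie c y x.2)
  lie_smul c y x := Prod.ext (lie_smul c y x.1) (lie_smul c y x.2)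

variable (n M V) in
/-- The first projection of a product of modules. -/
def fstHom : M × V →ₗ⁅ℂ, Sl n⁆ M := { LinearMap.fst ℂ M V with map_lie' := rfl }

variable (n M V) in
/-- The second projection of a product of modules. -/
def sndHom : M × V →ₗ⁅ℂ, Sl n⁆ V := { LinearMap.snd ℂ M V with map_lie' := rfl }

variable (n M V) in
/-- The first inclusion into a product of modules. -/
def inlHom : M →ₗ⁅ℂ, Sl n⁆ M × V :=
  { LinearMap.inl ℂ M V with map_lie' := fun {y _} => Prod.ext rfl (lie_zero y).symm }

theorem LocNilpotent.prod (hM : LocNilpotent n M) (hV : LocNilpotent n V) :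
    LocNilpotent n (M × V) := by
  intro α x
  obtain ⟨k, hk⟩ := hM α x.1
  obtain ⟨l, hl⟩ := hV α x.2
  refine ⟨k + l, Prod.ext ?_ ?_⟩
  · have h := map_toEnd_pow (fstHom n M V) (fVec α) (k + l) x
    refine h.trans ?_
    rw [add_comm, pow_add, Module.End.mul_apply]
    exact (congrArg _ hk).trans (map_zero _)
  · have h := map_toEnd_pow (sndHom n M V) (fVec α) (k + l) x
    refine h.trans ?_
    rw [pow_add, Module.End.mul_apply]
    exact (congrArg _ hl).trans (map_zero _)

theorem IsBounded.prod {κ : Module.Dual ℂ (cartan n)} (hM : IsBounded M κ) (hV : IsBounded V κ) :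
    IsBounded (M × V) κ := by
  have h1 : wtSum M (below κ) ≤ (wtSum (M × V) (below κ)).comap (LinearMap.inl ℂ M V) :=
    Submodule.span_le.2 fun x ⟨μ, hμ, hx⟩ => Submodule.subset_span ⟨μ, hμ, fun h =>
      Prod.ext (hx h) ((lie_zero _).trans (smul_zero _).symm)⟩
  have h2 : wtSum V (below κ) ≤ (wtSum (M × V) (below κ)).comap (LinearMap.inr ℂ M V) :=
    Submodule.span_le.2 fun x ⟨μ, hμ, hx⟩ => Submodule.subset_span ⟨μ, hμ, fun h =>
      Prod.ext ((lie_zero _).trans (smul_zero _).symm) (hx h)⟩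
  rw [hM] at h1
  rw [hV] at h2
  refine eq_top_iff.2 fun x _ => ?_
  have h3 : ((x.1, 0) : M × V) ∈ wtSum (M × V) (below κ) := h1 Submodule.mem_top
  have h4 : ((0, x.2) : M × V) ∈ wtSum (M × V) (below κ) := h2 Submodule.mem_top
  simpa using Submodule.add_mem _ h3 h4

end Prod

/-! ### Homomorphisms to a simple module -/

section Hom

variable {M : Type*} [AddCommGroup M] [Module ℂ M] [LieRingModule (Sl n) M]
  [LieModule ℂ (Sl n) M] {κ τ : Module.Dual ℂ (cartan n)}
variable {V : Type*} [AddCommGroup V] [Module ℂ V] [LieRingModule (Sl n) V]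
  [LieModule ℂ (Sl n) V]

omit [LieModule ℂ (Sl n) V] in
theorem lieSpan_singleton_eq_top [LieModule.IsIrreducible ℂ (Sl n) V] {v : V} (h : v ≠ 0) :
    LieSubmodule.lieSpan ℂ (Sl n) {v} = ⊤ := by
  refine (IsSimpleOrder.eq_bot_or_eq_top _).resolve_left fun h1 => h ?_
  rw [LieSubmodule.lieSpan_eq_bot_iff] at h1
  exact h1 v rfl

theorem isBounded_of_isIrreducible [LieModule.IsIrreducible ℂ (Sl n) V] {v : V} (h : v ≠ 0)
    (hv : v ∈ wtSpace V τ) (hs : IsSingular n v) : IsBounded V τ := by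
  have h1 := lieSpan_singleton_le_wtSum hs hv
  rw [lieSpan_singleton_eq_top h] at h1
  exact eq_top_iff.2 h1

/-- A nonzero singular weight vector generates the simple module, so each of two such vectors bounds
the weight of the other. The weights coincide, and the highest weight space is a line. -/
theorem singular_eq [LieModule.IsIrreducible ℂ (Sl n) V] {v : V} (h : v ≠ 0)
    (hv : v ∈ wtSpace V τ) (hs : IsSingular n v) {μ : Module.Dual ℂ (cartan n)} {w : V}
    (hw : w ∈ wtSpace V μ) (hws : IsSingular n w) : (μ ≠ τ → w = 0) ∧ ∃ c : ℂ, w = c • v := by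
  by_cases h0 : w = 0
  · exact ⟨fun _ => h0, 0, by rw [h0, zero_smul]⟩
  have hb := isBounded_of_isIrreducible h hv hs
  have hb' := isBounded_of_isIrreducible h0 hw hws
  have hμτ : μ = τ := below_antisymm (hb'.mem_below hv h) (hb.mem_below hw h0)
  subst hμτ
  exact ⟨fun h => absurd rfl h, exists_smul_of_mem_lieSpan hs hv
    (by rw [lieSpan_singleton_eq_top h]; trivial) hw⟩

/-- The submodule `G` generated by `(w, v)` is simple, hence the graph of a map on the submodule `S`
generated by `w`. As `S` is simple and not inside `W`, it meets `W` trivially; a complement `Z` of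
`S ⊔ W` allows the map to be extended by zero on `W ⊔ Z`. -/
theorem exists_hom (hM : IsBounded M κ) (hf : LocNilpotent n M) (hVf : LocNilpotent n V)
    [LieModule.IsIrreducible ℂ (Sl n) V] {v : V} (h : v ≠ 0) (hv : v ∈ wtSpace V τ)
    (hs : IsSingular n v) (W : LieSubmodule ℂ (Sl n) M) {w : M} (hwW : w ∉ W)
    (hw : w ∈ wtSpace M τ) (hws : IsSingular n w) :
    ∃ φ : M →ₗ⁅ℂ, Sl n⁆ V, φ w = v ∧ ∀ x ∈ W, φ x = 0 := by
  have hw0 : w ≠ 0 := fun h => hwW (h ▸ W.zero_mem)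
  have hVτ := isBounded_of_isIrreducible h hv hs
  -- The weight `τ` of `w` lies below `κ`, hence so do all weights of `V`, and the results on
  -- bounded modules apply to `M × V`.
  have hVκ : IsBounded V κ := eq_top_iff.2 (hVτ.ge.trans (wtSum_mono fun ν hν =>
    below_trans (hM.mem_below hw hw0) hν))
  have hatom := isAtom_lieSpan hM hf hw hws hw0
  have hPatom := isAtom_lieSpan (hM.prod hVκ) (hf.prod hVf) (v := (w, v)) (μ := τ)
    (fun a => Prod.ext (hw a) (hv a)) (fun α => Prod.ext (hws α) (hs α))
    (fun h0 => hw0 (congrArg Prod.fst h0))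
  set S := LieSubmodule.lieSpan ℂ (Sl n) {w} with hS
  set G := LieSubmodule.lieSpan ℂ (Sl n) {(w, v)} with hG
  have hwS : w ∈ S := LieSubmodule.subset_lieSpan rfl
  have hwvG : (w, v) ∈ G := LieSubmodule.subset_lieSpan rfl
  have hcompl := complementedLattice hM hf
  have hWS : Disjoint S W := hatom.not_le_iff_disjoint.1 fun hle => hwW (hle hwS)
  obtain ⟨Z, hZ⟩ := exists_isCompl (S ⊔ W)
  have hQ : Disjoint S (W ⊔ Z) := hWS.disjoint_sup_right_of_disjoint_sup_left hZ.disjoint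
  have hGfst : ∀ x ∈ G, x.1 ∈ S := by
    have : G ≤ S.comap (fstHom n M V) := by
      rw [hG, LieSubmodule.lieSpan_le, Set.singleton_subset_iff]
      exact hwS
    exact this
  have hGinj : ∀ x ∈ G, x.1 = 0 → x = 0 := by
    have : G ⊓ (fstHom n M V).ker = ⊥ := by
      refine (hPatom.le_iff.1 inf_le_left).resolve_right fun h1 => hw0 ?_
      exact (h1.ge.trans inf_le_right : G ≤ _) hwvG
    intro x hx hx1
    have h2 : x ∈ G ⊓ (fstHom n M V).ker := ⟨hx, hx1⟩
    rw [this] at h2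
    exact (LieSubmodule.mem_bot x).1 h2
  -- The graph of the homomorphism to be constructed. It remains to see that its first projection is
  -- bijective; the map is then the inverse followed by the second projection.
  let T : LieSubmodule ℂ (Sl n) (M × V) := G ⊔ (W ⊔ Z).map (inlHom n M V)
  have hTinl : ∀ x ∈ W ⊔ Z, (x, (0 : V)) ∈ T := fun x hx =>
    (le_sup_right : _ ≤ T) ((LieSubmodule.mem_map _).2 ⟨x, hx, rfl⟩)
  let f : T →ₗ⁅ℂ, Sl n⁆ M := (fstHom n M V).comp T.incl
  have hf_inj : Function.Injective f := by
    refine (injective_iff_map_eq_zero f).2 ?_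
    rintro ⟨x, hx⟩ hx0
    replace hx0 : x.1 = 0 := hx0
    obtain ⟨g, hg, q, hq, rfl⟩ := (LieSubmodule.mem_sup _ _ _).1 hx
    obtain ⟨q, hqWZ, rfl⟩ := (LieSubmodule.mem_map _).1 hq
    replace hx0 : g.1 + q = 0 := hx0
    have hg1 : g.1 = 0 := by
      have h1 : g.1 ∈ W ⊔ Z := by
        rw [eq_neg_of_add_eq_zero_left hx0]
        exact neg_mem hqWZ
      have h2 : g.1 ∈ S ⊓ (W ⊔ Z) := ⟨hGfst g hg, h1⟩
      rw [hQ.eq_bot] at h2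
      exact (LieSubmodule.mem_bot _).1 h2
    have hq0 : q = 0 := by rwa [hg1, zero_add] at hx0
    apply Subtype.ext
    change g + _ = 0
    rw [hGinj g hg hg1, hq0, map_zero, zero_add]
  have hf_surj : Function.Surjective f := by
    have h1 : S ⊔ (W ⊔ Z) ≤ f.range := by
      refine sup_le ?_ ?_
      · rw [hS, LieSubmodule.lieSpan_le, Set.singleton_subset_iff]
        exact (LieModuleHom.mem_range f w).2 ⟨⟨(w, v), (le_sup_left : G ≤ T) hwvG⟩, rfl⟩
      · intro x hx
        exact (LieModuleHom.mem_range f x).2 ⟨⟨(x, 0), hTinl x hx⟩, rfl⟩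
    rw [← sup_assoc, hZ.sup_eq_top] at h1
    intro x
    exact (LieModuleHom.mem_range f x).1 (h1 trivial)
  let e : T ≃ₗ[ℂ] M := LinearEquiv.ofBijective (f : T →ₗ[ℂ] M) ⟨hf_inj, hf_surj⟩
  have he : ∀ t : T, e t = f t := fun _ => rfl
  let ψ : M →ₗ⁅ℂ, Sl n⁆ T :=
    { (e.symm : M →ₗ[ℂ] T) with
      map_lie' := by
        intro y x
        change e.symm ⁅y, x⁆ = ⁅y, e.symm x⁆
        rw [LinearEquiv.symm_apply_eq, he, LieModuleHom.map_lie, ← he, LinearEquiv.apply_symm_apply] }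
  have hψ : ∀ x y (hxy : (x, y) ∈ T), ψ x = ⟨(x, y), hxy⟩ := by
    intro x y hxy
    change e.symm x = _
    rw [LinearEquiv.symm_apply_eq]
    rfl
  refine ⟨(sndHom n M V).comp (T.incl.comp ψ), ?_, fun x hx => ?_⟩
  · change (ψ w).1.2 = v
    rw [hψ w v ((le_sup_left : G ≤ T) hwvG)]
  · change (ψ x).1.2 = 0
    rw [hψ x 0 (hTinl x ((le_sup_left : W ≤ W ⊔ Z) hx))]

/-- The multiplicity of a simple module in a module filtered by well-ordered cyclic subquotients. -/
theorem finrank_hom_eq (hM : IsBounded M κ) (hf : LocNilpotent n M)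
    [FiniteDimensional ℂ V] [LieModule.IsIrreducible ℂ (Sl n) V] {v : V} (h : v ≠ 0)
    (hv : v ∈ wtSpace V τ) (hs : IsSingular n v)
    {P : Type*} [AddCommGroup P] [Module ℂ P] [LieRingModule (Sl n) P] [LieModule ℂ (Sl n) P]
    (j : P →ₗ⁅ℂ, Sl n⁆ M) (hj : Function.Injective j)
    {ι : Type*} [LinearOrder ι] [WellFoundedLT ι] (u : ι → M) (wt : ι → Module.Dual ℂ (cartan n))
    (N : ι → LieSubmodule ℂ (Sl n) M)
    (hN : ∀ k, N k = ⨆ l < k, LieSubmodule.lieSpan ℂ (Sl n) {u l})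
    (hu : ∀ k, u k ∈ wtSpace M (wt k)) (hus : ∀ k, ∀ α : PosRoot n, ⁅eVec α, u k⁆ ∈ N k)
    (hjr : j.range = ⨆ k, LieSubmodule.lieSpan ℂ (Sl n) {u k})
    (hfin : {k | u k ∉ N k ∧ wt k = τ}.Finite) :
    Module.Finite ℂ (P →ₗ⁅ℂ, Sl n⁆ V) ∧
      (Module.finrank ℂ (P →ₗ⁅ℂ, Sl n⁆ V) : ℕ∞) = {k | u k ∉ N k ∧ wt k = τ}.encard := by
  have hVf := locNilpotent_of_finiteDimensional (isBounded_of_isIrreducible h hv hs)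
  -- Each generator is replaced by a truly singular vector in the same class modulo its
  -- predecessors, and by zero if it already lies in their span.
  choose w hw hws hwN hw0 using fun k => exists_singular_lift hM hf (N k) (hu k) (hus k)
  have hmem : ∀ {l k}, l < k → u l ∈ N k := by
    intro l k hlk
    rw [hN]
    exact (le_iSup₂ (f := fun l (_ : l < k) => LieSubmodule.lieSpan ℂ (Sl n) {u l}) l hlk)
      (LieSubmodule.subset_lieSpan rfl)
  have hNle : ∀ {k} {D : LieSubmodule ℂ (Sl n) M}, (∀ l < k, u l ∈ D) → N k ≤ D := by
    intro k D hD
    rw [hN]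
    exact iSup₂_le fun l hl => LieSubmodule.lieSpan_le.2 (Set.singleton_subset_iff.2 (hD l hl))
  have hur : ∀ k, u k ∈ j.range := by
    intro k
    rw [hjr]
    exact (le_iSup (fun k => LieSubmodule.lieSpan ℂ (Sl n) {u k}) k)
      (LieSubmodule.subset_lieSpan rfl)
  have hwr : ∀ k, ∃ p : P, j p = w k := by
    intro k
    refine (LieModuleHom.mem_range j _).1 ?_
    have := sub_mem (hur k) (hNle (fun l _ => hur l) (hwN k))
    simpa using this
  choose p hp using hwr
  -- A linear form which identifies the highest weight line of `V` with `ℂ`. Images of singular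
  -- vectors of weight `τ` lie on this line, so `ω` loses nothing.
  obtain ⟨ω, hω⟩ : ∃ ω : V →ₗ[ℂ] ℂ, ω v ≠ 0 := by
    by_contra! hcon
    exact h ((Module.forall_dual_apply_eq_zero_iff ℂ v).1 hcon)
  set K := {k | u k ∉ N k ∧ wt k = τ} with hK
  have : Fintype K := hfin.fintype
  let R : (P →ₗ⁅ℂ, Sl n⁆ V) →ₗ[ℂ] (K → ℂ) :=
    { toFun := fun φ k => ω (φ (p k))
      map_add' := fun φ ψ => by ext; simp
      map_smul' := fun c φ => by ext; simp }
  have hpw : ∀ k, p k ∈ wtSpace P (wt k) := by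
    intro k a
    apply hj
    rw [LieModuleHom.map_lie, map_smul, hp, hw k]
  have hps : ∀ k, IsSingular n (p k) := by
    intro k α
    apply hj
    rw [LieModuleHom.map_lie, map_zero, hp, hws k]
  have hR : Function.Injective R := by
    refine (injective_iff_map_eq_zero R).2 fun φ hφ => ?_
    have h0 : ∀ k, φ (p k) = 0 := by
      intro k
      have hk := singular_eq h hv hs (map_mem_wtSpace φ (hpw k)) ((hps k).map φ)
      by_cases hkN : u k ∈ N k
      · have : p k = 0 := hj (by rw [hp, hw0 k hkN, map_zero])
        rw [this, map_zero]
      · by_cases hkτ : wt k = τ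
        · obtain ⟨c, hc⟩ := hk.2
          have h2 : ω (φ (p k)) = 0 := congrFun hφ ⟨k, hkN, hkτ⟩
          rw [hc, map_smul, smul_eq_mul] at h2
          rw [hc, (mul_eq_zero.1 h2).resolve_right hω, zero_smul]
        · exact hk.1 hkτ
    -- Every `u k` is the sum of `w k` and an element generated by earlier `u l`, so a homomorphism
    -- which vanishes on all `p k` vanishes altogether.
    have hD : ∀ k, u k ∈ φ.ker.map j := by
      intro k
      induction k using WellFoundedLT.induction with
      | ind k ih =>
        have h1 := hNle ih (hwN k)
        have h2 : w k ∈ φ.ker.map j := (LieSubmodule.mem_map _).2 ⟨p k, h0 k, hp k⟩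
        simpa using add_mem h1 h2
    have hle : j.range ≤ φ.ker.map j := by
      rw [hjr]
      exact iSup_le fun k => LieSubmodule.lieSpan_le.2 (Set.singleton_subset_iff.2 (hD k))
    ext x
    obtain ⟨y, hy, hyx⟩ := (LieSubmodule.mem_map _).1 (hle ((LieModuleHom.mem_range j _).2 ⟨x, rfl⟩))
    rw [← hj hyx]
    exact hy
  have hfinite : Module.Finite ℂ (P →ₗ⁅ℂ, Sl n⁆ V) := Module.Finite.of_injective R hR
  have hle : Module.finrank ℂ (P →ₗ⁅ℂ, Sl n⁆ V) ≤ Fintype.card K := by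
    simpa using LinearMap.finrank_le_finrank_of_injective hR
  have hexφ : ∀ k : K, ∃ φ : M →ₗ⁅ℂ, Sl n⁆ V, φ (w k) = v ∧ ∀ x ∈ N k, φ x = 0 := by
    rintro ⟨k, hk⟩
    refine exists_hom hM hf hVf h hv hs (N k) (fun hwk => hk.1 ?_) (hk.2 ▸ hw k) (hws k)
    simpa using add_mem (hwN k) hwk
  choose φ hφ hφN using hexφ
  -- Triangularity: `φ l` kills `N l`, which contains `w k` for all `k < l`, while `φ k (w k) = v`
  -- is nonzero.
  have hli : LinearIndependent ℂ fun k : K => (φ k).comp j := by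
    rw [Fintype.linearIndependent_iff]
    intro c hc k
    induction k using WellFoundedLT.induction with
    | ind k ih =>
      have h1 : ∑ l : K, c l • φ l (w k) = 0 := by
        have := LieModuleHom.congr_fun hc (p k)
        rw [LieModuleHom.zero_apply] at this
        rw [← this, ← hp]
        have h3 : ∀ s : Finset K, ∑ l ∈ s, c l • φ l (j (p k)) =
            (∑ l ∈ s, c l • (φ l).comp j) (p k) := by
          intro s
          classical
          induction s using Finset.induction_on with
          | empty => simp
          | insert a s ha ih => rw [Finset.sum_insert ha, Finset.sum_insert ha, ih]; rfl
        exact h3 _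
      rw [Finset.sum_eq_single k] at h1
      · rw [hφ] at h1
        exact (smul_eq_zero.1 h1).resolve_right h
      · intro l _ hlk
        rcases lt_or_gt_of_ne hlk with hlt | hgt
        · rw [ih l hlt, zero_smul]
        · have h4 : w k ∈ N l := by
            have h5 := sub_mem (hmem hgt)
              (hNle (D := N l) (fun i hi => hmem (lt_trans hi hgt)) (hwN k))
            simpa using h5
          rw [hφN l _ h4, smul_zero]
      · simp
  refine ⟨hfinite, ?_⟩
  rw [le_antisymm hle hli.fintype_card_le_finrank, Set.encard_eq_coe_toFinset_card,
    Set.toFinset_card]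

end Hom

end SlCurrent

end

noncomputable section

namespace SlCurrent

variable {n : ℕ}

/-! ## The enveloping algebra of the current algebra -/

section Enveloping

attribute [local instance 100] LieRing.ofAssociativeRing

theorem cur_lie (x y : Sl n) (p q : Polynomial ℂ) :
    cur ⁅x, y⁆ (p * q) = cur x p * cur y q - cur y q * cur x p := by
  have h : ((p * q) ⊗ₜ[ℂ] ⁅x, y⁆ : Current n) = ⁅p ⊗ₜ[ℂ] x, q ⊗ₜ[ℂ] y⁆ := by
    rw [LieAlgebra.ExtendScalars.bracket_tmul]
  rw [cur, h]
  exact (LieHom.map_lie (UniversalEnvelopingAlgebra.ι ℂ) _ _).trans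
    (LieRing.of_associative_ring_bracket _ _)

theorem cur_mul_comm (x y : Sl n) (p q : Polynomial ℂ) :
    cur x p * cur y q = cur y q * cur x p + cur ⁅x, y⁆ (p * q) := by
  rw [cur_lie]; abel

theorem cur_add_right (x : Sl n) (p q : Polynomial ℂ) : cur x (p + q) = cur x p + cur x q := by
  simp only [cur, TensorProduct.add_tmul, map_add]

theorem cur_smul_right (c : ℂ) (x : Sl n) (p : Polynomial ℂ) : cur x (c • p) = c • cur x p := by
  simp only [cur, ← TensorProduct.smul_tmul', map_smul]

theorem cur_zero_left (p : Polynomial ℂ) : cur (0 : Sl n) p = 0 := by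
  simp only [cur, TensorProduct.tmul_zero, map_zero]

/-- The universal property sends the enveloping algebra into the subalgebra, and composing with the
inclusion gives the identity by uniqueness. -/
theorem envelopingAlgebra_adjoin_range_ι (L : Type*) [LieRing L] [LieAlgebra ℂ L] :
    Algebra.adjoin ℂ (Set.range (UniversalEnvelopingAlgebra.ι ℂ : L →ₗ⁅ℂ⁆ _)) = ⊤ := by
  set A := Algebra.adjoin ℂ (Set.range (UniversalEnvelopingAlgebra.ι ℂ : L →ₗ⁅ℂ⁆ _)) with hA
  let j : L →ₗ⁅ℂ⁆ A :=
    { toFun := fun x => ⟨UniversalEnvelopingAlgebra.ι ℂ x, Algebra.subset_adjoin ⟨x, rfl⟩⟩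
      map_add' := fun x y => Subtype.ext (map_add _ x y)
      map_smul' := fun c x => Subtype.ext (map_smul _ c x)
      map_lie' := fun {x y} => Subtype.ext (LieHom.map_lie _ x y) }
  have h : A.val.comp (UniversalEnvelopingAlgebra.lift ℂ j) = AlgHom.id ℂ _ := by
    apply UniversalEnvelopingAlgebra.hom_ext
    ext x
    change (UniversalEnvelopingAlgebra.lift ℂ j (UniversalEnvelopingAlgebra.ι ℂ x)).1 =
      UniversalEnvelopingAlgebra.ι ℂ x
    rw [UniversalEnvelopingAlgebra.lift_ι_apply]
    rfl
  refine eq_top_iff.2 fun u _ => ?_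
  have := AlgHom.congr_fun h u
  rw [AlgHom.id_apply] at this
  rw [← this]
  exact (UniversalEnvelopingAlgebra.lift ℂ j u).2

/-- A subspace stable under all `x ⊗ p` is stable under the enveloping algebra. -/
theorem smul_mem_of_cur_smul_mem {W : Type*} [AddCommGroup W] [Module (UCurrent n) W] [Module ℂ W]
    [IsScalarTower ℂ (UCurrent n) W] (K : Submodule ℂ W)
    (h : ∀ (x : Sl n) (p : Polynomial ℂ), ∀ v ∈ K, cur x p • v ∈ K) (u : UCurrent n) {v : W}
    (hv : v ∈ K) : u • v ∈ K := by
  have hu : u ∈ Algebra.adjoin ℂ (Set.range (UniversalEnvelopingAlgebra.ι ℂ :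
      Current n →ₗ⁅ℂ⁆ UCurrent n)) := by
    rw [envelopingAlgebra_adjoin_range_ι]; trivial
  induction hu using Algebra.adjoin_induction generalizing v with
  | mem u hu =>
    obtain ⟨z, rfl⟩ := hu
    induction z using TensorProduct.induction_on with
    | zero => rw [map_zero, zero_smul]; exact K.zero_mem
    | tmul p x => exact h x p v hv
    | add a b ha hb => rw [map_add, add_smul]; exact K.add_mem ha hb
  | algebraMap c => rw [algebraMap_smul]; exact K.smul_mem c hv
  | add a b _ _ ha hb => rw [add_smul]; exact K.add_mem (ha hv) (hb hv)
  | mul a b _ _ ha hb => rw [mul_smul]; exact ha (hb hv)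

/-- The endomorphism of the current algebra with `t ↦ 2 t`. -/
def currentScale (n : ℕ) : Current n →ₗ⁅ℂ⁆ Current n :=
  LieAlgebra.ExtendScalars.map (Polynomial.aeval (2 * Polynomial.X : Polynomial ℂ)) LieHom.id

/-- The endomorphism of the enveloping algebra with `t ↦ 2 t`. -/
def scale (n : ℕ) : UCurrent n →ₐ[ℂ] UCurrent n :=
  UniversalEnvelopingAlgebra.lift ℂ ((UniversalEnvelopingAlgebra.ι ℂ).comp (currentScale n))

theorem scale_cur (x : Sl n) (p : Polynomial ℂ) :
    scale n (cur x p) = cur x (Polynomial.aeval (2 * Polynomial.X) p) := by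
  rw [scale, cur, UniversalEnvelopingAlgebra.lift_ι_apply]
  rfl

theorem scale_cur_one (x : Sl n) : scale n (cur x 1) = cur x 1 := by
  rw [scale_cur, map_one]

theorem scale_cur_X_pow (x : Sl n) (r : ℕ) :
    scale n (cur x (Polynomial.X ^ r)) = (2 : ℂ) ^ r • cur x (Polynomial.X ^ r) := by
  rw [scale_cur, ← cur_smul_right]
  congr 1
  rw [map_pow, Polynomial.aeval_X, mul_pow, Polynomial.smul_eq_C_mul, Polynomial.C_pow]
  rfl

end Enveloping

/-! ## Relations in `F` -/

/-- Left ideals which define integrable modules. -/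
structure IsIntegrableIdeal (wt₁ wt₂ : DomWeight n) (J : Submodule (UCurrent n) (UCurrent n)) :
    Prop where
  rel_le : relIdeal wt₁ wt₂ ≤ J
  nilpotent : ∀ (α : PosRoot n) (u : UCurrent n),
    (∃ k : ℕ, cur (eVec α) 1 ^ k * u ∈ J) ∧ ∃ k : ℕ, cur (fVec α) 1 ^ k * u ∈ J

namespace FModule

variable {wt₁ wt₂ : DomWeight n}

/-- `F` is the quotient of the enveloping algebra by the intersection of these left ideals, so a
relation in `F` may be checked modulo each of them separately. -/
theorem smul_one_eq_zero_iff {u : UCurrent n} : u • one wt₁ wt₂ = 0 ↔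
    ∀ J, IsIntegrableIdeal wt₁ wt₂ J → u ∈ J := by
  have h1 : u • one wt₁ wt₂ = 0 ↔ (Submodule.Quotient.mk u : UCurrent n ⧸ relIdeal wt₁ wt₂) ∈
      integrableKernel n (UCurrent n ⧸ relIdeal wt₁ wt₂) := by
    have : u • one wt₁ wt₂ = (Submodule.Quotient.mk (Submodule.Quotient.mk u) :
        (UCurrent n ⧸ relIdeal wt₁ wt₂) ⧸ integrableKernel n (UCurrent n ⧸ relIdeal wt₁ wt₂)) := by
      conv_rhs => rw [← mul_one u]
      rfl
    rw [this]
    exact Submodule.Quotient.mk_eq_zero _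
  rw [h1, integrableKernel, Submodule.mem_sInf]
  constructor
  · intro h J hJ
    have hcomap : (J.map (relIdeal wt₁ wt₂).mkQ).comap (relIdeal wt₁ wt₂).mkQ = J := by
      rw [Submodule.comap_map_mkQ]
      exact sup_eq_right.2 hJ.rel_le
    have hmem : ∀ v : UCurrent n, (Submodule.Quotient.mk v : UCurrent n ⧸ relIdeal wt₁ wt₂) ∈
        J.map (relIdeal wt₁ wt₂).mkQ ↔ v ∈ J := by
      intro v
      conv_rhs => rw [← hcomap]
      rfl
    rw [← hmem]
    refine h _ ?_
    intro α v
    obtain ⟨v, rfl⟩ := Submodule.Quotient.mk_surjective _ v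
    obtain ⟨v, rfl⟩ := Submodule.Quotient.mk_surjective _ v
    obtain ⟨⟨k, hk⟩, ⟨l, hl⟩⟩ := hJ.nilpotent α v
    exact ⟨⟨k, (Submodule.Quotient.mk_eq_zero _).2 ((hmem _).2 hk)⟩,
      ⟨l, (Submodule.Quotient.mk_eq_zero _).2 ((hmem _).2 hl)⟩⟩
  · intro h N hN
    refine h (N.comap (relIdeal wt₁ wt₂).mkQ) ⟨?_, ?_⟩
    · intro v hv
      have : (relIdeal wt₁ wt₂).mkQ v = 0 := (Submodule.Quotient.mk_eq_zero _).2 hv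
      rw [Submodule.mem_comap, this]
      exact N.zero_mem
    · intro α v
      obtain ⟨⟨k, hk⟩, ⟨l, hl⟩⟩ := hN α (Submodule.Quotient.mk (Submodule.Quotient.mk v))
      exact ⟨⟨k, (Submodule.Quotient.mk_eq_zero N).1 hk⟩,
        ⟨l, (Submodule.Quotient.mk_eq_zero N).1 hl⟩⟩

theorem smul_one_eq_zero {u : UCurrent n} (hu : u ∈ relIdeal wt₁ wt₂) : u • one wt₁ wt₂ = 0 :=
  smul_one_eq_zero_iff.2 fun _ hJ => hJ.rel_le hu

theorem exists_smul_one (v : FModule wt₁ wt₂) : ∃ u : UCurrent n, u • one wt₁ wt₂ = v := by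
  obtain ⟨v, rfl⟩ := Submodule.Quotient.mk_surjective _ v
  obtain ⟨v, rfl⟩ := Submodule.Quotient.mk_surjective _ v
  refine ⟨v, ?_⟩
  conv_rhs => rw [← mul_one v]
  rfl

theorem eVec_smul_one (α : PosRoot n) (p : Polynomial ℂ) : cur (eVec α) p • one wt₁ wt₂ = 0 :=
  smul_one_eq_zero (Submodule.subset_span (Or.inl (Or.inl (Or.inl ⟨α, p, rfl⟩))))

theorem cartan_smul_one (h : cartan n) (p : Polynomial ℂ) : cur (h : Sl n) p • one wt₁ wt₂ =
    (p.eval 0 * (wt₁ + wt₂ : DomWeight n).toDual h) • one wt₁ wt₂ := by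
  have := smul_one_eq_zero (wt₁ := wt₁) (wt₂ := wt₂)
    (Submodule.subset_span (Or.inl (Or.inl (Or.inr ⟨h, p, rfl⟩))))
  rwa [sub_smul, algebraMap_smul, sub_eq_zero] at this

theorem fVec_smul_one (α : PosRoot n) (p : Polynomial ℂ) :
    cur (fVec α) (Polynomial.X ^ 2 * p) • one wt₁ wt₂ = 0 :=
  smul_one_eq_zero (Submodule.subset_span (Or.inl (Or.inr ⟨α, p, rfl⟩)))

theorem fVec_pow_smul_one (α : PosRoot n) :
    cur (fVec α) Polynomial.X ^ (min (wt₁.pairing α) (wt₂.pairing α) + 1) • one wt₁ wt₂ = 0 :=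
  smul_one_eq_zero (Submodule.subset_span (Or.inr ⟨α, rfl⟩))

theorem toEnd_pow_apply (y : Sl n) (k : ℕ) (v : FModule wt₁ wt₂) :
    (LieModule.toEnd ℂ (Sl n) (FModule wt₁ wt₂) y ^ k) v = cur y 1 ^ k • v := by
  induction k with
  | zero => simp
  | succ k ih =>
    rw [pow_succ', Module.End.mul_apply, ih, pow_succ', mul_smul]
    rfl

end FModule

/-! ### Local nilpotency through `𝔰𝔩₂`-relations -/

section Integrability

variable {W : Type*} [AddCommGroup W] [Module (UCurrent n) W] [Module ℂ W]
  [IsScalarTower ℂ (UCurrent n) W]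

/-- The `𝔰𝔩₂`-relation which bounds the nilpotency of `f_α` on a highest weight vector. -/
theorem fVec_pow_smul_eq_zero {α : PosRoot n} {w : W} {N : ℕ} (he : cur (eVec α) 1 • w = 0)
    (hh : cur (coroot α : Sl n) 1 • w = (N : ℂ) • w) (hf : ∃ k : ℕ, cur (fVec α) 1 ^ k • w = 0) :
    cur (fVec α) 1 ^ (N + 1) • w = 0 := by
  rcases eq_or_ne w 0 with rfl | h0
  · rw [smul_zero]
  have hhf : ∀ k : ℕ, cur (coroot α : Sl n) 1 • cur (fVec α) 1 ^ k • w =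
      ((N : ℂ) - 2 * k) • cur (fVec α) 1 ^ k • w := by
    intro k
    induction k with
    | zero => simpa using hh
    | succ k ih =>
      rw [pow_succ', mul_smul, ← mul_smul, cur_mul_comm, cartan_lie_fVec, toDual_coroot_self,
        cur_smul_left, add_smul, mul_smul, ih, mul_one, smul_assoc, smul_comm _ (_ : ℂ), ← add_smul]
      push_cast
      ring_nf
  have hef : ∀ k : ℕ, cur (eVec α) 1 • cur (fVec α) 1 ^ (k + 1) • w =
      (((k : ℂ) + 1) * (N - k)) • cur (fVec α) 1 ^ k • w := by
    intro k
    induction k with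
    | zero =>
      rw [zero_add, pow_one, ← mul_smul, cur_mul_comm, eVec_lie_fVec, add_smul, mul_smul, he, mul_one,
        hh]
      simp
    | succ k ih =>
      rw [pow_succ', mul_smul, ← mul_smul, cur_mul_comm, eVec_lie_fVec, add_smul, mul_smul, ih,
        mul_one, hhf, smul_comm _ (_ : ℂ), ← mul_smul (cur (fVec α) 1), ← pow_succ', ← add_smul]
      push_cast
      ring_nf
  obtain ⟨k, hk₁, hk₂⟩ := Nat.exists_not_and_succ_of_not_zero_of_exists
    (p := fun k => cur (fVec α) 1 ^ k • w = 0) (by simpa using h0) hf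
  have h1 := hef k
  rw [hk₂, smul_zero, eq_comm, smul_eq_zero_iff_left hk₁, mul_eq_zero, sub_eq_zero] at h1
  have h2 : N = k := by exact_mod_cast h1.resolve_left (Nat.cast_add_one_ne_zero k)
  rw [h2]
  exact hk₂

/-- As a matrix `f_α` has square zero, and every term of the triple commutator contains `f_α` twice
in a row. -/
theorem fVec_lie_lie_lie (α : PosRoot n) (y : Sl n) :
    ⁅fVec α, ⁅fVec α, ⁅fVec α, y⁆⁆⁆ = 0 := by
  have h0 : (fVec α).1 * (fVec α).1 = 0 := by
    simp [fVec, α.src_lt_tgt.ne]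
  apply Subtype.ext
  simp only [LieAlgebra.SpecialLinear.sl_bracket]
  set f := (fVec α).1
  have : f * (f * (f * y.1 - y.1 * f) - (f * y.1 - y.1 * f) * f) -
      (f * (f * y.1 - y.1 * f) - (f * y.1 - y.1 * f) * f) * f =
      f * f * f * y.1 - 3 • (f * f * y.1 * f) + 3 • (f * y.1 * (f * f)) - y.1 * (f * f) * f := by
    noncomm_ring
  rw [this]
  simp [h0]

omit [Module ℂ W] [IsScalarTower ℂ (UCurrent n) W] in
-- Moving one `f_α` past `y ⊗ p` either uses up one power on `v` or replaces `y` by `[f_α, y]`;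
-- induction on the sum of the two nilpotency bounds.
theorem fVec_pow_smul_cur_smul {α : PosRoot n} (p : Polynomial ℂ) {j k : ℕ} {y : Sl n} {v : W}
    (hy : (LieModule.toEnd ℂ (Sl n) (Sl n) (fVec α) ^ j) y = 0)
    (hv : cur (fVec α) 1 ^ k • v = 0) : cur (fVec α) 1 ^ (j + k) • cur y p • v = 0 := by
  induction hs : j + k using Nat.strong_induction_on generalizing j k y v with
  | _ s ih =>
    rcases j with _ | j
    · have : y = 0 := by simpa using hy
      rw [this, cur_zero_left, zero_smul, smul_zero]
    rcases k with _ | k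
    · have : v = 0 := by simpa using hv
      rw [this, smul_zero, smul_zero]
    obtain ⟨s, rfl⟩ : ∃ s', s = s' + 1 := ⟨j + 1 + k, by omega⟩
    rw [pow_succ, mul_smul, ← mul_smul (cur (fVec α) 1), cur_mul_comm, one_mul, add_smul, smul_add,
      mul_smul]
    rw [ih s (by omega) (j := j + 1) (k := k) hy (by rwa [← mul_smul, ← pow_succ]) (by omega),
      ih s (by omega) (j := j) (k := k + 1) (by rwa [pow_succ, Module.End.mul_apply] at hy) hv
        (by omega), add_zero]

end Integrability

namespace FModule

variable {wt₁ wt₂ : DomWeight n}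

/-- Integrability of each quotient does not by itself pass to the intersection of the kernels. The
exponent here depends only on `λ(h_α)`, not on the ideal, so this relation does pass. -/
theorem fVec_pow_one_smul_one (α : PosRoot n) :
    cur (fVec α) 1 ^ ((wt₁ + wt₂ : DomWeight n).pairing α + 1) • one wt₁ wt₂ = 0 := by
  refine smul_one_eq_zero_iff.2 fun J hJ => ?_
  have h1 : ∀ u : UCurrent n, u • (Submodule.Quotient.mk 1 : UCurrent n ⧸ J) = 0 ↔ u ∈ J := by
    intro u
    rw [← Submodule.Quotient.mk_smul, smul_eq_mul, mul_one, Submodule.Quotient.mk_eq_zero]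
  refine (h1 _).1 (fVec_pow_smul_eq_zero ?_ ?_ ?_)
  · exact (h1 _).2 (hJ.rel_le (Submodule.subset_span (Or.inl (Or.inl (Or.inl ⟨α, 1, rfl⟩)))))
  · have := (h1 _).2 (hJ.rel_le (Submodule.subset_span
      (Or.inl (Or.inl (Or.inr ⟨coroot α, 1, rfl⟩)))))
    rw [sub_smul, algebraMap_smul, sub_eq_zero] at this
    rw [this, Polynomial.eval_one, one_mul, DomWeight.toDual_coroot]
  · obtain ⟨k, hk⟩ := (hJ.nilpotent α 1).2
    exact ⟨k, (h1 _).2 (by simpa using hk)⟩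

/-- The vectors killed by a power of `f_α` form a subspace stable under every `x ⊗ p`, because `ad
f_α` has cube zero. It contains the generator, hence everything. -/
theorem locNilpotent (wt₁ wt₂ : DomWeight n) : LocNilpotent n (FModule wt₁ wt₂) := by
  intro α v
  simp only [toEnd_pow_apply]
  let K : Submodule ℂ (FModule wt₁ wt₂) :=
    { carrier := {v | ∃ k : ℕ, cur (fVec α) 1 ^ k • v = 0}
      zero_mem' := ⟨0, smul_zero _⟩
      add_mem' := by
        rintro x y ⟨k, hk⟩ ⟨l, hl⟩
        refine ⟨k + l, ?_⟩
        have hx : cur (fVec α) 1 ^ (k + l) • x = 0 := by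
          rw [add_comm, pow_add, mul_smul, hk, smul_zero]
        have hy : cur (fVec α) 1 ^ (k + l) • y = 0 := by
          rw [pow_add, mul_smul, hl, smul_zero]
        rw [smul_add, hx, hy, add_zero]
      smul_mem' := by
        rintro c x ⟨k, hk⟩
        exact ⟨k, by rw [smul_comm, hk, smul_zero]⟩ }
  obtain ⟨u, rfl⟩ := exists_smul_one v
  refine smul_mem_of_cur_smul_mem K ?_ u (v := one wt₁ wt₂) ⟨_, fVec_pow_one_smul_one α⟩
  rintro x p v ⟨k, hk⟩
  exact ⟨3 + k, fVec_pow_smul_cur_smul p (fVec_lie_lie_lie α x) hk⟩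

/-! ## The grading -/

/-- The substitution `t ↦ 2t` preserves each family of relations and fixes `sl_n ⊗ 1`, so the
preimage of an ideal with integrable quotient is again of this kind. -/
theorem scale_smul_one_eq_zero {u : UCurrent n} (hu : u • one wt₁ wt₂ = 0) :
    scale n u • one wt₁ wt₂ = 0 := by
  rw [smul_one_eq_zero_iff] at hu ⊢
  intro J hJ
  let J' : Submodule (UCurrent n) (UCurrent n) :=
    { carrier := {v | scale n v ∈ J}
      zero_mem' := by simp
      add_mem' := fun ha hb => by
        simp only [Set.mem_ofPred_eq, map_add] at ha hb ⊢
        exact J.add_mem ha hb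
      smul_mem' := fun c x hx => by
        simp only [Set.mem_ofPred_eq, smul_eq_mul, map_mul] at hx ⊢
        exact J.smul_mem _ hx }
  refine hu J' ⟨Submodule.span_le.2 ?_, fun α v => ?_⟩
  · rintro v (((⟨α, p, rfl⟩ | ⟨h, p, rfl⟩) | ⟨α, p, rfl⟩) | ⟨α, rfl⟩)
    · change scale n _ ∈ J
      rw [scale_cur]
      exact hJ.rel_le (Submodule.subset_span (Or.inl (Or.inl (Or.inl ⟨α, _, rfl⟩))))
    · change scale n _ ∈ J
      rw [map_sub, scale_cur, AlgHom.commutes]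
      refine hJ.rel_le (Submodule.subset_span (Or.inl (Or.inl (Or.inr
        ⟨h, Polynomial.aeval (2 * Polynomial.X) p, ?_⟩))))
      have h0 : (Polynomial.aeval (2 * Polynomial.X) p : Polynomial ℂ).eval 0 = p.eval 0 := by
        change (p.comp _).eval 0 = _
        rw [Polynomial.eval_comp]
        simp
      rw [h0]
    · change scale n _ ∈ J
      rw [scale_cur]
      -- The factor 4 comes from `(2t)² p(2t) = t² · 4p(2t)`.
      refine hJ.rel_le (Submodule.subset_span (Or.inl (Or.inr
        ⟨α, 4 * Polynomial.aeval (2 * Polynomial.X) p, ?_⟩)))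
      congr 1
      simp only [map_mul, map_pow, Polynomial.aeval_X]
      ring
    · change scale n _ ∈ J
      have := scale_cur_X_pow (fVec α) 1
      rw [pow_one, pow_one] at this
      rw [map_pow, this, smul_pow]
      exact Submodule.smul_of_tower_mem _ _
        (hJ.rel_le (Submodule.subset_span (Or.inr ⟨α, rfl⟩)))
  · change (∃ k : ℕ, scale n _ ∈ J) ∧ ∃ k : ℕ, scale n _ ∈ J
    simp only [map_mul, map_pow, scale_cur_one]
    exact hJ.nilpotent α _

variable (wt₁ wt₂) in
/-- The action of `U(sl_n ⊗ ℂ[t])` on the generator. -/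
def orbitMap : UCurrent n →ₗ[ℂ] FModule wt₁ wt₂ :=
  (LinearMap.toSpanSingleton (UCurrent n) (FModule wt₁ wt₂) (one wt₁ wt₂)).restrictScalars ℂ

theorem orbitMap_surjective : Function.Surjective (orbitMap wt₁ wt₂) := exists_smul_one

variable (wt₁ wt₂) in
/-- The endomorphism of `F` induced by `t ↦ 2 t`. -/
def scaleEnd : Module.End ℂ (FModule wt₁ wt₂) :=
  (LinearMap.ker (orbitMap wt₁ wt₂)).liftQ (orbitMap wt₁ wt₂ ∘ₗ (scale n).toLinearMap)
    (fun _ hu => scale_smul_one_eq_zero hu) ∘ₗ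
    ((orbitMap wt₁ wt₂).quotKerEquivOfSurjective orbitMap_surjective).symm.toLinearMap

theorem scaleEnd_smul_one (u : UCurrent n) :
    scaleEnd wt₁ wt₂ (u • one wt₁ wt₂) = scale n u • one wt₁ wt₂ := by
  have : ((orbitMap wt₁ wt₂).quotKerEquivOfSurjective orbitMap_surjective).symm
      (u • one wt₁ wt₂) = Submodule.Quotient.mk u := by
    rw [LinearEquiv.symm_apply_eq]
    rfl
  rw [scaleEnd, LinearMap.comp_apply, LinearEquiv.coe_coe, this]
  rfl

theorem graded_le_eigenspace (s : ℕ) : (graded wt₁ wt₂ s : Submodule ℂ (FModule wt₁ wt₂)) ≤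
    (scaleEnd wt₁ wt₂).eigenspace (2 ^ s) := by
  rintro _ ⟨u, hu, rfl⟩
  rw [Module.End.mem_eigenspace_iff]
  change scaleEnd wt₁ wt₂ (u • one wt₁ wt₂) = (2 : ℂ) ^ s • u • one wt₁ wt₂
  rw [scaleEnd_smul_one, ← smul_assoc]
  congr 1
  refine LinearMap.eqOn_span (f := (scale n).toLinearMap)
    (g := (2 : ℂ) ^ s • (LinearMap.id : UCurrent n →ₗ[ℂ] UCurrent n)) ?_ hu
  rintro _ ⟨l, hl, rfl⟩
  clear hu
  subst hl
  simp only [AlgHom.toLinearMap_apply, LinearMap.smul_apply, LinearMap.id_apply]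
  induction l with
  | nil => simp
  | cons a l ih =>
    rw [List.map_cons, List.prod_cons, map_mul, ih, scale_cur_X_pow, List.map_cons, List.sum_cons,
      smul_mul_smul_comm, pow_add]

/-- The component of degree `s` lies in the eigenspace of `t ↦ 2t` for `2^s`, and these eigenvalues
are distinct. -/
theorem iSupIndep_graded (wt₁ wt₂ : DomWeight n) :
    iSupIndep fun s => (graded wt₁ wt₂ s : Submodule ℂ (FModule wt₁ wt₂)) :=
  (((scaleEnd wt₁ wt₂).eigenspaces_iSupIndep).comp (f := fun s : ℕ => (2 : ℂ) ^ s) (fun s s' h => by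
    have h2 : (2 : ℕ) ^ s = 2 ^ s' := by
      have h' : (2 : ℂ) ^ s = 2 ^ s' := h
      exact_mod_cast h'
    exact Nat.pow_right_injective le_rfl h2)).mono graded_le_eigenspace

end FModule

end SlCurrent

end

noncomputable section

namespace SlCurrent

variable {n : ℕ}

theorem single_le {m : PosRoot n → ℕ} {α : PosRoot n} (h : m α ≠ 0) : Pi.single α 1 ≤ m := by
  intro γ
  rcases eq_or_ne γ α with rfl | h'
  · rw [Pi.single_eq_same]; exact Nat.one_le_iff_ne_zero.2 h
  · simp [h']

theorem sub_single_add {m : PosRoot n → ℕ} {α : PosRoot n} (h : m α ≠ 0) :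
    m - Pi.single α 1 + Pi.single α 1 = m :=
  tsub_add_cancel_of_le (single_le h)

namespace FModule

variable {wt₁ wt₂ : DomWeight n}

/-! ## Monomials -/

variable (wt₁ wt₂) in
/-- The vectors killed by `sl_n ⊗ t² ℂ[t]` and `𝔟 ⊗ t`. -/
def killed : Submodule ℂ (FModule wt₁ wt₂) where
  carrier := {v | (∀ (x : Sl n) (p : Polynomial ℂ), cur x (Polynomial.X ^ 2 * p) • v = 0) ∧
    (∀ α : PosRoot n, cur (eVec α) Polynomial.X • v = 0) ∧
    ∀ h : cartan n, cur (h : Sl n) Polynomial.X • v = 0}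
  zero_mem' := by simp
  add_mem' := by
    rintro v w ⟨h1, h2, h3⟩ ⟨h1', h2', h3'⟩
    exact ⟨fun x p => by rw [smul_add, h1, h1', add_zero],
      fun α => by rw [smul_add, h2, h2', add_zero], fun h => by rw [smul_add, h3, h3', add_zero]⟩
  smul_mem' := by
    rintro c v ⟨h1, h2, h3⟩
    exact ⟨fun x p => by rw [smul_comm, h1, smul_zero],
      fun α => by rw [smul_comm, h2, smul_zero], fun h => by rw [smul_comm, h3, smul_zero]⟩

theorem one_mem_killed : one wt₁ wt₂ ∈ killed wt₁ wt₂ := by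
  refine ⟨fun x p => ?_, fun α => eVec_smul_one α _, fun h => ?_⟩
  · induction x using sl_induction with
    | he α => exact eVec_smul_one α _
    | hf α => exact fVec_smul_one α p
    | hh h => rw [cartan_smul_one]; simp
    | add x y hx hy => rw [cur_add_left, add_smul, hx, hy, add_zero]
    | smul c x hx => rw [cur_smul_left, smul_assoc, hx, smul_zero]
  · rw [cartan_smul_one]; simp

/-- The commutator of two elements of degree one has degree two and acts by zero here. This is why
the order of factors in a monomial is irrelevant and why `killed` is stable under all `f_α ⊗ t`. -/
theorem cur_X_smul_comm {v : FModule wt₁ wt₂} (hv : v ∈ killed wt₁ wt₂) (x y : Sl n) :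
    cur x Polynomial.X • cur y Polynomial.X • v = cur y Polynomial.X • cur x Polynomial.X • v := by
  rw [← mul_smul, cur_mul_comm, add_smul, mul_smul, ← sq, ← mul_one (Polynomial.X ^ 2), hv.1,
    add_zero]

theorem fVec_smul_mem_killed {v : FModule wt₁ wt₂} (hv : v ∈ killed wt₁ wt₂) (α : PosRoot n) :
    cur (fVec α) Polynomial.X • v ∈ killed wt₁ wt₂ := by
  refine ⟨fun x p => ?_, fun β => ?_, fun h => ?_⟩
  · rw [← mul_smul, cur_mul_comm, add_smul, mul_smul, hv.1, smul_zero, zero_add, mul_assoc, hv.1]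
  · rw [cur_X_smul_comm hv, hv.2.1, smul_zero]
  · rw [cur_X_smul_comm hv, hv.2.2, smul_zero]

theorem fVec_pow_smul_mem_killed {v : FModule wt₁ wt₂} (hv : v ∈ killed wt₁ wt₂) (α : PosRoot n)
    (k : ℕ) : cur (fVec α) Polynomial.X ^ k • v ∈ killed wt₁ wt₂ := by
  induction k with
  | zero => simpa using hv
  | succ k ih => rw [pow_succ', mul_smul]; exact fVec_smul_mem_killed ih α

theorem prod_smul_mem_killed {v : FModule wt₁ wt₂} (hv : v ∈ killed wt₁ wt₂)
    (L : List (PosRoot n)) (m : PosRoot n → ℕ) :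
    (L.map fun α => cur (fVec α) Polynomial.X ^ m α).prod • v ∈ killed wt₁ wt₂ := by
  induction L with
  | nil => simpa using hv
  | cons β L ih =>
    rw [List.map_cons, List.prod_cons, mul_smul]
    exact fVec_pow_smul_mem_killed ih β _

theorem fVec_pow_smul_comm {v : FModule wt₁ wt₂} (hv : v ∈ killed wt₁ wt₂) (α β : PosRoot n)
    (k : ℕ) : cur (fVec α) Polynomial.X • cur (fVec β) Polynomial.X ^ k • v =
      cur (fVec β) Polynomial.X ^ k • cur (fVec α) Polynomial.X • v := by
  induction k with
  | zero => simp
  | succ k ih =>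
    rw [pow_succ', mul_smul, cur_X_smul_comm (fVec_pow_smul_mem_killed hv β k), ih, mul_smul]

theorem fVec_smul_prod {v : FModule wt₁ wt₂} (hv : v ∈ killed wt₁ wt₂) (β : PosRoot n)
    (m : PosRoot n → ℕ) (L : List (PosRoot n)) (hL : L.Nodup) (hβ : β ∈ L) :
    cur (fVec β) Polynomial.X • (L.map fun α => cur (fVec α) Polynomial.X ^ m α).prod • v =
      (L.map fun α => cur (fVec α) Polynomial.X ^ (m + Pi.single β 1 : PosRoot n → ℕ) α).prod • v := by
  induction L with
  | nil => simp at hβ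
  | cons γ L ih =>
    rw [List.nodup_cons] at hL
    simp only [List.map_cons, List.prod_cons, mul_smul]
    rcases eq_or_ne γ β with rfl | hne
    · have hmap : (L.map fun α => cur (fVec α) Polynomial.X ^ (m + Pi.single γ 1 : PosRoot n → ℕ) α) =
          L.map fun α => cur (fVec α) Polynomial.X ^ m α := by
        refine List.map_congr_left fun α hα => ?_
        have : α ≠ γ := fun h => hL.1 (h ▸ hα)
        simp [this]
      rw [hmap, Pi.add_apply, Pi.single_eq_same, ← mul_smul, ← pow_succ']
    · have hβL : β ∈ L := (List.mem_cons.1 hβ).resolve_left hne.symm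
      rw [fVec_pow_smul_comm (prod_smul_mem_killed hv L m), ih hL.2 hβL]
      simp [hne]

theorem monomialVec_mem_killed (m : PosRoot n → ℕ) : monomialVec wt₁ wt₂ m ∈ killed wt₁ wt₂ :=
  prod_smul_mem_killed one_mem_killed _ m

theorem monomialVec_zero : monomialVec wt₁ wt₂ 0 = one wt₁ wt₂ := by
  simp [monomialVec]

theorem fVec_smul_monomialVec (β : PosRoot n) (m : PosRoot n → ℕ) :
    cur (fVec β) Polynomial.X • monomialVec wt₁ wt₂ m =
      monomialVec wt₁ wt₂ (m + Pi.single β 1) :=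
  fVec_smul_prod one_mem_killed β m _ (Finset.sort_nodup _ _) (by simp)

end FModule

theorem exponent_induction {p : (PosRoot n → ℕ) → Prop} (zero : p 0)
    (step : ∀ m β, p m → p (m + Pi.single β 1)) (m : PosRoot n → ℕ) : p m := by
  induction hd : deg m generalizing m with
  | zero =>
    have : m = 0 := by
      funext α
      exact Finset.sum_eq_zero_iff.1 hd α (Finset.mem_univ α)
    rwa [this]
  | succ d ih =>
    obtain ⟨β, hβ⟩ : ∃ β, m β ≠ 0 := by
      by_contra! h
      have : m = 0 := funext h
      rw [this, deg_zero] at hd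
      omega
    have hm := sub_single_add hβ
    rw [← hm]
    refine step _ _ (ih _ ?_)
    rw [← hm, deg_add, deg_single] at hd
    omega

namespace FModule

variable {wt₁ wt₂ : DomWeight n}

/-- The action of `sl_n ⊗ 1` on monomials. -/
theorem lie_monomialVec (x : Sl n) (m : PosRoot n → ℕ) {c : ℂ}
    (hx : cur x 1 • one wt₁ wt₂ = c • one wt₁ wt₂) : ⁅x, monomialVec wt₁ wt₂ m⁆ =
    c • monomialVec wt₁ wt₂ m + ∑ α, m α • cur ⁅x, fVec α⁆ Polynomial.X •
      monomialVec wt₁ wt₂ (m - Pi.single α 1) := by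
  induction m using exponent_induction with
  | zero => simp [monomialVec_zero, lie_def, hx]
  | step m β ih =>
    rw [lie_def] at ih ⊢
    rw [← fVec_smul_monomialVec, ← mul_smul, cur_mul_comm, add_smul, mul_smul, ih, one_mul, smul_add,
      smul_comm _ c, Finset.smul_sum, add_assoc]
    congr 1
    simp only [Pi.add_apply, add_smul, Finset.sum_add_distrib]
    congr 1
    · refine Finset.sum_congr rfl fun α _ => ?_
      rcases Nat.eq_zero_or_pos (m α) with h0 | h0
      · rw [h0, zero_smul, zero_smul, smul_zero]
      · have hle := single_le h0.ne'
        rw [smul_comm _ (m α), ← cur_X_smul_comm (monomialVec_mem_killed _), fVec_smul_monomialVec,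
          tsub_add_eq_add_tsub hle]
    · rw [Finset.sum_eq_single β]
      · simp
      · intro α _ h
        simp [h]
      · simp

/-- The weight of the generator. -/
abbrev genWeight (wt₁ wt₂ : DomWeight n) : Module.Dual ℂ (cartan n) :=
  (wt₁ + wt₂ : DomWeight n).toDual

theorem monomialVec_mem_wtSpace (m : PosRoot n → ℕ) :
    monomialVec wt₁ wt₂ m ∈ wtSpace (FModule wt₁ wt₂) (genWeight wt₁ wt₂ - weight m) := by
  intro h
  rw [lie_monomialVec (h : Sl n) m (c := genWeight wt₁ wt₂ h) (by
    rw [cartan_smul_one, Polynomial.eval_one, one_mul]), LinearMap.sub_apply, sub_smul,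
    sub_eq_add_neg]
  congr 1
  have h1 : ∀ α, m α • cur ⁅(h : Sl n), fVec α⁆ Polynomial.X •
      monomialVec wt₁ wt₂ (m - Pi.single α 1) =
        (-(m α * α.toDual h : ℂ)) • monomialVec wt₁ wt₂ m := by
    intro α
    rcases Nat.eq_zero_or_pos (m α) with h0 | h0
    · simp [h0]
    · rw [cartan_lie_fVec, cur_smul_left, smul_assoc, fVec_smul_monomialVec,
        sub_single_add h0.ne', ← Nat.cast_smul_eq_nsmul ℂ, smul_smul, mul_neg]
  rw [Finset.sum_congr rfl fun α _ => h1 α, ← Finset.sum_smul, ← neg_smul, Finset.sum_neg_distrib]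
  simp [weight]

theorem cur_matUnit_smul_of_le {v : FModule wt₁ wt₂} (hv : v ∈ killed wt₁ wt₂) {k i : Fin n}
    (h : k ≤ i) : cur (matUnit k i) Polynomial.X • v = 0 := by
  rcases h.lt_or_eq with h | rfl
  · have := hv.2.1 ⟨toLex (k, i), h⟩
    rwa [eVec_eq] at this
  · exact hv.2.2 (diagUnit k)

/-- The root `ε_i - ε_j`. -/
def mkRoot {i j : Fin n} (h : i < j) : PosRoot n := ⟨toLex (i, j), h⟩

theorem fVec_mkRoot {i j : Fin n} (h : i < j) : fVec (mkRoot h) = matUnit j i := fVec_eq _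

/-- The bracket is zero, lies in `𝔟`, where the factor `t` makes it act by zero, or is up to sign an
`f_γ` with `γ` shorter than `α`. -/
theorem cur_eVec_lie_fVec_smul {v : FModule wt₁ wt₂} (hv : v ∈ killed wt₁ wt₂) (β α : PosRoot n) :
    cur ⁅eVec β, fVec α⁆ Polynomial.X • v = 0 ∨ ∃ (γ : PosRoot n) (c : ℂ),
      γ.height < α.height ∧
        cur ⁅eVec β, fVec α⁆ Polynomial.X • v = c • cur (fVec γ) Polynomial.X • v := by
  have hβ := Fin.lt_def.1 β.src_lt_tgt
  have hα := Fin.lt_def.1 α.src_lt_tgt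
  rw [eVec_eq, fVec_eq, matUnit_lie]
  by_cases h1 : β.tgt = α.tgt <;> by_cases h2 : β.src = α.src
  · left
    have : ((if β.tgt = α.tgt then matUnit β.src α.src else 0) -
        if β.src = α.src then matUnit α.tgt β.tgt else 0) =
        ((diagUnit β.src - diagUnit β.tgt : cartan n) : Sl n) := by
      simp [h1, h2, diagUnit]
    rw [this]
    exact hv.2.2 _
  · simp only [h1, h2, if_true, if_false, sub_zero]
    rcases le_or_gt β.src α.src with h | h
    · exact Or.inl (cur_matUnit_smul_of_le hv h)
    · refine Or.inr ⟨mkRoot h, 1, ?_, by rw [fVec_mkRoot, one_smul]⟩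
      change (β.src : ℕ) - α.src < α.tgt - α.src
      rw [h1] at hβ
      have := Fin.lt_def.1 h
      omega
  · simp only [h1, h2, if_true, if_false, zero_sub]
    have hneg : cur (-matUnit α.tgt β.tgt) Polynomial.X • v =
        (-1 : ℂ) • cur (matUnit α.tgt β.tgt) Polynomial.X • v := by
      rw [← neg_one_smul ℂ (matUnit α.tgt β.tgt), cur_smul_left, smul_assoc]
    rw [hneg]
    rcases le_or_gt α.tgt β.tgt with h | h
    · left; rw [cur_matUnit_smul_of_le hv h, smul_zero]
    · refine Or.inr ⟨mkRoot h, -1, ?_, by rw [fVec_mkRoot]⟩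
      change (α.tgt : ℕ) - β.tgt < α.tgt - α.src
      rw [h2] at hβ
      have := Fin.lt_def.1 h
      omega
  · left
    simp [h1, h2, cur_zero_left]

/-- `e_β` acts as a derivation which replaces one factor `f_α ⊗ t` by a shorter one. Monomial
vectors are thereby singular modulo smaller height. -/
theorem eVec_lie_monomialVec_mem (β : PosRoot n) (m : PosRoot n → ℕ) :
    ⁅eVec β, monomialVec wt₁ wt₂ m⁆ ∈
      Submodule.span ℂ {v | ∃ m', deg m' = deg m ∧ ht m' < ht m ∧ v = monomialVec wt₁ wt₂ m'} := by
  rw [lie_monomialVec (eVec β) m (c := 0) (by rw [zero_smul]; exact eVec_smul_one β 1), zero_smul,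
    zero_add]
  refine Submodule.sum_mem _ fun α _ => ?_
  rcases Nat.eq_zero_or_pos (m α) with h0 | h0
  · rw [h0, zero_smul]; exact Submodule.zero_mem _
  refine Submodule.smul_of_tower_mem _ _ ?_
  rcases cur_eVec_lie_fVec_smul (monomialVec_mem_killed (wt₁ := wt₁) (wt₂ := wt₂)
    (m - Pi.single α 1)) β α with h | ⟨γ, c, hγ, h⟩
  · rw [h]; exact Submodule.zero_mem _
  · rw [h, fVec_smul_monomialVec]
    have hm := sub_single_add h0.ne'
    refine Submodule.smul_mem _ _ (Submodule.subset_span ⟨_, ?_, ?_, rfl⟩)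
    · conv_rhs => rw [← hm]
      rw [deg_add, deg_add, deg_single, deg_single]
    · conv_rhs => rw [← hm]
      rw [ht_add, ht_add, ht_single, ht_single]
      omega

/-! ## Generation by monomials -/

variable (wt₁ wt₂) in
/-- The `sl_n`-submodule generated by the monomials of degree `s`. -/
def monomialSpan (s : ℕ) : LieSubmodule ℂ (Sl n) (FModule wt₁ wt₂) :=
  LieSubmodule.lieSpan ℂ (Sl n) {v | ∃ m, deg m = s ∧ v = monomialVec wt₁ wt₂ m}

theorem monomialVec_mem_monomialSpan (m : PosRoot n → ℕ) :
    monomialVec wt₁ wt₂ m ∈ monomialSpan wt₁ wt₂ (deg m) :=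
  LieSubmodule.subset_lieSpan ⟨m, rfl, rfl⟩

/-- The linear span of the monomials of degree `s` is already `𝔟`-stable, so only the lowering
operators remain to be applied. -/
theorem monomialSpan_le_wtSum (s : ℕ) :
    (monomialSpan wt₁ wt₂ s : Submodule ℂ (FModule wt₁ wt₂)) ≤
      wtSum (FModule wt₁ wt₂) (below (genWeight wt₁ wt₂)) := by
  set S := {v | ∃ m, deg m = s ∧ v = monomialVec wt₁ wt₂ m}
  have hspan : ∀ (φ : Module.End ℂ (FModule wt₁ wt₂)), (∀ m, deg m = s →
      φ (monomialVec wt₁ wt₂ m) ∈ Submodule.span ℂ S) →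
      ∀ x ∈ Submodule.span ℂ S, φ x ∈ Submodule.span ℂ S := by
    intro φ hφ
    have : Submodule.span ℂ S ≤ (Submodule.span ℂ S).comap φ := by
      refine Submodule.span_le.2 ?_
      rintro _ ⟨m, hm, rfl⟩
      exact hφ m hm
    exact this
  have h2 := lieSpan_le_of_stable (T := Submodule.span ℂ S)
    (W := wtSum (FModule wt₁ wt₂) (below (genWeight wt₁ wt₂)))
    (fun α => hspan (LieModule.toEnd ℂ (Sl n) _ (eVec α)) fun m hm =>
      Submodule.span_mono (by
        rintro v ⟨m', h1, -, rfl⟩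
        exact ⟨m', h1.trans hm, rfl⟩) (eVec_lie_monomialVec_mem α m))
    (fun h => hspan (LieModule.toEnd ℂ (Sl n) _ (h : Sl n)) fun m hm => by
      rw [LieModule.toEnd_apply_apply, monomialVec_mem_wtSpace m h]
      exact Submodule.smul_mem _ _ (Submodule.subset_span ⟨m, hm, rfl⟩))
    (Submodule.span_le.2 (by
      rintro _ ⟨m, -, rfl⟩
      have hm : genWeight wt₁ wt₂ - weight m ∈ below (genWeight wt₁ wt₂) :=
        ⟨m, by rw [sub_add_cancel]⟩
      exact wtSpace_le_wtSum hm (monomialVec_mem_wtSpace m)))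
    (fun α x hx => wtSum_mono (strictlyBelow_subset_below _) (lie_fVec_mem_wtSum_below hx α))
  refine le_trans ?_ h2
  exact LieSubmodule.lieSpan_mono Submodule.subset_span

theorem cur_X_pow_smul_monomialVec_mem (x : Sl n) (r : ℕ) (m : PosRoot n → ℕ) :
    cur x (Polynomial.X ^ r) • monomialVec wt₁ wt₂ m ∈ monomialSpan wt₁ wt₂ (r + deg m) := by
  rcases r with _ | _ | r
  · rw [pow_zero, zero_add]
    exact (monomialSpan wt₁ wt₂ (deg m)).lie_mem (x := x) (monomialVec_mem_monomialSpan m)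
  · rw [zero_add, pow_one]
    have hk := monomialVec_mem_killed (wt₁ := wt₁) (wt₂ := wt₂) m
    induction x using sl_induction with
    | he α => rw [hk.2.1]; exact zero_mem _
    | hh h => rw [hk.2.2]; exact zero_mem _
    | hf α =>
      have := monomialVec_mem_monomialSpan (wt₁ := wt₁) (wt₂ := wt₂) (m + Pi.single α 1)
      rwa [deg_add, deg_single, add_comm, ← fVec_smul_monomialVec] at this
    | add x y hx hy => rw [cur_add_left, add_smul]; exact add_mem hx hy
    | smul c x hx =>
      rw [cur_smul_left, smul_assoc]
      exact (monomialSpan wt₁ wt₂ (1 + deg m)).smul_mem c hx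
  · rw [add_assoc r, one_add_one_eq_two, pow_add, mul_comm, (monomialVec_mem_killed m).1]
    exact zero_mem _

/-- The vectors which all `x ⊗ t^r` send into the target form an `sl_n`-submodule, since bracketing
with `y ⊗ 1` keeps the degree. It suffices to test monomials. -/
theorem cur_X_pow_smul_mem (x : Sl n) (r s : ℕ) {v : FModule wt₁ wt₂}
    (hv : v ∈ monomialSpan wt₁ wt₂ s) :
    cur x (Polynomial.X ^ r) • v ∈ monomialSpan wt₁ wt₂ (r + s) := by
  let K : LieSubmodule ℂ (Sl n) (FModule wt₁ wt₂) :=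
    { carrier := {v | ∀ x : Sl n, cur x (Polynomial.X ^ r) • v ∈ monomialSpan wt₁ wt₂ (r + s)}
      zero_mem' := fun x => by rw [smul_zero]; exact zero_mem _
      add_mem' := fun ha hb x => by rw [smul_add]; exact add_mem (ha x) (hb x)
      smul_mem' := fun c v hv x => by
        rw [smul_comm]; exact (monomialSpan wt₁ wt₂ (r + s)).smul_mem c (hv x)
      lie_mem := by
        intro y v hv x
        change cur x _ • cur y 1 • v ∈ _
        rw [← mul_smul, cur_mul_comm, add_smul, mul_smul, mul_one]
        exact add_mem ((monomialSpan wt₁ wt₂ (r + s)).lie_mem (hv x)) (hv _) }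
  have hle : monomialSpan wt₁ wt₂ s ≤ K := by
    refine LieSubmodule.lieSpan_le.2 ?_
    rintro _ ⟨m, rfl, rfl⟩ x
    exact cur_X_pow_smul_monomialVec_mem x r m
  exact hle hv x

theorem one_mem_monomialSpan : one wt₁ wt₂ ∈ monomialSpan wt₁ wt₂ 0 := by
  have := monomialVec_mem_monomialSpan (wt₁ := wt₁) (wt₂ := wt₂) 0
  rwa [deg_zero, monomialVec_zero] at this

theorem one_mem_graded : one wt₁ wt₂ ∈ graded wt₁ wt₂ 0 := by
  refine ⟨1, Submodule.subset_span ⟨[], rfl, rfl⟩, ?_⟩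
  exact one_smul (UCurrent n) (one wt₁ wt₂)

theorem cur_X_pow_smul_mem_graded (x : Sl n) (r : ℕ) {s : ℕ} {v : FModule wt₁ wt₂}
    (hv : v ∈ graded wt₁ wt₂ s) : cur x (Polynomial.X ^ r) • v ∈ graded wt₁ wt₂ (r + s) := by
  obtain ⟨u, hu, rfl⟩ := hv
  refine ⟨cur x (Polynomial.X ^ r) * u, ?_, mul_smul (cur x (Polynomial.X ^ r)) u (one wt₁ wt₂)⟩
  change u ∈ uGraded n s at hu
  change _ ∈ uGraded n (r + s)
  have : uGraded n s ≤ (uGraded n (r + s)).comap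
      (LinearMap.mulLeft ℂ (cur x (Polynomial.X ^ r))) := by
    refine Submodule.span_le.2 ?_
    rintro _ ⟨l, hl, rfl⟩
    exact Submodule.subset_span ⟨(x, r) :: l, by simp [hl], by simp⟩
  exact this hu

theorem monomialVec_mem_graded (m : PosRoot n → ℕ) :
    monomialVec wt₁ wt₂ m ∈ graded wt₁ wt₂ (deg m) := by
  induction m using exponent_induction with
  | zero => rw [monomialVec_zero, deg_zero]; exact one_mem_graded
  | step m β ih =>
    rw [← fVec_smul_monomialVec, deg_add, deg_single, add_comm]
    simpa using cur_X_pow_smul_mem_graded (fVec β) 1 ih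

/-- Takes the place of a PBW argument: a product of degree `s` is applied to the generator one
factor at a time, each step raising the index of the monomial submodule by the degree of the factor.
-/
theorem graded_eq_monomialSpan (s : ℕ) : graded wt₁ wt₂ s = monomialSpan wt₁ wt₂ s := by
  apply le_antisymm
  · have key : ∀ l : List (Sl n × ℕ), (l.map fun y => cur y.1 (Polynomial.X ^ y.2)).prod •
        one wt₁ wt₂ ∈ monomialSpan wt₁ wt₂ (l.map Prod.snd).sum := by
      intro l
      induction l with
      | nil => simpa using one_mem_monomialSpan
      | cons a l ih =>
        simp only [List.map_cons, List.prod_cons, List.sum_cons, mul_smul]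
        exact cur_X_pow_smul_mem _ _ _ ih
    rintro _ ⟨u, hu, rfl⟩
    have h1 : uGraded n s ≤ (monomialSpan wt₁ wt₂ s : Submodule ℂ (FModule wt₁ wt₂)).comap
        (orbitMap wt₁ wt₂) := by
      refine Submodule.span_le.2 ?_
      rintro _ ⟨l, hl, rfl⟩
      exact hl ▸ key l
    exact h1 hu
  · refine LieSubmodule.lieSpan_le.2 ?_
    rintro _ ⟨m, rfl, rfl⟩
    exact monomialVec_mem_graded m

theorem iSup_monomialSpan : ⨆ s, monomialSpan wt₁ wt₂ s = ⊤ := by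
  refine eq_top_iff.2 fun v _ => ?_
  obtain ⟨u, rfl⟩ := exists_smul_one v
  set A := ⨆ s, monomialSpan wt₁ wt₂ s with hA
  have h1 : ∀ s, monomialSpan wt₁ wt₂ s ≤ A := le_iSup _
  refine smul_mem_of_cur_smul_mem (A : Submodule ℂ (FModule wt₁ wt₂)) ?_ u
    (h1 0 one_mem_monomialSpan)
  intro x p
  have h2 : (A : Submodule ℂ (FModule wt₁ wt₂)) ≤ (A : Submodule ℂ (FModule wt₁ wt₂)).comap
      (Algebra.lsmul ℂ ℂ (FModule wt₁ wt₂) (cur x p)) := by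
    rw [hA, LieSubmodule.iSup_toSubmodule]
    refine iSup_le fun s v hv => ?_
    rw [← LieSubmodule.iSup_toSubmodule, ← hA]
    change cur x p • v ∈ A
    induction p using Polynomial.induction_on' with
    | add p q hp hq => rw [cur_add_right, add_smul]; exact add_mem hp hq
    | monomial r c =>
      rw [← Polynomial.smul_X_eq_monomial, cur_smul_right, smul_assoc]
      exact A.smul_mem c (h1 _ (cur_X_pow_smul_mem x r s hv))
  exact fun v hv => h2 hv

theorem isBounded (wt₁ wt₂ : DomWeight n) :
    IsBounded (FModule wt₁ wt₂) (genWeight wt₁ wt₂) := by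
  refine eq_top_iff.2 ?_
  have h := iSup_monomialSpan (wt₁ := wt₁) (wt₂ := wt₂)
  rw [← LieSubmodule.toSubmodule_inj, LieSubmodule.iSup_toSubmodule,
    LieSubmodule.top_toSubmodule] at h
  rw [← h]
  exact iSup_le monomialSpan_le_wtSum

end FModule

end SlCurrent

end

noncomputable section

namespace SlCurrent

variable {n : ℕ}

/-! ## Row and column sums of exponents -/

/-- The sum of the exponents of the roots `ε_i - ε_j` with given `i`. -/
def rowSum (t : PosRoot n → ℕ) (i : Fin n) : ℕ := ∑ α : PosRoot n, if α.src = i then t α else 0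

/-- The sum of the exponents of the roots `ε_i - ε_j` with given `j`. -/
def colSum (t : PosRoot n → ℕ) (j : Fin n) : ℕ := ∑ α : PosRoot n, if α.tgt = j then t α else 0

theorem rowSum_add (s t : PosRoot n → ℕ) : rowSum (s + t) = rowSum s + rowSum t := by
  funext i
  simp only [rowSum, Pi.add_apply, ← Finset.sum_add_distrib]
  exact Finset.sum_congr rfl fun α _ => by split_ifs <;> simp

theorem colSum_add (s t : PosRoot n → ℕ) : colSum (s + t) = colSum s + colSum t := by
  funext i
  simp only [colSum, Pi.add_apply, ← Finset.sum_add_distrib]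
  exact Finset.sum_congr rfl fun α _ => by split_ifs <;> simp

theorem rowSum_single (α : PosRoot n) : rowSum (Pi.single α 1) = Pi.single α.src 1 := by
  funext i
  rw [rowSum, Finset.sum_eq_single α]
  · simp [Pi.single_apply, eq_comm]
  · intro β _ h; simp [h]
  · simp

theorem colSum_single (α : PosRoot n) : colSum (Pi.single α 1) = Pi.single α.tgt 1 := by
  funext i
  rw [colSum, Finset.sum_eq_single α]
  · simp [Pi.single_apply, eq_comm]
  · intro β _ h; simp [h]
  · simp

theorem le_rowSum (t : PosRoot n → ℕ) (α : PosRoot n) : t α ≤ rowSum t α.src := by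
  have := Finset.single_le_sum (f := fun β : PosRoot n => if β.src = α.src then t β else 0)
    (fun _ _ => Nat.zero_le _) (Finset.mem_univ α)
  simpa [rowSum] using this

theorem le_colSum (t : PosRoot n → ℕ) (α : PosRoot n) : t α ≤ colSum t α.tgt := by
  have := Finset.single_le_sum (f := fun β : PosRoot n => if β.tgt = α.tgt then t β else 0)
    (fun _ _ => Nat.zero_le _) (Finset.mem_univ α)
  simpa [colSum] using this

theorem sum_rowSum_mul (t : PosRoot n → ℕ) (g : Fin n → ℕ) :
    ∑ i, rowSum t i * g i = ∑ α, t α * g α.src := by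
  simp only [rowSum, Finset.sum_mul]
  rw [Finset.sum_comm]
  refine Finset.sum_congr rfl fun α _ => ?_
  simp [ite_mul]

theorem sum_colSum_mul (t : PosRoot n → ℕ) (g : Fin n → ℕ) :
    ∑ i, colSum t i * g i = ∑ α, t α * g α.tgt := by
  simp only [colSum, Finset.sum_mul]
  rw [Finset.sum_comm]
  refine Finset.sum_congr rfl fun α _ => ?_
  simp [ite_mul]

theorem sum_rowSum (t : PosRoot n → ℕ) : ∑ i, rowSum t i = deg t := by
  simpa [deg] using sum_rowSum_mul t fun _ => 1

theorem sum_colSum (t : PosRoot n → ℕ) : ∑ i, colSum t i = deg t := by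
  simpa [deg] using sum_colSum_mul t fun _ => 1

/-- The height is the sum of targets minus the sum of sources, hence determined by the row and
column sums. -/
theorem ht_add_sum_rowSum (t : PosRoot n → ℕ) :
    ht t + ∑ i, rowSum t i * (i : ℕ) = ∑ i, colSum t i * (i : ℕ) := by
  rw [sum_rowSum_mul, sum_colSum_mul, ht, ← Finset.sum_add_distrib]
  refine Finset.sum_congr rfl fun α _ => ?_
  have := Fin.lt_def.1 α.src_lt_tgt
  rw [← mul_add, PosRoot.height, Nat.sub_add_cancel this.le]

theorem posRoot_lt_iff {α β : PosRoot n} :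
    α < β ↔ α.src < β.src ∨ α.src = β.src ∧ α.tgt < β.tgt :=
  Prod.Lex.lt_iff

theorem posRoot_ext {α β : PosRoot n} (h1 : α.src = β.src) (h2 : α.tgt = β.tgt) : α = β :=
  Subtype.ext (Prod.ext h1 h2)

/-- An exponent which is supported on a chain is the lexicographic maximum among all exponents
with the same row and column sums. -/
theorem exists_lt_of_margins {s t : PosRoot n → ℕ}
    (hs : ∀ α β, s α ≠ 0 → s β ≠ 0 →
      (α.src ≤ β.src ∧ α.tgt ≤ β.tgt) ∨ (β.src ≤ α.src ∧ β.tgt ≤ α.tgt))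
    (hrow : rowSum t = rowSum s) (hcol : colSum t = colSum s) (hne : t ≠ s) :
    ∃ α, (∀ β < α, t β = s β) ∧ t α < s α := by
  obtain ⟨α, hα, hmin⟩ := WellFounded.has_min (wellFounded_lt (α := PosRoot n))
    {α | t α ≠ s α} (by
      by_contra h
      rw [Set.not_nonempty_iff_eq_empty] at h
      exact hne (funext fun α => by
        by_contra h2
        exact (Set.eq_empty_iff_forall_notMem.1 h) α h2))
  have heq : ∀ β < α, t β = s β := fun β hβ => by
    by_contra h
    exact hmin β h hβ
  refine ⟨α, heq, lt_of_le_of_ne ?_ hα⟩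
  by_contra! hlt
  -- At the first root `α` where the two differ, suppose `t` is larger. A chain cannot meet both the
  -- rest of the row and the rest of the column of `α`, so `s` vanishes on one of them; there the
  -- corresponding sum of `t` would exceed that of `s`.
  have hcase : (∀ γ : PosRoot n, γ.src = α.src → α.tgt < γ.tgt → s γ = 0) ∨
      (∀ γ : PosRoot n, γ.tgt = α.tgt → α.src < γ.src → s γ = 0) := by
    by_contra! h
    obtain ⟨⟨γ, h1, h2, h3⟩, ⟨δ, h4, h5, h6⟩⟩ := h
    rcases hs γ δ h3 h6 with h | h
    · exact absurd (h2.trans_le h.2) (by rw [h4]; exact lt_irrefl _)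
    · exact absurd (h5.trans_le h.1) (by rw [h1]; exact lt_irrefl _)
  rcases hcase with h | h
  · have : rowSum s α.src < rowSum t α.src := by
      refine Finset.sum_lt_sum (fun γ _ => ?_) ⟨α, Finset.mem_univ α, by simpa using hlt⟩
      split_ifs with hγ
      · rcases lt_trichotomy γ α with hlt' | rfl | hgt
        · exact (heq γ hlt').ge
        · exact hlt.le
        · rcases posRoot_lt_iff.1 hgt with h1 | h1
          · exact absurd hγ h1.ne'
          · rw [h γ hγ h1.2]; exact Nat.zero_le _
      · exact le_rfl
    rw [hrow] at this
    exact lt_irrefl _ this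
  · have : colSum s α.tgt < colSum t α.tgt := by
      refine Finset.sum_lt_sum (fun γ _ => ?_) ⟨α, Finset.mem_univ α, by simpa using hlt⟩
      split_ifs with hγ
      · rcases lt_trichotomy γ α with hlt' | rfl | hgt
        · exact (heq γ hlt').ge
        · exact hlt.le
        · rcases posRoot_lt_iff.1 hgt with h1 | h1
          · rw [h γ hγ h1]; exact Nat.zero_le _
          · exact absurd hγ h1.2.ne'
      · exact le_rfl
    rw [hcol] at this
    exact lt_irrefl _ this

/-- The exponents with given row and column sums. -/
def marginClass (r c : Fin n → ℕ) : Finset (PosRoot n → ℕ) :=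
  (Fintype.piFinset fun α : PosRoot n => Finset.range (r α.src + 1)).filter
    fun t => rowSum t = r ∧ colSum t = c

theorem mem_marginClass {r c : Fin n → ℕ} {t : PosRoot n → ℕ} :
    t ∈ marginClass r c ↔ rowSum t = r ∧ colSum t = c := by
  rw [marginClass, Finset.mem_filter]
  refine ⟨fun h => h.2, fun h => ⟨?_, h⟩⟩
  rw [Fintype.mem_piFinset]
  intro α
  rw [Finset.mem_range, Nat.lt_succ_iff, ← h.1]
  exact le_rowSum t α

/-- Moving the units of a vector of natural numbers with given sum away from one position. -/
theorem margin_induction {p : (Fin n → ℕ) → Prop} {i₀ : Fin n} {N : ℕ} {S : Set (Fin n)}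
    (base : p (Pi.single i₀ N))
    (step : ∀ r : Fin n → ℕ, ∀ l ∈ S, l ≠ i₀ → (∀ i, i ≠ i₀ → i ∉ S → r i = 0) →
      p (r + Pi.single i₀ 1) → p (r + Pi.single l 1))
    {r : Fin n → ℕ} (hr : ∀ i, i ≠ i₀ → i ∉ S → r i = 0) (hN : ∑ i, r i = N) : p r := by
  induction hd : ∑ i ∈ Finset.univ.erase i₀, r i generalizing r with
  | zero =>
    have h0 : ∀ i, i ≠ i₀ → r i = 0 := fun i hi =>
      Finset.sum_eq_zero_iff.1 hd i (Finset.mem_erase.2 ⟨hi, Finset.mem_univ i⟩)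
    have : r = Pi.single i₀ N := by
      funext i
      rw [← Finset.add_sum_erase _ _ (Finset.mem_univ i₀), hd, add_zero] at hN
      rcases eq_or_ne i i₀ with rfl | hi
      · rw [Pi.single_eq_same, hN]
      · rw [h0 i hi, Pi.single_eq_of_ne hi]
    rwa [this]
  | succ d ih =>
    obtain ⟨l, hl, hl0⟩ := Finset.exists_ne_zero_of_sum_ne_zero (hd.trans_ne (Nat.succ_ne_zero d))
    have hli : l ≠ i₀ := (Finset.mem_erase.1 hl).1
    have hlS : l ∈ S := by
      by_contra h
      exact hl0 (hr l hli h)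
    have hle : Pi.single l 1 ≤ r := by
      intro i
      rcases eq_or_ne i l with rfl | h
      · rw [Pi.single_eq_same]; exact Nat.one_le_iff_ne_zero.2 hl0
      · simp [h]
    obtain ⟨q, rfl⟩ := exists_add_of_le hle
    rw [add_comm (Pi.single l 1)] at hr hN hd ⊢
    have hq : ∀ i, i ≠ i₀ → i ∉ S → q i = 0 := by
      intro i hi hiS
      have := hr i hi hiS
      rw [Pi.add_apply] at this
      omega
    have hsingle : ∀ k : Fin n, ∑ i, (Pi.single k 1 : Fin n → ℕ) i = 1 := by
      intro k; simp
    refine step q l hlS hli hq (ih ?_ ?_ ?_)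
    · intro i hi hiS
      rw [Pi.add_apply, hq i hi hiS, Pi.single_eq_of_ne hi, add_zero]
    · simp only [Pi.add_apply, Finset.sum_add_distrib, hsingle] at hN ⊢
      exact hN
    · simp only [Pi.add_apply, Finset.sum_add_distrib] at hd ⊢
      have h1 : ∑ i ∈ Finset.univ.erase i₀, (Pi.single i₀ 1 : Fin n → ℕ) i = 0 :=
        Finset.sum_eq_zero fun i hi => Pi.single_eq_of_ne (Finset.mem_erase.1 hi).1 _
      have h2 : ∑ i ∈ Finset.univ.erase i₀, (Pi.single l 1 : Fin n → ℕ) i = 1 := by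
        rw [Finset.sum_eq_single_of_mem l hl fun i _ h => Pi.single_eq_of_ne h _,
          Pi.single_eq_same]
      omega

namespace FModule

variable {wt₁ wt₂ : DomWeight n}

/-! ## Divided monomials -/

/-- The coefficient `1 / ∏ m_α!`. -/
def divCoeff (m : PosRoot n → ℕ) : ℂ := ((∏ α, (m α).factorial : ℕ) : ℂ)⁻¹

theorem divCoeff_ne_zero (m : PosRoot n → ℕ) : divCoeff m ≠ 0 :=
  inv_ne_zero (Nat.cast_ne_zero.2 (Finset.prod_ne_zero_iff.2 fun _ _ => Nat.factorial_ne_zero _))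

/-- With divided powers, removing a factor has coefficient one. This makes raising operators act on
the sums below by a single scalar. -/
theorem nsmul_divCoeff (m : PosRoot n → ℕ) (α : PosRoot n) :
    (m + Pi.single α 1 : PosRoot n → ℕ) α • divCoeff (m + Pi.single α 1) = divCoeff m := by
  have h : ∏ β, ((m + Pi.single α 1 : PosRoot n → ℕ) β).factorial =
      (m α + 1) * ∏ β, (m β).factorial := by
    rw [← Finset.mul_prod_erase _ _ (Finset.mem_univ α),
      ← Finset.mul_prod_erase Finset.univ (fun β => (m β).factorial) (Finset.mem_univ α)]
    have : ∏ β ∈ Finset.univ.erase α, ((m + Pi.single α 1 : PosRoot n → ℕ) β).factorial =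
        ∏ β ∈ Finset.univ.erase α, (m β).factorial := by
      refine Finset.prod_congr rfl fun β hβ => ?_
      simp [(Finset.mem_erase.1 hβ).1]
    rw [this, Pi.add_apply, Pi.single_eq_same, Nat.factorial_succ, mul_assoc]
  rw [divCoeff, h, divCoeff, Pi.add_apply, Pi.single_eq_same, nsmul_eq_mul, Nat.cast_mul, mul_inv,
    ← mul_assoc, mul_inv_cancel₀ (Nat.cast_ne_zero.2 (Nat.succ_ne_zero _)), one_mul]

/-- A derivation which replaces the roots `a x` by the roots `b x` acts on sums of divided
monomials. -/
theorem lie_sum_divCoeff {ι : Type*} [Fintype ι] (a b : ι → PosRoot n)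
    (A A' : Finset (PosRoot n → ℕ))
    (hA : ∀ x (s : PosRoot n → ℕ), s + Pi.single (a x) 1 ∈ A ↔ s + Pi.single (b x) 1 ∈ A') (y : Sl n) (ε : ℂ)
    (hy : ∀ t ∈ A, ⁅y, monomialVec wt₁ wt₂ t⁆ =
      ε • ∑ x, t (a x) • monomialVec wt₁ wt₂ (t - Pi.single (a x) 1 + Pi.single (b x) 1))
    (R : ℕ) (hR : ∀ t ∈ A', ∑ x, t (b x) = R) :
    ⁅y, ∑ t ∈ A, divCoeff t • monomialVec wt₁ wt₂ t⁆ =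
      ε • R • ∑ t ∈ A', divCoeff t • monomialVec wt₁ wt₂ t := by
  have h1 : ∀ x, ∑ t ∈ A, divCoeff t • t (a x) •
      monomialVec wt₁ wt₂ (t - Pi.single (a x) 1 + Pi.single (b x) 1) =
      ∑ t ∈ A', t (b x) • divCoeff t • monomialVec wt₁ wt₂ t := by
    intro x
    rw [← Finset.sum_filter_of_ne (p := fun t => t (a x) ≠ 0) (s := A) (fun t _ h h0 => h (by
        rw [h0, zero_smul, smul_zero])),
      ← Finset.sum_filter_of_ne (p := fun t => t (b x) ≠ 0) (s := A') (fun t _ h h0 => h (by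
        rw [h0, zero_smul]))]
    -- Exchange one factor `a x` for one factor `b x`. By `nsmul_divCoeff` both coefficients equal
    -- the divided coefficient of the common part.
    refine Finset.sum_nbij' (fun t => t - Pi.single (a x) 1 + Pi.single (b x) 1)
      (fun t => t - Pi.single (b x) 1 + Pi.single (a x) 1) ?_ ?_ ?_ ?_ ?_
    · intro t ht
      rw [Finset.mem_filter] at ht ⊢
      refine ⟨(hA x _).1 ?_, by simp⟩
      rw [sub_single_add ht.2]
      exact ht.1
    · intro t ht
      rw [Finset.mem_filter] at ht ⊢
      refine ⟨(hA x _).2 ?_, by simp⟩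
      rw [sub_single_add ht.2]
      exact ht.1
    · intro t ht
      rw [Finset.mem_filter] at ht
      rw [add_tsub_cancel_right, sub_single_add ht.2]
    · intro t ht
      rw [Finset.mem_filter] at ht
      rw [add_tsub_cancel_right, sub_single_add ht.2]
    · intro t ht
      rw [Finset.mem_filter] at ht
      obtain ⟨s, rfl⟩ : ∃ s : PosRoot n → ℕ, t = s + Pi.single (a x) 1 := ⟨_, (sub_single_add ht.2).symm⟩
      rw [add_tsub_cancel_right, smul_comm, ← smul_assoc, nsmul_divCoeff, ← smul_assoc,
        nsmul_divCoeff]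
  rw [lie_sum]
  have h2 : ∀ t ∈ A, ⁅y, divCoeff t • monomialVec wt₁ wt₂ t⁆ = ε • ∑ x, divCoeff t • t (a x) •
      monomialVec wt₁ wt₂ (t - Pi.single (a x) 1 + Pi.single (b x) 1) := by
    intro t ht
    rw [lie_smul, hy t ht, smul_comm, Finset.smul_sum]
  rw [Finset.sum_congr rfl h2, ← Finset.smul_sum, Finset.sum_comm, Finset.sum_congr rfl fun x _ => h1 x,
    Finset.sum_comm]
  congr 1
  rw [Finset.smul_sum]
  -- The monomial `t` arises once for each `x`, with multiplicity `t (b x)`; these multiplicities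
  -- add up to `R`.
  refine Finset.sum_congr rfl fun t ht => ?_
  rw [← Finset.sum_smul, hR t ht]

/-- The sum of the divided monomials with given row and column sums. -/
def marginSum (wt₁ wt₂ : DomWeight n) (r c : Fin n → ℕ) : FModule wt₁ wt₂ :=
  ∑ t ∈ marginClass r c, divCoeff t • monomialVec wt₁ wt₂ t

theorem cur_matUnit_X_smul_monomialVec {i j : Fin n} (h : i < j) (m : PosRoot n → ℕ) :
    cur (matUnit j i) Polynomial.X • monomialVec wt₁ wt₂ m =
      monomialVec wt₁ wt₂ (m + Pi.single (mkRoot h) 1) := by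
  rw [← fVec_mkRoot h, fVec_smul_monomialVec]

/-- In `[E_{kl}, E_{ji}]` the term `E_{ki}` has `k ≤ i` by the support condition and acts by zero
with `t`. Only `-E_{jl}` with `i = k` survives: a root moves from row `k` to row `l` in the same
column. -/
theorem eVec_lie_monomialVec_row {k l : Fin n} (h : k < l) {t : PosRoot n → ℕ}
    (ht : ∀ α : PosRoot n, t α ≠ 0 → k ≤ α.src) :
    ⁅eVec (mkRoot h), monomialVec wt₁ wt₂ t⁆ = (-1 : ℂ) • ∑ j : {j // l < j},
      t (mkRoot (h.trans j.2)) • monomialVec wt₁ wt₂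
        (t - Pi.single (mkRoot (h.trans j.2)) 1 + Pi.single (mkRoot j.2) 1) := by
  rw [lie_monomialVec _ t (c := 0) (by rw [zero_smul]; exact eVec_smul_one _ 1), zero_smul,
    zero_add, Finset.smul_sum]
  have hact : ∀ α : PosRoot n, t α ≠ 0 → ∀ v ∈ killed wt₁ wt₂,
      cur ⁅eVec (mkRoot h), fVec α⁆ Polynomial.X • v =
        (-1 : ℂ) • if k = α.src then cur (matUnit α.tgt l) Polynomial.X • v else 0 := by
    intro α hα v hv
    rw [eVec_eq, fVec_eq, matUnit_lie, sub_eq_add_neg, ← neg_one_smul ℂ (ite _ _ _), cur_add_left,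
      cur_smul_left, add_smul, smul_assoc]
    have h1 : cur (if (mkRoot h).tgt = α.tgt then matUnit (mkRoot h).src α.src else 0)
        Polynomial.X • v = 0 := by
      split_ifs
      · exact cur_matUnit_smul_of_le hv (ht α hα)
      · rw [cur_zero_left, zero_smul]
    rw [h1, zero_add]
    congr 1
    change cur (if k = α.src then matUnit α.tgt l else 0) Polynomial.X • v = _
    split_ifs
    · rfl
    · rw [cur_zero_left, zero_smul]
  symm
  refine Finset.sum_of_injOn (fun j => mkRoot (h.trans j.2)) ?_ (fun _ _ => Finset.mem_univ _) ?_ ?_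
  · intro i _ j _ hij
    exact Subtype.ext (congrArg PosRoot.tgt hij)
  · intro α _ hα
    rcases eq_or_ne (t α) 0 with h0 | h0
    · rw [h0, zero_smul]
    rw [hact α h0 _ (monomialVec_mem_killed _)]
    split_ifs with hk
    · rcases le_or_gt α.tgt l with hle | hgt
      · rw [cur_matUnit_smul_of_le (monomialVec_mem_killed _) hle, smul_zero, smul_zero]
      · exact absurd ⟨⟨α.tgt, hgt⟩, Finset.mem_coe.2 (Finset.mem_univ _),
          posRoot_ext hk rfl⟩ hα
    · rw [smul_zero, smul_zero]
  · intro j _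
    rcases eq_or_ne (t (mkRoot (h.trans j.2))) 0 with h0 | h0
    · rw [h0, zero_smul, smul_zero, zero_smul]
    · rw [hact _ h0 _ (monomialVec_mem_killed _), smul_comm]
      congr 2
      have : k = (mkRoot (h.trans j.2)).src := rfl
      rw [if_pos this]
      exact (cur_matUnit_X_smul_monomialVec j.2 _).symm

/-- The transposed computation: the support condition now kills the other term of the bracket, and a
root moves from column `l` to column `k` in the same row. -/
theorem eVec_lie_monomialVec_col {k l : Fin n} (h : k < l) {t : PosRoot n → ℕ}
    (ht : ∀ α : PosRoot n, t α ≠ 0 → α.tgt ≤ l) :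
    ⁅eVec (mkRoot h), monomialVec wt₁ wt₂ t⁆ = (1 : ℂ) • ∑ i : {i // i < k},
      t (mkRoot (i.2.trans h)) • monomialVec wt₁ wt₂
        (t - Pi.single (mkRoot (i.2.trans h)) 1 + Pi.single (mkRoot i.2) 1) := by
  rw [lie_monomialVec _ t (c := 0) (by rw [zero_smul]; exact eVec_smul_one _ 1), zero_smul,
    zero_add, one_smul]
  have hact : ∀ α : PosRoot n, t α ≠ 0 → ∀ v ∈ killed wt₁ wt₂,
      cur ⁅eVec (mkRoot h), fVec α⁆ Polynomial.X • v =
        if l = α.tgt then cur (matUnit k α.src) Polynomial.X • v else 0 := by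
    intro α hα v hv
    rw [eVec_eq, fVec_eq, matUnit_lie, sub_eq_add_neg, ← neg_one_smul ℂ (ite _ _ _), cur_add_left,
      cur_smul_left, add_smul, smul_assoc]
    have h1 : cur (if (mkRoot h).src = α.src then matUnit α.tgt (mkRoot h).tgt else 0)
        Polynomial.X • v = 0 := by
      split_ifs
      · exact cur_matUnit_smul_of_le hv (ht α hα)
      · rw [cur_zero_left, zero_smul]
    rw [h1, smul_zero, add_zero]
    change cur (if l = α.tgt then matUnit k α.src else 0) Polynomial.X • v = _
    split_ifs
    · rfl
    · rw [cur_zero_left, zero_smul]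
  symm
  refine Finset.sum_of_injOn (fun i => mkRoot (i.2.trans h)) ?_ (fun _ _ => Finset.mem_univ _) ?_ ?_
  · intro i _ j _ hij
    exact Subtype.ext (congrArg PosRoot.src hij)
  · intro α _ hα
    rcases eq_or_ne (t α) 0 with h0 | h0
    · rw [h0, zero_smul]
    rw [hact α h0 _ (monomialVec_mem_killed _)]
    split_ifs with hk
    · rcases le_or_gt k α.src with hle | hgt
      · rw [cur_matUnit_smul_of_le (monomialVec_mem_killed _) hle, smul_zero]
      · exact absurd ⟨⟨α.src, hgt⟩, Finset.mem_coe.2 (Finset.mem_univ _),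
          posRoot_ext rfl hk⟩ hα
    · rw [smul_zero]
  · intro i _
    rcases eq_or_ne (t (mkRoot (i.2.trans h))) 0 with h0 | h0
    · rw [h0, zero_smul, zero_smul]
    · rw [hact _ h0 _ (monomialVec_mem_killed _)]
      congr 1
      have : l = (mkRoot (i.2.trans h)).tgt := rfl
      rw [if_pos this]
      exact (cur_matUnit_X_smul_monomialVec i.2 _).symm

theorem sum_mkRoot_row (t : PosRoot n → ℕ) (l : Fin n) :
    ∑ j : {j // l < j}, t (mkRoot j.2) = rowSum t l := by
  refine Finset.sum_of_injOn (fun j => mkRoot j.2) ?_ (fun _ _ => Finset.mem_univ _) ?_ ?_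
  · intro i _ j _ hij
    exact Subtype.ext (congrArg PosRoot.tgt hij)
  · intro α _ hα
    refine if_neg fun hl : α.src = l => hα ⟨⟨α.tgt, hl ▸ α.src_lt_tgt⟩, Finset.mem_coe.2 (Finset.mem_univ _),
      posRoot_ext hl.symm rfl⟩
  · intro j _
    exact (if_pos rfl).symm

theorem sum_mkRoot_col (t : PosRoot n → ℕ) (k : Fin n) :
    ∑ i : {i // i < k}, t (mkRoot i.2) = colSum t k := by
  refine Finset.sum_of_injOn (fun j => mkRoot j.2) ?_ (fun _ _ => Finset.mem_univ _) ?_ ?_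
  · intro i _ j _ hij
    exact Subtype.ext (congrArg PosRoot.src hij)
  · intro α _ hα
    refine if_neg fun hl : α.tgt = k => hα ⟨⟨α.src, hl ▸ α.src_lt_tgt⟩, Finset.mem_coe.2 (Finset.mem_univ _),
      posRoot_ext rfl hl.symm⟩
  · intro j _
    exact (if_pos rfl).symm

/-- The raising operator of `ε_k - ε_l` carries the first sum to `-(r_l + 1)` times the second, and
this scalar is nonzero. -/
theorem marginSum_row {k l : Fin n} (h : k < l) {r c : Fin n → ℕ} (hr : ∀ i < k, r i = 0)
    (h0 : marginSum wt₁ wt₂ (r + Pi.single k 1) c = 0) :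
    marginSum wt₁ wt₂ (r + Pi.single l 1) c = 0 := by
  have key := lie_sum_divCoeff (wt₁ := wt₁) (wt₂ := wt₂) (ι := {j // l < j})
    (fun j => mkRoot (h.trans j.2)) (fun j => mkRoot j.2) (marginClass (r + Pi.single k 1) c)
    (marginClass (r + Pi.single l 1) c) (fun j s => by
      rw [mem_marginClass, mem_marginClass, rowSum_add, rowSum_add, colSum_add, colSum_add,
        rowSum_single, rowSum_single, colSum_single, colSum_single]
      change _ + Pi.single k 1 = _ ∧ _ ↔ _ + Pi.single l 1 = _ ∧ _
      rw [add_left_inj, add_left_inj]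
      rfl) (eVec (mkRoot h)) (-1) (fun t ht => eVec_lie_monomialVec_row h fun α hα => by
      by_contra! hlt
      have h1 := le_rowSum t α
      rw [(mem_marginClass.1 ht).1, Pi.add_apply, hr _ hlt, Pi.single_eq_of_ne hlt.ne] at h1
      omega) (r l + 1) (fun t ht => by
      rw [sum_mkRoot_row, (mem_marginClass.1 ht).1, Pi.add_apply, Pi.single_eq_same])
  rw [marginSum] at h0 ⊢
  rw [h0, lie_zero, neg_one_smul, eq_comm, neg_eq_zero] at key
  rw [← Nat.cast_smul_eq_nsmul ℂ] at key
  exact (smul_eq_zero.1 key).resolve_left (Nat.cast_ne_zero.2 (Nat.succ_ne_zero _))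

/-- As for rows, with the nonzero scalar `c_k + 1`. -/
theorem marginSum_col {k l : Fin n} (h : k < l) {r c : Fin n → ℕ} (hc : ∀ j, l < j → c j = 0)
    (h0 : marginSum wt₁ wt₂ r (c + Pi.single l 1) = 0) :
    marginSum wt₁ wt₂ r (c + Pi.single k 1) = 0 := by
  have key := lie_sum_divCoeff (wt₁ := wt₁) (wt₂ := wt₂) (ι := {i // i < k})
    (fun i => mkRoot (i.2.trans h)) (fun i => mkRoot i.2) (marginClass r (c + Pi.single l 1))
    (marginClass r (c + Pi.single k 1)) (fun j s => by
      rw [mem_marginClass, mem_marginClass, rowSum_add, rowSum_add, colSum_add, colSum_add,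
        rowSum_single, rowSum_single, colSum_single, colSum_single]
      change _ ∧ _ + Pi.single l 1 = _ ↔ _ ∧ _ + Pi.single k 1 = _
      rw [add_left_inj, add_left_inj]
      rfl) (eVec (mkRoot h)) 1 (fun t ht => eVec_lie_monomialVec_col h fun α hα => by
      by_contra! hlt
      have h1 := le_colSum t α
      rw [(mem_marginClass.1 ht).2, Pi.add_apply, hc _ hlt, Pi.single_eq_of_ne hlt.ne'] at h1
      omega) (c k + 1) (fun t ht => by
      rw [sum_mkRoot_col, (mem_marginClass.1 ht).2, Pi.add_apply, Pi.single_eq_same])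
  rw [marginSum] at h0 ⊢
  rw [h0, lie_zero, one_smul, eq_comm] at key
  rw [← Nat.cast_smul_eq_nsmul ℂ] at key
  exact (smul_eq_zero.1 key).resolve_left (Nat.cast_ne_zero.2 (Nat.succ_ne_zero _))

theorem monomialVec_single (β : PosRoot n) (N : ℕ) : monomialVec wt₁ wt₂ (Pi.single β N) =
    cur (fVec β) Polynomial.X ^ N • one wt₁ wt₂ := by
  induction N with
  | zero => rw [Pi.single_zero, monomialVec_zero, pow_zero, one_smul]
  | succ N ih => rw [Pi.single_add, ← fVec_smul_monomialVec, ih, pow_succ', mul_smul]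

/-- When both margins are concentrated at `β`, the only monomial is `(f_β ⊗ t)^N`, which vanishes
since `N > a_β`. Units of the column sum are then moved away from the target of `β` to smaller
indices, and units of the row sum away from its source to larger ones; each move preserves the
vanishing. -/
theorem marginSum_eq_zero {β : PosRoot n} {N : ℕ}
    (hN : min (wt₁.pairing β) (wt₂.pairing β) < N) {r c : Fin n → ℕ}
    (hr : ∀ i < β.src, r i = 0) (hc : ∀ j, β.tgt < j → c j = 0)
    (hrN : ∑ i, r i = N) (hcN : ∑ i, c i = N) : marginSum wt₁ wt₂ r c = 0 := by
  have hbase : marginSum wt₁ wt₂ (Pi.single β.src N) (Pi.single β.tgt N) = 0 := by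
    refine Finset.sum_eq_zero fun t ht => ?_
    rw [mem_marginClass] at ht
    have h0 : ∀ α, α ≠ β → t α = 0 := by
      intro α hα
      by_contra h
      refine hα (posRoot_ext ?_ ?_)
      · by_contra hne
        have := le_rowSum t α
        rw [ht.1, Pi.single_eq_of_ne hne] at this
        omega
      · by_contra hne
        have := le_colSum t α
        rw [ht.2, Pi.single_eq_of_ne hne] at this
        omega
    have htN : t = Pi.single β N := by
      funext α
      rcases eq_or_ne α β with rfl | h
      · have h1 := congrFun ht.1 α.src
        rw [Pi.single_eq_same, rowSum, Finset.sum_eq_single α, if_pos rfl] at h1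
        · rw [h1, Pi.single_eq_same]
        · intro γ _ hγ
          rw [h0 γ hγ, ite_self]
        · simp
      · rw [h0 α h, Pi.single_eq_of_ne h]
    obtain ⟨d, rfl⟩ := Nat.exists_eq_add_of_lt hN
    rw [htN, monomialVec_single, add_right_comm, add_comm, pow_add, mul_smul, fVec_pow_smul_one,
      smul_zero, smul_zero]
  have hcol : marginSum wt₁ wt₂ (Pi.single β.src N) c = 0 := by
    refine margin_induction (p := fun c => marginSum wt₁ wt₂ (Pi.single β.src N) c = 0)
      (S := {j | j < β.tgt}) hbase ?_ ?_ hcN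
    · intro q l hl _ hq h
      exact marginSum_col hl (fun j hj => hq j hj.ne' fun h' => lt_asymm hj h') h
    · intro j hj hj'
      exact hc j (lt_of_le_of_ne (not_lt.1 hj') hj.symm)
  refine margin_induction (p := fun r => marginSum wt₁ wt₂ r c = 0)
    (S := {i | β.src < i}) hcol ?_ ?_ hrN
  · intro q l hl _ hq h
    exact marginSum_row hl (fun j hj => hq j hj.ne fun h' => lt_asymm hj h') h
  · intro j hj hj'
    exact hr j (lt_of_le_of_ne (not_lt.1 hj') hj)

theorem sum_smul_monomialVec_add {A : Finset (PosRoot n → ℕ)} {c : (PosRoot n → ℕ) → ℂ}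
    (h : ∑ t ∈ A, c t • monomialVec wt₁ wt₂ t = 0) (m : PosRoot n → ℕ) :
    ∑ t ∈ A, c t • monomialVec wt₁ wt₂ (t + m) = 0 := by
  induction m using exponent_induction with
  | zero => simpa using h
  | step m β ih =>
    have := congrArg (cur (fVec β) Polynomial.X • ·) ih
    simp only [smul_zero, Finset.smul_sum] at this
    rw [← this]
    refine Finset.sum_congr rfl fun t _ => ?_
    rw [smul_comm, fVec_smul_monomialVec, add_assoc]

end FModule

/-! ## Dyck paths -/

/-- Each step raises the sum of the two indices by one. This strict increase excludes repetitions on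
the path, while the weak inequalities make the path a chain. -/
theorem DyckPath.pairwise (p : DyckPath n) : p.roots.Pairwise fun α β =>
    α.src ≤ β.src ∧ α.tgt ≤ β.tgt ∧ (α.src : ℕ) + α.tgt < β.src + β.tgt := by
  have htrans : IsTrans (PosRoot n) fun α β => α.src ≤ β.src ∧ α.tgt ≤ β.tgt ∧
      (α.src : ℕ) + α.tgt < β.src + β.tgt :=
    ⟨fun _ _ _ h h' => ⟨h.1.trans h'.1, h.2.1.trans h'.2.1, h.2.2.trans h'.2.2⟩⟩
  rw [← List.isChain_iff_pairwise]
  refine p.isChain.imp ?_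
  rintro α β (⟨h1, h2⟩ | ⟨h1, h2⟩)
  · refine ⟨Fin.le_def.2 (by omega), h2.ge, ?_⟩
    rw [h2]; omega
  · refine ⟨h1.ge, Fin.le_def.2 (by omega), ?_⟩
    rw [h1]; omega

theorem DyckPath.nodup (p : DyckPath n) : p.roots.Nodup :=
  p.pairwise.imp fun h heq => by
    rw [heq] at h
    exact lt_irrefl _ h.2.2

theorem DyckPath.comparable (p : DyckPath n) {α β : PosRoot n} (hα : α ∈ p.roots)
    (hβ : β ∈ p.roots) :
    (α.src ≤ β.src ∧ α.tgt ≤ β.tgt) ∨ (β.src ≤ α.src ∧ β.tgt ≤ α.tgt) := by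
  have : Std.Symm fun α β : PosRoot n =>
      (α.src ≤ β.src ∧ α.tgt ≤ β.tgt) ∨ (β.src ≤ α.src ∧ β.tgt ≤ α.tgt) :=
    ⟨fun _ _ h => h.symm⟩
  refine List.Pairwise.forall_of_forall (R := fun α β : PosRoot n =>
    (α.src ≤ β.src ∧ α.tgt ≤ β.tgt) ∨ (β.src ≤ α.src ∧ β.tgt ≤ α.tgt)) ?_ ?_ hα hβ
  · exact fun _ _ => Or.inl ⟨le_rfl, le_rfl⟩
  · exact p.pairwise.imp fun h => Or.inl ⟨h.1, h.2.1⟩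

theorem DyckPath.baseRoot_src_le (p : DyckPath n) {α : PosRoot n} (hα : α ∈ p.roots) :
    p.baseRoot.src ≤ α.src := by
  change (p.roots.head p.ne_nil).src ≤ α.src
  have hp := p.pairwise
  rw [← List.cons_head_tail p.ne_nil] at hα hp
  rcases List.mem_cons.1 hα with rfl | h
  · exact le_rfl
  · exact ((List.pairwise_cons.1 hp).1 α h).1

theorem DyckPath.le_baseRoot_tgt (p : DyckPath n) {α : PosRoot n} (hα : α ∈ p.roots) :
    α.tgt ≤ p.baseRoot.tgt := by
  change α.tgt ≤ (p.roots.getLast p.ne_nil).tgt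
  have hp := p.pairwise
  rw [← List.dropLast_append_getLast p.ne_nil] at hα hp
  rcases List.mem_append.1 hα with h | h
  · exact ((List.pairwise_append.1 hp).2.2 α h _ (List.mem_singleton_self _)).2.1
  · rw [List.mem_singleton.1 h]

theorem exists_dyckPath_of_notMem {wt₁ wt₂ : DomWeight n} {b : PosRoot n → ℕ}
    (hb : b ∉ pointSet wt₁ wt₂) : ∃ p : DyckPath n,
      min (wt₁.pairing p.baseRoot) (wt₂.pairing p.baseRoot) < (p.roots.map b).sum := by
  by_contra! h
  refine hb fun p => ?_
  have h1 : (p.roots.map fun α => (b α : ℝ)).sum = ((p.roots.map b).sum : ℕ) := by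
    rw [Nat.cast_list_sum, List.map_map]
    rfl
  rw [h1]
  exact_mod_cast h p

theorem lex_add_lt {s t m : PosRoot n → ℕ} (h : ∃ α, (∀ β < α, t β = s β) ∧ t α < s α) :
    toLex (t + m) < toLex (s + m) := by
  obtain ⟨α, h1, h2⟩ := h
  exact ⟨α, fun β hβ => congrArg (· + m β) (h1 β hβ), Nat.add_lt_add_right h2 _⟩

namespace FModule

variable {wt₁ wt₂ : DomWeight n}

/-- The straightening law: a monomial whose exponent violates a Dyck path inequality is a
combination of lexicographically smaller monomials of the same degree and height. -/
theorem monomialVec_mem_span_lt {b : PosRoot n → ℕ} (hb : b ∉ pointSet wt₁ wt₂) :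
    monomialVec wt₁ wt₂ b ∈ Submodule.span ℂ {v | ∃ m, deg m = deg b ∧ ht m = ht b ∧
      toLex m < toLex b ∧ v = monomialVec wt₁ wt₂ m} := by
  classical
  obtain ⟨p, hp⟩ := exists_dyckPath_of_notMem hb
  -- Split `b` into its part `s` on the violated path and the rest `q`. The support of `s` lies
  -- between the indices of the base root, and its degree exceeds the bound for that root.
  let s : PosRoot n → ℕ := fun α => if α ∈ p.roots then b α else 0
  let q : PosRoot n → ℕ := fun α => if α ∈ p.roots then 0 else b α
  have hsq : s + q = b := by
    funext α
    simp only [s, q, Pi.add_apply]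
    split_ifs <;> simp
  have hs : ∀ α, s α ≠ 0 → α ∈ p.roots := by
    intro α hα
    by_contra h
    exact hα (if_neg h)
  have hsum : (p.roots.map b).sum = deg s := by
    rw [deg, ← List.sum_toFinset _ p.nodup, Finset.sum_ite, Finset.sum_const_zero, add_zero]
    refine Finset.sum_congr ?_ fun _ _ => rfl
    ext α; simp
  rw [hsum] at hp
  have h0 := marginSum_eq_zero (wt₁ := wt₁) (wt₂ := wt₂) hp (r := rowSum s) (c := colSum s)
    (fun i hi => Finset.sum_eq_zero fun α _ => by
      split_ifs with h
      · by_contra h'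
        exact absurd (p.baseRoot_src_le (hs α h')) (not_le.2 (h ▸ hi))
      · rfl)
    (fun j hj => Finset.sum_eq_zero fun α _ => by
      split_ifs with h
      · by_contra h'
        exact absurd (p.le_baseRoot_tgt (hs α h')) (not_le.2 (h ▸ hj))
      · rfl)
    (sum_rowSum s) (sum_colSum s)
  have h1 := sum_smul_monomialVec_add h0 q
  have hsmem : s ∈ marginClass (rowSum s) (colSum s) := mem_marginClass.2 ⟨rfl, rfl⟩
  -- In the vanishing sum over the margins of `s`, multiplied by the factors of `q`, single out the
  -- term of `s`, which is a multiple of the monomial of `b`. The other terms have smaller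
  -- exponents, since `s` is the maximum of its class.
  rw [← Finset.add_sum_erase _ _ hsmem, hsq] at h1
  have h2 : divCoeff s • monomialVec wt₁ wt₂ b ∈ Submodule.span ℂ {v | ∃ m, deg m = deg b ∧
      ht m = ht b ∧ toLex m < toLex b ∧ v = monomialVec wt₁ wt₂ m} := by
    rw [eq_neg_of_add_eq_zero_left h1]
    refine Submodule.neg_mem _ (Submodule.sum_mem _ fun t ht' => Submodule.smul_mem _ _
      (Submodule.subset_span ⟨t + q, ?_, ?_, ?_, rfl⟩)) <;>
    obtain ⟨hts, htm⟩ := Finset.mem_erase.1 ht' <;>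
    rw [mem_marginClass] at htm
    · rw [← hsq, deg_add, deg_add, ← sum_rowSum, htm.1, sum_rowSum]
    · have h3 := ht_add_sum_rowSum t
      rw [htm.1, htm.2, ← ht_add_sum_rowSum s, Nat.add_right_cancel_iff] at h3
      rw [← hsq, ht_add, ht_add, h3]
    · rw [← hsq]
      exact lex_add_lt (exists_lt_of_margins (fun α β hα hβ =>
        p.comparable (hs α hα) (hs β hβ)) htm.1 htm.2 hts)
  have h3 := Submodule.smul_mem _ (divCoeff s)⁻¹ h2
  rwa [smul_smul, inv_mul_cancel₀ (divCoeff_ne_zero s), one_smul] at h3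

end FModule

end SlCurrent

end

/-! ### The filtration by exponents and the counting of its nonzero steps -/

noncomputable section

namespace SlCurrent

variable {n : ℕ}

/-- Exponents of monomials, ordered by degree, then height, then lexicographically. -/
@[ext]
structure Exponent (n : ℕ) where
  toFun : PosRoot n → ℕ

/-- The key by which exponents are compared. -/
def Exponent.key (b : Exponent n) : ℕ ×ₗ ℕ ×ₗ Lex (PosRoot n → ℕ) :=
  toLex (deg b.toFun, toLex (ht b.toFun, toLex b.toFun))

theorem Exponent.toFun_injective : Function.Injective (Exponent.toFun (n := n)) :=
  fun _ _ => Exponent.ext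

theorem Exponent.key_injective : Function.Injective (Exponent.key (n := n)) := fun _ _ h =>
  Exponent.ext (toLex_inj.1 (Prod.ext_iff.1 (toLex_inj.1 (Prod.ext_iff.1 (toLex_inj.1 h)).2)).2)

instance : LinearOrder (Exponent n) := LinearOrder.lift' Exponent.key Exponent.key_injective

instance : WellFoundedLT (Exponent n) := ⟨InvImage.wf Exponent.key wellFounded_lt⟩

theorem Exponent.lt_iff {b c : Exponent n} : b < c ↔
    deg b.toFun < deg c.toFun ∨ deg b.toFun = deg c.toFun ∧
      (ht b.toFun < ht c.toFun ∨ ht b.toFun = ht c.toFun ∧ toLex b.toFun < toLex c.toFun) := by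
  change b.key < c.key ↔ _
  rw [Exponent.key, Exponent.key, Prod.Lex.toLex_lt_toLex, Prod.Lex.toLex_lt_toLex]

variable {wt₁ wt₂ : DomWeight n}

namespace FModule

/-- Brings the nested filtration into the form which `finrank_hom_eq` requires: one cyclic submodule
for each preceding exponent. -/
theorem filtPrev_eq (b : PosRoot n → ℕ) : filtPrev wt₁ wt₂ b =
    ⨆ (m : PosRoot n → ℕ) (_ : deg m = deg b ∧
      (ht m < ht b ∨ ht m = ht b ∧ toLex m < toLex b)),
      LieSubmodule.lieSpan ℂ (Sl n) {monomialVec wt₁ wt₂ m} := by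
  set A := ⨆ (m : PosRoot n → ℕ) (_ : deg m = deg b ∧
      (ht m < ht b ∨ ht m = ht b ∧ toLex m < toLex b)),
      LieSubmodule.lieSpan ℂ (Sl n) {monomialVec wt₁ wt₂ m} with hA
  have hmem : ∀ m : PosRoot n → ℕ, deg m = deg b →
      (ht m < ht b ∨ ht m = ht b ∧ toLex m < toLex b) → monomialVec wt₁ wt₂ m ∈ A := by
    intro m h1 h2
    exact (le_iSup₂ (f := fun (m : PosRoot n → ℕ) (_ : deg m = deg b ∧
      (ht m < ht b ∨ ht m = ht b ∧ toLex m < toLex b)) =>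
      LieSubmodule.lieSpan ℂ (Sl n) {monomialVec wt₁ wt₂ m}) m ⟨h1, h2⟩)
      (LieSubmodule.subset_lieSpan rfl)
  have hlt : ∀ m : PosRoot n → ℕ, deg m = deg b → ht m = ht b →
      filtLT wt₁ wt₂ (deg m) (ht m) ≤ A := by
    intro m h1 h2
    refine LieSubmodule.lieSpan_le.2 ?_
    rintro _ ⟨m', h3, h4, rfl⟩
    exact hmem m' (h3.trans h1) (Or.inl (h4.trans_eq h2))
  apply le_antisymm
  · refine sup_le (hlt b rfl rfl) (iSup₂_le fun m hm => sup_le (hlt m hm.1 hm.2.1)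
      (LieSubmodule.lieSpan_le.2 ?_))
    rintro _ ⟨m', h3, h4, h5, rfl⟩
    exact hmem m' (h3.trans hm.1) (Or.inr ⟨h4.trans hm.2.1, h5.trans_lt hm.2.2⟩)
  · refine iSup₂_le fun m hm => LieSubmodule.lieSpan_le.2 (Set.singleton_subset_iff.2 ?_)
    rcases hm.2 with h | h
    · exact (le_sup_left : filtLT wt₁ wt₂ (deg b) (ht b) ≤ filtPrev wt₁ wt₂ b)
        (LieSubmodule.subset_lieSpan ⟨m, hm.1, h, rfl⟩)
    · have h1 : filtLE wt₁ wt₂ m ≤ filtPrev wt₁ wt₂ b :=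
        le_sup_of_le_right (le_iSup₂ (f := fun (m : PosRoot n → ℕ) (_ : m ∈ {m : PosRoot n → ℕ |
          deg m = deg b ∧ ht m = ht b ∧ toLex m < toLex b}) => filtLE wt₁ wt₂ m) m ⟨hm.1, h⟩)
      exact h1 ((le_sup_right : _ ≤ filtLE wt₁ wt₂ m)
        (LieSubmodule.subset_lieSpan ⟨m, rfl, rfl, le_rfl, rfl⟩))

theorem monomialVec_mem_filtPrev {m b : PosRoot n → ℕ} (hd : deg m = deg b)
    (h : ht m < ht b ∨ ht m = ht b ∧ toLex m < toLex b) :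
    monomialVec wt₁ wt₂ m ∈ filtPrev wt₁ wt₂ b := by
  rw [filtPrev_eq]
  exact (le_iSup₂ (f := fun (m : PosRoot n → ℕ) (_ : deg m = deg b ∧
    (ht m < ht b ∨ ht m = ht b ∧ toLex m < toLex b)) =>
    LieSubmodule.lieSpan ℂ (Sl n) {monomialVec wt₁ wt₂ m}) m ⟨hd, h⟩)
    (LieSubmodule.subset_lieSpan rfl)

theorem filtPrev_le_graded (b : PosRoot n → ℕ) :
    filtPrev wt₁ wt₂ b ≤ graded wt₁ wt₂ (deg b) := by
  rw [filtPrev_eq]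
  refine iSup₂_le fun m hm => LieSubmodule.lieSpan_le.2 (Set.singleton_subset_iff.2 ?_)
  exact hm.1 ▸ monomialVec_mem_graded m

theorem filtLE_le_iff (b : PosRoot n → ℕ) :
    filtLE wt₁ wt₂ b ≤ filtPrev wt₁ wt₂ b ↔ monomialVec wt₁ wt₂ b ∈ filtPrev wt₁ wt₂ b := by
  constructor
  · intro h
    exact h ((le_sup_right : _ ≤ filtLE wt₁ wt₂ b)
      (LieSubmodule.subset_lieSpan ⟨b, rfl, rfl, le_rfl, rfl⟩))
  · intro h
    refine sup_le le_sup_left (LieSubmodule.lieSpan_le.2 ?_)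
    rintro _ ⟨m, h1, h2, h3, rfl⟩
    rcases h3.lt_or_eq with h4 | h4
    · exact monomialVec_mem_filtPrev h1 (Or.inr ⟨h2, h4⟩)
    · rw [toLex_inj.1 h4]; exact h

/-- The component is cyclic, generated by the class of the monomial of `b`, because every other
generator precedes it. -/
theorem nontrivial_grComponent_iff (b : PosRoot n → ℕ) :
    Nontrivial (GrComponent wt₁ wt₂ b) ↔ monomialVec wt₁ wt₂ b ∉ filtPrev wt₁ wt₂ b := by
  rw [← filtLE_le_iff, ← not_subsingleton_iff_nontrivial, not_iff_not]
  refine Iff.trans (Submodule.Quotient.subsingleton_iff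
    (p := ((filtPrev wt₁ wt₂ b).comap (filtLE wt₁ wt₂ b).incl).toSubmodule)) ?_
  rw [Submodule.eq_top_iff']
  exact ⟨fun h x hx => h ⟨x, hx⟩, fun h x => h x.2⟩

theorem monomialVec_mem_filtPrev_of_notMem {b : PosRoot n → ℕ} (hb : b ∉ pointSet wt₁ wt₂) :
    monomialVec wt₁ wt₂ b ∈ filtPrev wt₁ wt₂ b := by
  refine (Submodule.span_le (p := (filtPrev wt₁ wt₂ b).toSubmodule)).2 ?_
    (monomialVec_mem_span_lt hb)
  rintro _ ⟨m, h1, h2, h3, rfl⟩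
  exact monomialVec_mem_filtPrev h1 (Or.inr ⟨h2, h3⟩)

/-- Membership in `S(λ₁, λ₂)` is automatic: by the straightening law the component is zero outside
it. -/
theorem mem_hwPoints_iff (b : PosRoot n → ℕ) :
    b ∈ hwPoints wt₁ wt₂ ↔ monomialVec wt₁ wt₂ b ∉ filtPrev wt₁ wt₂ b :=
  ⟨fun h => (nontrivial_grComponent_iff b).1 h.2, fun h =>
    ⟨by_contra fun hb => h (monomialVec_mem_filtPrev_of_notMem hb),
      (nontrivial_grComponent_iff b).2 h⟩⟩

/-- Paths consisting of a single root bound each coordinate. -/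
theorem finite_pointSet (wt₁ wt₂ : DomWeight n) : (pointSet wt₁ wt₂).Finite := by
  refine (Set.finite_Iic (fun α => min (wt₁.pairing α) (wt₂.pairing α))).subset fun b hb α => ?_
  have h := hb ⟨[α], by simp, by simp⟩
  simp only [List.map_cons, List.map_nil, List.sum_cons, List.sum_nil, add_zero] at h
  exact Nat.cast_le.1 h

theorem eVec_lie_monomialVec_mem_filtPrev (α : PosRoot n) (b : PosRoot n → ℕ) :
    ⁅eVec α, monomialVec wt₁ wt₂ b⁆ ∈ filtPrev wt₁ wt₂ b := by
  refine (Submodule.span_le (p := (filtPrev wt₁ wt₂ b).toSubmodule)).2 ?_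
    (eVec_lie_monomialVec_mem α b)
  rintro _ ⟨m, h1, h2, rfl⟩
  exact monomialVec_mem_filtPrev h1 (Or.inl h2)

/-- For all of `F` the exponents of every degree form one well-ordered list, in which the
predecessors of `b` include everything of lower degree. -/
theorem iSup_graded_lt_sup_filtPrev (b : Exponent n) :
    (⨆ d < deg b.toFun, graded wt₁ wt₂ d) ⊔ filtPrev wt₁ wt₂ b.toFun =
      ⨆ l < b, LieSubmodule.lieSpan ℂ (Sl n) {monomialVec wt₁ wt₂ l.toFun} := by
  have hmem : ∀ l < b, monomialVec wt₁ wt₂ l.toFun ∈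
      ⨆ l < b, LieSubmodule.lieSpan ℂ (Sl n) {monomialVec wt₁ wt₂ l.toFun} := fun l hl =>
    (le_iSup₂ (f := fun (l : Exponent n) (_ : l < b) =>
      LieSubmodule.lieSpan ℂ (Sl n) {monomialVec wt₁ wt₂ l.toFun}) l hl)
      (LieSubmodule.subset_lieSpan rfl)
  apply le_antisymm
  · refine sup_le (iSup₂_le fun d hd => ?_) ?_
    · rw [graded_eq_monomialSpan]
      refine LieSubmodule.lieSpan_le.2 ?_
      rintro _ ⟨m, rfl, rfl⟩
      exact hmem ⟨m⟩ (Exponent.lt_iff.2 (Or.inl hd))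
    · rw [filtPrev_eq]
      exact iSup₂_le fun m hm => LieSubmodule.lieSpan_le.2 (Set.singleton_subset_iff.2
        (hmem ⟨m⟩ (Exponent.lt_iff.2 (Or.inr hm))))
  · refine iSup₂_le fun l hl => LieSubmodule.lieSpan_le.2 (Set.singleton_subset_iff.2 ?_)
    rcases Exponent.lt_iff.1 hl with h | h
    · exact (le_sup_of_le_left (le_iSup₂ (f := fun d (_ : d < deg b.toFun) => graded wt₁ wt₂ d) _ h) :
        graded wt₁ wt₂ (deg l.toFun) ≤ _) (monomialVec_mem_graded l.toFun)
    · exact (le_sup_right : filtPrev wt₁ wt₂ b.toFun ≤ _) (monomialVec_mem_filtPrev h.1 h.2)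

/-- A contribution from lower degrees would also lie in degree `deg b`, hence is zero by
independence. The steps of the long list are therefore nonzero exactly when those within one degree
are. -/
theorem monomialVec_mem_sup_iff (b : PosRoot n → ℕ) :
    monomialVec wt₁ wt₂ b ∈ (⨆ d < deg b, graded wt₁ wt₂ d) ⊔ filtPrev wt₁ wt₂ b ↔
      monomialVec wt₁ wt₂ b ∈ filtPrev wt₁ wt₂ b := by
  refine ⟨fun h => ?_, fun h => (le_sup_right : filtPrev wt₁ wt₂ b ≤ _) h⟩
  obtain ⟨x, hx, y, hy, hxy⟩ := (LieSubmodule.mem_sup _ _ _).1 h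
  have hx' : x ∈ graded wt₁ wt₂ (deg b) := by
    rw [← add_sub_cancel_right x y, hxy]
    exact sub_mem (monomialVec_mem_graded b) (filtPrev_le_graded b hy)
  have hle : (⨆ d < deg b, graded wt₁ wt₂ d : LieSubmodule ℂ (Sl n) _).toSubmodule ≤
      ⨆ d ≠ deg b, (graded wt₁ wt₂ d : Submodule ℂ (FModule wt₁ wt₂)) := by
    rw [LieSubmodule.iSup_toSubmodule]
    refine iSup_le fun d => ?_
    rw [LieSubmodule.iSup_toSubmodule]
    exact iSup_le fun hd => le_iSup₂ (f := fun d (_ : d ≠ deg b) =>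
      (graded wt₁ wt₂ d : Submodule ℂ (FModule wt₁ wt₂))) d hd.ne
  have h0 : x = 0 := (Submodule.disjoint_def.1 (iSupIndep_graded wt₁ wt₂ (deg b))) x hx' (hle hx)
  rwa [← hxy, h0, zero_add]

theorem genWeight_sub_weight_eq_iff (b : PosRoot n → ℕ) (τ : Module.Dual ℂ (cartan n)) :
    genWeight wt₁ wt₂ - weight b = τ ↔ weight b = wt₁.toDual + wt₂.toDual - τ := by
  have h : genWeight wt₁ wt₂ = wt₁.toDual + wt₂.toDual := by
    simp only [genWeight, DomWeight.toDual, Pi.add_apply, add_smul, Finset.sum_add_distrib]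
  rw [h, sub_eq_iff_eq_add, eq_sub_iff_add_eq, add_comm, eq_comm, add_comm]

variable {V : Type*} [AddCommGroup V] [Module ℂ V] [LieRingModule (Sl n) V]
  [LieModule ℂ (Sl n) V] [FiniteDimensional ℂ V] [LieModule.IsIrreducible ℂ (Sl n) V]
  {τ : DomWeight n}

theorem finite_hwPoints (wt₁ wt₂ : DomWeight n) : (hwPoints wt₁ wt₂).Finite :=
  (finite_pointSet wt₁ wt₂).subset fun _ h => h.1

/-- The multiplicities of simple modules in `F`. -/
theorem finrank_hom (hV : HasHighestWeight V τ) :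
    Module.Finite ℂ (FModule wt₁ wt₂ →ₗ⁅ℂ, Sl n⁆ V) ∧
      (Module.finrank ℂ (FModule wt₁ wt₂ →ₗ⁅ℂ, Sl n⁆ V) : ℕ∞) =
        Set.encard {b ∈ hwPoints wt₁ wt₂ | weight b = wt₁.toDual + wt₂.toDual - τ.toDual} := by
  obtain ⟨v, hv0, hvs, hvw⟩ := hV
  have hset : {b ∈ hwPoints wt₁ wt₂ | weight b = wt₁.toDual + wt₂.toDual - τ.toDual} =
      Exponent.toFun '' {k : Exponent n | monomialVec wt₁ wt₂ k.toFun ∉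
        (⨆ d < deg k.toFun, graded wt₁ wt₂ d) ⊔ filtPrev wt₁ wt₂ k.toFun ∧
          genWeight wt₁ wt₂ - weight k.toFun = τ.toDual} := by
    ext b
    simp only [Set.mem_ofPred_eq, Set.mem_image, monomialVec_mem_sup_iff, ← mem_hwPoints_iff,
      genWeight_sub_weight_eq_iff]
    exact ⟨fun h => ⟨⟨b⟩, h, rfl⟩, fun ⟨_, h, hb⟩ => hb ▸ h⟩
  rw [hset, Exponent.toFun_injective.encard_image]
  refine finrank_hom_eq (FModule.isBounded wt₁ wt₂) (FModule.locNilpotent wt₁ wt₂) hv0 hvw hvs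
    LieModuleHom.id (fun _ _ h => h) (fun b : Exponent n => monomialVec wt₁ wt₂ b.toFun)
    (fun b => genWeight wt₁ wt₂ - weight b.toFun) _ iSup_graded_lt_sup_filtPrev
    (fun b => monomialVec_mem_wtSpace b.toFun)
    (fun b α => (le_sup_right : filtPrev wt₁ wt₂ b.toFun ≤ _)
      (eVec_lie_monomialVec_mem_filtPrev α b.toFun)) ?_ ?_
  · refine Eq.trans (eq_top_iff.2 fun x _ => ⟨x, rfl⟩) (eq_top_iff.2 ?_).symm
    rw [← iSup_monomialSpan]
    refine iSup_le fun s => LieSubmodule.lieSpan_le.2 ?_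
    rintro _ ⟨m, -, rfl⟩
    exact (le_iSup (fun b : Exponent n =>
      LieSubmodule.lieSpan ℂ (Sl n) {monomialVec wt₁ wt₂ b.toFun}) ⟨m⟩)
      (LieSubmodule.subset_lieSpan rfl)
  · refine Set.Finite.of_finite_image ?_ Exponent.toFun_injective.injOn
    rw [← hset]
    exact (finite_hwPoints wt₁ wt₂).subset fun _ h => h.1

/-- The multiplicities of simple modules in the graded components of `F`. -/
theorem finrank_hom_graded (hV : HasHighestWeight V τ) (s : ℕ) :
    Module.Finite ℂ (graded wt₁ wt₂ s →ₗ⁅ℂ, Sl n⁆ V) ∧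
      (Module.finrank ℂ (graded wt₁ wt₂ s →ₗ⁅ℂ, Sl n⁆ V) : ℕ∞) =
        Set.encard {b ∈ hwPoints wt₁ wt₂ |
          weight b = wt₁.toDual + wt₂.toDual - τ.toDual ∧ deg b = s} := by
  obtain ⟨v, hv0, hvs, hvw⟩ := hV
  have hset : {b ∈ hwPoints wt₁ wt₂ |
      weight b = wt₁.toDual + wt₂.toDual - τ.toDual ∧ deg b = s} =
      (fun k : {b : Exponent n // deg b.toFun = s} => k.1.toFun) ''
        {k | monomialVec wt₁ wt₂ k.1.toFun ∉ filtPrev wt₁ wt₂ k.1.toFun ∧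
          genWeight wt₁ wt₂ - weight k.1.toFun = τ.toDual} := by
    ext b
    constructor
    · rintro ⟨h1, h2, h3⟩
      exact ⟨⟨⟨b⟩, h3⟩, ⟨(mem_hwPoints_iff b).1 h1, (genWeight_sub_weight_eq_iff b _).2 h2⟩, rfl⟩
    · rintro ⟨⟨b, h3⟩, ⟨h1, h2⟩, rfl⟩
      exact ⟨(mem_hwPoints_iff _).2 h1, (genWeight_sub_weight_eq_iff _ _).1 h2, h3⟩
  have hinj : Function.Injective fun k : {b : Exponent n // deg b.toFun = s} => k.1.toFun :=
    Exponent.toFun_injective.comp Subtype.val_injective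
  rw [hset, hinj.encard_image]
  refine finrank_hom_eq (FModule.isBounded wt₁ wt₂) (FModule.locNilpotent wt₁ wt₂) hv0 hvw hvs
    (graded wt₁ wt₂ s).incl Subtype.val_injective
    (fun b : {b : Exponent n // deg b.toFun = s} => monomialVec wt₁ wt₂ b.1.toFun)
    (fun b => genWeight wt₁ wt₂ - weight b.1.toFun) (fun b => filtPrev wt₁ wt₂ b.1.toFun)
    (fun b => ?_) (fun b => monomialVec_mem_wtSpace b.1.toFun)
    (fun b α => eVec_lie_monomialVec_mem_filtPrev α b.1.toFun) ?_ ?_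
  · rw [filtPrev_eq]
    apply le_antisymm
    · exact iSup₂_le fun m hm => le_iSup₂_of_le
        (f := fun (l : {b : Exponent n // deg b.toFun = s}) (_ : l < b) =>
          LieSubmodule.lieSpan ℂ (Sl n) {monomialVec wt₁ wt₂ l.1.toFun})
        ⟨⟨m⟩, hm.1.trans b.2⟩ (Exponent.lt_iff.2 (Or.inr hm)) le_rfl
    · refine iSup₂_le fun l hl => ?_
      have hd : deg l.1.toFun = deg b.1.toFun := l.2.trans b.2.symm
      have hlt := (Exponent.lt_iff.1 (show l.1 < b.1 from hl)).resolve_left (by omega)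
      exact le_iSup₂_of_le (f := fun (m : PosRoot n → ℕ) (_ : deg m = deg b.1.toFun ∧
        (ht m < ht b.1.toFun ∨ ht m = ht b.1.toFun ∧ toLex m < toLex b.1.toFun)) =>
        LieSubmodule.lieSpan ℂ (Sl n) {monomialVec wt₁ wt₂ m}) l.1.toFun hlt le_rfl
  · rw [LieSubmodule.range_incl, graded_eq_monomialSpan]
    apply le_antisymm
    · refine LieSubmodule.lieSpan_le.2 ?_
      rintro _ ⟨m, hm, rfl⟩
      exact (le_iSup (fun b : {b : Exponent n // deg b.toFun = s} =>
        LieSubmodule.lieSpan ℂ (Sl n) {monomialVec wt₁ wt₂ b.1.toFun}) ⟨⟨m⟩, hm⟩)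
        (LieSubmodule.subset_lieSpan rfl)
    · refine iSup_le fun b => LieSubmodule.lieSpan_le.2 (Set.singleton_subset_iff.2 ?_)
      exact LieSubmodule.subset_lieSpan ⟨b.1.toFun, b.2, rfl⟩
  · refine Set.Finite.of_finite_image ?_ hinj.injOn
    rw [← hset]
    exact (finite_hwPoints wt₁ wt₂).subset fun _ h => h.1

end FModule

end SlCurrent

end

/-! ### The multiplicity formula -/

theorem mainTheorem8 (n : ℕ) (hn : 2 ≤ n) (wt₁ wt₂ τ : SlCurrent.DomWeight n)
    (V : Type*) [AddCommGroup V] [Module ℂ V] [LieRingModule (SlCurrent.Sl n) V]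
    [LieModule ℂ (SlCurrent.Sl n) V] [FiniteDimensional ℂ V]
    [LieModule.IsIrreducible ℂ (SlCurrent.Sl n) V] (hV : SlCurrent.HasHighestWeight V τ) :
    -- the multiplicity of `V(τ)` in `F`
    (Module.Finite ℂ (SlCurrent.FModule wt₁ wt₂ →ₗ⁅ℂ, SlCurrent.Sl n⁆ V) ∧
      (Module.finrank ℂ (SlCurrent.FModule wt₁ wt₂ →ₗ⁅ℂ, SlCurrent.Sl n⁆ V) : ℕ∞) =
        Set.encard {b ∈ SlCurrent.hwPoints wt₁ wt₂ |
          SlCurrent.weight b = wt₁.toDual + wt₂.toDual - τ.toDual}) ∧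
    -- the multiplicity of `V(τ)` in each graded component of `F`
    (∀ s : ℕ,
      Module.Finite ℂ (SlCurrent.FModule.graded wt₁ wt₂ s →ₗ⁅ℂ, SlCurrent.Sl n⁆ V) ∧
      (Module.finrank ℂ (SlCurrent.FModule.graded wt₁ wt₂ s →ₗ⁅ℂ, SlCurrent.Sl n⁆ V) : ℕ∞) =
        Set.encard {b ∈ SlCurrent.hwPoints wt₁ wt₂ |
          SlCurrent.weight b = wt₁.toDual + wt₂.toDual - τ.toDual ∧ SlCurrent.deg b = s}) ∧
    -- the resulting bound by lattice points of the Dyck path polytope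
    (Module.finrank ℂ (SlCurrent.FModule wt₁ wt₂ →ₗ⁅ℂ, SlCurrent.Sl n⁆ V) : ℕ∞) ≤
      Set.encard {b ∈ SlCurrent.pointSet wt₁ wt₂ |
        SlCurrent.weight b = wt₁.toDual + wt₂.toDual - τ.toDual} := by
  refine ⟨SlCurrent.FModule.finrank_hom hV,
    fun s => SlCurrent.FModule.finrank_hom_graded hV s, ?_⟩
  rw [(SlCurrent.FModule.finrank_hom (wt₁ := wt₁) (wt₂ := wt₂) hV).2]
  exact Set.encard_le_encard fun b hb => ⟨hb.1.1, hb.2⟩
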